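/- Let $r,T>0$, $d,m\in\mathbb N$ and $H\in(\frac12,1)$, let $W^H=(W^{H,1},\dots,W^{H,m})$ be independent fractional Brownian motions on $[0,T]$ with Hurst parameter $H$ (centered Gaussian processes with covariance $\frac12(s^{2H}+t^{2H}-|t-s|^{2H})$ and a.s. continuous paths) on a probability space $(\Omega,\mathcal F,\mathbb P)$. Consider $$X(t)=\eta(0)+\int_0^t b(s,X)\,ds+\int_0^t\sigma(s,X(s-r))\,dW^H_s,\quad t\in(0,T],\qquad X(t)=\eta(t),\quad t\in[-r,0],$$ where the last integral is a pathwise Riemann--Stieltjes integral. For $a<c$ let $W_0^{\alpha,\infty}(a,c;\mathbb R^d)$ be the space of measurable $f:[a,c]\to\mathbb R^d$ with $$\sup_{t\in[a,c]}\Big(|f(t)|+\int_a^t\frac{|f(t)-f(s)|}{(t-s)^{\alpha+1}}ds\Big)<\infty,$$ write $\|f\|_{\alpha,\infty(r)}$ for this norm when $[a,c]=[-r,T]$, and let $C^{\lambda}(a,c;\mathbb R^d)$ be the space of $\lambda$-Hölder continuous functions. Assume: (H1) $\sigma:[0,T]\times\mathbb R^d\to\mathbb R^{d\times m}$ is measurable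 and differentiable in $x$, and there are $\beta,\delta\in(0,1]$ and, for every $N\ge0$, $M_N>0$ such that for all $s,t\in[0,T]$ and $i=1,\dots,d$: $|\sigma(t,x)-\sigma(t,y)|\le M_0|x-y|$ for all $x,y$; $|\partial_{x_i}\sigma(t,x)-\partial_{x_i}\sigma(t,y)|\le M_N|x-y|^\delta$ for $|x|,|y|\le N$; and, for all $x$, $|\sigma(t,x)-\sigma(s,x)|+|\partial_{x_i}\sigma(t,x)-\partial_{x_i}\sigma(s,x)|\le M_0|t-s|^\beta$. (H2) $b:[0,T]\times C([-r,T];\mathbb R^d)\to\mathbb R^d$ is measurable, $b(t,f)$ depends only on $f|_{[-r,t]}$ for every $t>0$, and there are $b_0\in L^\rho(0,T)$ with $\rho\ge2$ and, for every $N\ge0$, $L_N>0$ such that for all $t\in[0,T]$: $|b(t,x)-b(t,y)|\le L_N\sup_{-r\le s\le t}|x(s)-y(s)|$ whenever $\sup_{[-r,T]}|x|\le N$ and $\sup_{[-r,T]}|y|\le N$; and $|b(t,x)|\le L_0\sup_{-r\le s\le t}|x(s)|+b_0(t)$ for all $x$. Suppose $\beta>1-H$ and $\delta>\frac1H-1$,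 put $\alpha_0=\min\{\frac12,\beta,\frac{\delta}{1+\delta}\}$, and let $\alpha\in(1-H,\alpha_0)$, $\rho\ge\frac1\alpha$ and $\eta\in W_0^{\alpha,\infty}(-r,0;\mathbb R^d)\cap C^{1-\alpha}(-r,0;\mathbb R^d)$. Then the equation has a unique solution $X\in L^0(\Omega,\mathcal F,\mathbb P;W_0^{\alpha,\infty}(-r,T;\mathbb R^d))$, and for $\mathbb P$-almost all $\omega$ one has $X(\omega,\cdot)\in C^{1-\alpha}(-r,T;\mathbb R^d)$. Moreover, if (H3) there are $\gamma\in[0,1]$ and $K_0>0$ with $|\sigma(t,x)|\le K_0(1+|x|^\gamma)$ for all $x\in\mathbb R^d$, $t\in[0,T]$, then $E\big(\|X\|_{\alpha',\infty(r)}^p\big)<\infty$ for all $p\ge1$ and all $\alpha'\in(1-H,\ \alpha_0\vee\frac{2-\gamma}4)$, where $\vee$ denotes the maximum; in particular this holds for $\alpha'=\alpha$. -/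

import Mathlib

open Set Filter Topology MeasureTheory ProbabilityTheory
open scoped ENNReal NNReal

namespace DelayFBM

/-- `ℝ^d` with its Euclidean norm. -/
abbrev E (d : ℕ) : Type := EuclideanSpace ℝ (Fin d)

/-- Real `d × m` matrices, with the Euclidean norm of the array of entries. -/
abbrev Mat (d m : ℕ) : Type := EuclideanSpace ℝ (Fin d × Fin m)

/-- The norm `sup_{t ∈ [a,b]} (|f(t)| + ∫_a^t |f(t) - f(s)| / (t - s)^(α+1) ds)`, with values
in `[0, ∞]`. -/
noncomputable def wNorm {d : ℕ} (α a b : ℝ) (f : ℝ → E d) : ℝ≥0∞ :=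
  ⨆ t ∈ Icc a b,
    (‖f t‖ₑ + ∫⁻ s in Ioo a t, ‖f t - f s‖ₑ / ENNReal.ofReal ((t - s) ^ (α + 1)))

/-- `f ∈ W_0^{α,∞}(a,b; ℝ^d)`; only the values of `f` on `[a,b]` matter. -/
def MemW {d : ℕ} (α a b : ℝ) (f : ℝ → E d) : Prop :=
  Measurable ((Icc a b).domRestrict f) ∧ wNorm α a b f < ∞

/-- `f ∈ C^lam(a,b; ℝ^d)`, the Hölder space of order `lam > 0`. As `[a,b]` is bounded, the sup norm
of such an `f` on `[a,b]` is automatically finite. -/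
def MemHolder {d : ℕ} (lam a b : ℝ) (f : ℝ → E d) : Prop :=
  ∃ C : ℝ≥0, HolderOnWith C lam.toNNReal f (Icc a b)

/-- `I` is the Riemann–Stieltjes integral `∫_a^b f dg`: the limit of the Riemann–Stieltjes sums
`∑ f(ξ_k) (g(t_{k+1}) - g(t_k))` over tagged partitions of `[a,b]`, as the mesh tends to `0`. -/
def HasRSIntegral (f g : ℝ → ℝ) (a b I : ℝ) : Prop :=
  ∀ ε > 0, ∃ δ > 0, ∀ (n : ℕ) (t ξ : ℕ → ℝ), t 0 = a → t n = b →
    (∀ k < n, t k ≤ t (k + 1) ∧ t (k + 1) - t k < δ ∧ ξ k ∈ Icc (t k) (t (k + 1))) →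
    |∑ k ∈ Finset.range n, f (ξ k) * (g (t (k + 1)) - g (t k)) - I| < ε

/-- `sup_{-r ≤ s ≤ t} |x(s)|` for a continuous path `x` on `[-r,T]`. -/
noncomputable def pathSup {d : ℕ} {r T : ℝ} (t : ℝ) (x : C(Icc (-r) T, E d)) : ℝ :=
  sSup ((fun s : Icc (-r) T => ‖x s‖) '' {s | (s : ℝ) ≤ t})

/-- Hypothesis (H1) on the diffusion coefficient, with exponents `β` and `δ`. The partial derivative
`∂_{x_i} σ(t,x)` is the derivative of `σ(t,·)` at `x` in the direction of the `i`-th basis vector. -/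
structure HypH1 {d m : ℕ} (T β δ : ℝ) (σ : ℝ → E d → Mat d m) : Prop where
  beta_mem : 0 < β ∧ β ≤ 1
  delta_mem : 0 < δ ∧ δ ≤ 1
  measurable : Measurable fun p : Icc (0 : ℝ) T × E d => σ p.1 p.2
  differentiable : ∀ t ∈ Icc 0 T, Differentiable ℝ (σ t)
  bounds : ∃ M : ℝ → ℝ, (∀ N, 0 ≤ N → 0 < M N) ∧
    (∀ t ∈ Icc 0 T, ∀ x y, ‖σ t x - σ t y‖ ≤ M 0 * ‖x - y‖) ∧
    (∀ N, 0 ≤ N → ∀ t ∈ Icc 0 T, ∀ x y, ‖x‖ ≤ N → ‖y‖ ≤ N → ∀ i : Fin d,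
      ‖fderiv ℝ (σ t) x (EuclideanSpace.single i 1) - fderiv ℝ (σ t) y (EuclideanSpace.single i 1)‖
        ≤ M N * ‖x - y‖ ^ δ) ∧
    (∀ t ∈ Icc 0 T, ∀ s ∈ Icc 0 T, ∀ x, ∀ i : Fin d,
      ‖σ t x - σ s x‖ +
        ‖fderiv ℝ (σ t) x (EuclideanSpace.single i 1)
          - fderiv ℝ (σ s) x (EuclideanSpace.single i 1)‖ ≤ M 0 * |t - s| ^ β)

/-- Hypothesis (H2) on the hereditary drift, with integrability exponent `ρ`. -/
structure HypH2 {d : ℕ} (r T : ℝ) (ρ : ℝ≥0∞) (b : ℝ → C(Icc (-r) T, E d) → E d) : Prop where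
  two_le : 2 ≤ ρ
  measurable : letI : MeasurableSpace C(Icc (-r) T, E d) := borel _
    Measurable fun p : Icc (0 : ℝ) T × C(Icc (-r) T, E d) => b p.1 p.2
  nonanticipating : ∀ t ∈ Ioc 0 T, ∀ x y : C(Icc (-r) T, E d),
    (∀ s : Icc (-r) T, (s : ℝ) ≤ t → x s = y s) → b t x = b t y
  bounds : ∃ (b₀ : ℝ → ℝ) (L : ℝ → ℝ), MemLp b₀ ρ (volume.restrict (Icc 0 T)) ∧
    (∀ N, 0 ≤ N → 0 < L N) ∧
    (∀ N, 0 ≤ N → ∀ t ∈ Icc 0 T, ∀ x y : C(Icc (-r) T, E d), ‖x‖ ≤ N → ‖y‖ ≤ N →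
      ‖b t x - b t y‖ ≤ L N * pathSup t (x - y)) ∧
    (∀ t ∈ Icc 0 T, ∀ x : C(Icc (-r) T, E d), ‖b t x‖ ≤ L 0 * pathSup t x + b₀ t)

/-- Hypothesis (H3) on the diffusion coefficient, with growth exponent `γ`. -/
def HypH3 {d m : ℕ} (T γ : ℝ) (σ : ℝ → E d → Mat d m) : Prop :=
  0 ≤ γ ∧ γ ≤ 1 ∧ ∃ K₀ > 0, ∀ t ∈ Icc 0 T, ∀ x, ‖σ t x‖ ≤ K₀ * (1 + ‖x‖ ^ γ)

/-- The restriction to `[-r,T]` of a function that is continuous there. -/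
def pathOf {d : ℕ} {r T : ℝ} {f : ℝ → E d} (hf : ContinuousOn f (Icc (-r) T)) :
    C(Icc (-r) T, E d) :=
  ⟨(Icc (-r) T).domRestrict f, hf.domRestrict⟩

/-- The path `f` solves, on `[-r,T]`, the delay equation driven by `g = (g_1, …, g_m)`
`f(t) = η(0) + ∫_0^t b(s,f) ds + ∫_0^t σ(s,f(s-r)) dg_s` for `t ∈ (0,T]`, `f = η` on `[-r,0]`.
The drift takes continuous paths as arguments, hence the requirement that `f` be continuous. The
Riemann–Stieltjes integrals `J i j = ∫_0^t σ_{ij}(s,f(s-r)) dg_j(s)` have to exist. -/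
def SolvesDelayEq {d m : ℕ} (r T : ℝ) (η : ℝ → E d) (b : ℝ → C(Icc (-r) T, E d) → E d)
    (σ : ℝ → E d → Mat d m) (g : Fin m → ℝ → ℝ) (f : ℝ → E d) : Prop :=
  (∀ t ∈ Icc (-r) 0, f t = η t) ∧
  ∃ hf : ContinuousOn f (Icc (-r) T),
    IntervalIntegrable (fun s => b s (pathOf hf)) volume 0 T ∧
    ∀ t ∈ Ioc 0 T, ∃ J : Fin d → Fin m → ℝ,
      (∀ i j, HasRSIntegral (fun s => σ s (f (s - r)) (i, j)) (g j) 0 t (J i j)) ∧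
      ∀ i, f t i = η 0 i + (∫ s in (0 : ℝ)..t, b s (pathOf hf)) i + ∑ j, J i j

/-- `B` is, on `[0,T]`, a fractional Brownian motion with Hurst parameter `H`: a centered Gaussian
process with covariance `(s^{2H} + t^{2H} - |t-s|^{2H}) / 2` and almost surely continuous paths. -/
structure IsFBM {Ω : Type*} [MeasurableSpace Ω] (H T : ℝ) (B : ℝ → Ω → ℝ) (P : Measure Ω) :
    Prop where
  gaussian : IsGaussianProcess (fun t : Icc (0 : ℝ) T => B t) P
  centered : ∀ t ∈ Icc 0 T, ∫ ω, B t ω ∂P = 0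
  covariance : ∀ s ∈ Icc 0 T, ∀ t ∈ Icc 0 T,
    cov[B s, B t; P] = (s ^ (2 * H) + t ^ (2 * H) - |t - s| ^ (2 * H)) / 2
  continuous : ∀ᵐ ω ∂P, ContinuousOn (fun t => B t ω) (Icc 0 T)

/-- `X ∈ L^0(Ω, F, P; W_0^{α,∞}(a,b; ℝ^d))`: almost every path of `X` belongs to `W_0^{α,∞}`, and `X`
is strongly measurable, i.e. an almost sure limit, in the norm of `W_0^{α,∞}`, of simple random
variables with values in that space. -/
def MemL0W {Ω : Type*} [MeasurableSpace Ω] {d : ℕ} (P : Measure Ω) (α a b : ℝ)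
    (X : Ω → ℝ → E d) : Prop :=
  (∀ᵐ ω ∂P, MemW α a b (X ω)) ∧
  ∃ U : ℕ → SimpleFunc Ω (ℝ → E d), (∀ n ω, MemW α a b (U n ω)) ∧
    ∀ᵐ ω ∂P, Tendsto (fun n => wNorm α a b (U n ω - X ω)) atTop (𝓝 0)

end DelayFBM

namespace DelayFBM

/-! ### Young integration -/

/-! The argument is pathwise; probability enters only through the regularity of the driver. Since `1
- α < H`, the paths of fractional Brownian motion are `(1-α)`-Hölder, with a Hölder constant that
has moments of all orders. If `x` is a `(1-α)`-Hölder path, then `σ(s, x(s-r))` is Hölder of order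
`min β (1-α)`. Because `α < β` and `α < 1/2`, the two exponents add up to more than `1`, so the
stochastic integral exists as a Young integral (`exists_young_integral`) and is again
`(1-α)`-Hölder.

The delay removes the difficulty of a fixed point in the rough term: up to time `t` the integral
sees the solution only up to `t - r`. Given a path `x`, let `z` be `η` continued by `η(0) + ∫ σ(s,
x(s-r)) dg`, and solve `y = z + ∫ b(s, y) ds`. This last equation involves only a Lebesgue integral
of a locally Lipschitz functional of linear growth, so Picard iteration and Gronwall's inequality in
exponential weights apply (`DriftBounds.exists_fixed`, `DriftBounds.norm_sub_le_of_fixed`). If two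
inputs agree up to `τ`, the outputs agree up to `τ + r`. Hence the iterates become stationary on
`[-r,T]` after finitely many steps, which gives existence (`exists_solution`), and the same
induction gives uniqueness (`SolvesDelayEq.eqOn`).

For the moments, one step turns a Hölder constant `A` into at most `c (1 + A) (1 + B)`, where `B` is
the Hölder constant of the driver. The number of steps is deterministic, so the Hölder constant of
the solution is at most a polynomial in `B`, and every power of it is integrable. Since the
admissible `α'` satisfy `α' < 1/2 < 1 - α`, this Hölder norm dominates the norm of `W_0^{α',∞}`
(`wNorm_le_of_holder`). Measurability is carried through the iteration: Young integrals are limits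
of Riemann sums over deterministic partitions, and the drift equation is solved by a continuous map.
-/

lemma sum_range_two_mul (a : ℕ → ℝ) (N : ℕ) :
    ∑ i ∈ Finset.range (2 * N), a i = ∑ k ∈ Finset.range N, (a (2 * k) + a (2 * k + 1)) := by
  induction N with
  | zero => simp
  | succ N ih => rw [Finset.sum_range_succ, ← ih, mul_add, mul_one, Finset.sum_range_succ,
      Finset.sum_range_succ, add_assoc]

lemma HasRSIntegral.congr {f f' g g' : ℝ → ℝ} {a b I : ℝ} (h : HasRSIntegral f g a b I)
    (hf : ∀ t ∈ Icc a b, f t = f' t) (hg : ∀ t ∈ Icc a b, g t = g' t) :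
    HasRSIntegral f' g' a b I := by
  intro ε hε
  obtain ⟨δ, hδ, H⟩ := h ε hε
  refine ⟨δ, hδ, fun n t ξ h0 hn ht => ?_⟩
  have hmono : ∀ i j, i ≤ j → j ≤ n → t i ≤ t j := by
    intro i j hij
    induction j, hij using Nat.le_induction with
    | base => intro _; exact le_rfl
    | succ j _ ih => intro hj; exact (ih (by omega)).trans (ht j (by omega)).1
  have hmem : ∀ k ≤ n, t k ∈ Icc a b := fun k hk =>
    ⟨h0 ▸ hmono 0 k (Nat.zero_le _) hk, hn ▸ hmono k n hk le_rfl⟩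
  have hsum : ∑ k ∈ Finset.range n, f' (ξ k) * (g' (t (k + 1)) - g' (t k)) =
      ∑ k ∈ Finset.range n, f (ξ k) * (g (t (k + 1)) - g (t k)) := by
    refine Finset.sum_congr rfl fun k hk => ?_
    have hk' := Finset.mem_range.1 hk
    have h1 := hmem k hk'.le
    have h2 := hmem (k + 1) hk'
    have h3 := (ht k hk').2.2
    rw [hf (ξ k) ⟨h1.1.trans h3.1, h3.2.trans h2.2⟩, hg _ h1, hg _ h2]
  rw [hsum]
  exact H n t ξ h0 hn ht

/-- The Riemann–Stieltjes sums over uniform partitions converge to the integral. -/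
lemma HasRSIntegral.tendsto_uniform {f g : ℝ → ℝ} {b I : ℝ} (hb : 0 ≤ b)
    (h : HasRSIntegral f g 0 b I) :
    Tendsto (fun n : ℕ => ∑ k ∈ Finset.range (n + 1), f (k * b / (n + 1)) *
      (g ((k + 1 : ℕ) * b / (n + 1)) - g (k * b / (n + 1)))) atTop (𝓝 I) := by
  rw [Metric.tendsto_atTop]
  intro ε hε
  obtain ⟨δ, hδ, H⟩ := h ε hε
  obtain ⟨N, hN⟩ := exists_nat_gt (b / δ)
  refine ⟨N, fun n hn => ?_⟩
  rw [Real.dist_eq]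
  have hn1 : (0 : ℝ) < n + 1 := by positivity
  refine H (n + 1) (fun k => k * b / (n + 1)) (fun k => k * b / (n + 1)) (by simp) ?_ ?_
  · push_cast; field_simp
  · intro k _
    have hle : (k : ℝ) * b / (n + 1) ≤ (k + 1 : ℕ) * b / (n + 1) := by
      push_cast; gcongr; linarith
    refine ⟨hle, ?_, le_rfl, hle⟩
    have : ((k + 1 : ℕ) : ℝ) * b / (n + 1) - k * b / (n + 1) = b / (n + 1) := by
      push_cast; field_simp; ring
    rw [this, div_lt_iff₀ hn1]
    rw [div_lt_iff₀ hδ] at hN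
    have : (N : ℝ) ≤ n := by exact_mod_cast hn
    nlinarith

/-- The condition `0 ≤ b` guarantees that `[0,b]` has partitions of arbitrarily small mesh;
otherwise the defining condition would be vacuous. -/
lemma HasRSIntegral.unique {f g : ℝ → ℝ} {b I J : ℝ} (hb : 0 ≤ b)
    (hI : HasRSIntegral f g 0 b I) (hJ : HasRSIntegral f g 0 b J) : I = J :=
  tendsto_nhds_unique (hI.tendsto_uniform hb) (hJ.tendsto_uniform hb)

/-- The constant in the Young–Loève estimate. -/
noncomputable def youngConst (θ : ℝ) : ℝ := 2 / (1 - 2 ^ (1 - θ))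

lemma two_rpow_lt_one {θ : ℝ} (hθ : 1 < θ) : (2 : ℝ) ^ (1 - θ) < 1 :=
  Real.rpow_lt_one_of_one_lt_of_neg (by norm_num) (by linarith)

lemma youngConst_pos {θ : ℝ} (hθ : 1 < θ) : 0 < youngConst θ :=
  div_pos two_pos (sub_pos.2 (two_rpow_lt_one hθ))

section Young

variable {f g : ℝ → ℝ} {T A B lam mu : ℝ}

lemma young_mul_le (hA : 0 ≤ A) (hB : 0 ≤ B) (hl : 0 < lam) (hm : 0 < mu)
    (hf : ∀ s ∈ Icc 0 T, ∀ t ∈ Icc 0 T, |f s - f t| ≤ A * |s - t| ^ lam)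
    (hg : ∀ s ∈ Icc 0 T, ∀ t ∈ Icc 0 T, |g s - g t| ≤ B * |s - t| ^ mu)
    {s t u v L : ℝ} (hs : s ∈ Icc 0 T) (ht : t ∈ Icc 0 T) (hu : u ∈ Icc 0 T) (hv : v ∈ Icc 0 T)
    (h1 : |s - t| ≤ L) (h2 : |u - v| ≤ L) :
    |(f s - f t) * (g u - g v)| ≤ A * B * L ^ (lam + mu) := by
  have hL : 0 ≤ L := (abs_nonneg _).trans h1
  rw [abs_mul, Real.rpow_add_of_nonneg hL hl.le hm.le]
  calc |f s - f t| * |g u - g v| ≤ (A * L ^ lam) * (B * L ^ mu) := by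
        gcongr
        · exact (hf s hs t ht).trans (by gcongr)
        · exact (hg u hu v hv).trans (by gcongr)
    _ = _ := by ring

/-- The Young–Loève estimate for Riemann–Stieltjes sums over arbitrary partitions. -/
lemma young_sum_le (hA : 0 ≤ A) (hB : 0 ≤ B) (hl : 0 < lam) (hm : 0 < mu) (hθ : 1 < lam + mu)
    (hf : ∀ s ∈ Icc 0 T, ∀ t ∈ Icc 0 T, |f s - f t| ≤ A * |s - t| ^ lam)
    (hg : ∀ s ∈ Icc 0 T, ∀ t ∈ Icc 0 T, |g s - g t| ≤ B * |s - t| ^ mu) (n : ℕ) :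
    ∀ u : ℕ → ℝ, (∀ k < n, u k ≤ u (k + 1)) → (∀ k ≤ n, u k ∈ Icc 0 T) →
      |∑ k ∈ Finset.range n, f (u k) * (g (u (k + 1)) - g (u k)) - f (u 0) * (g (u n) - g (u 0))|
        ≤ youngConst (lam + mu) * (A * B) * (u n - u 0) ^ (lam + mu) := by
  induction n using Nat.strong_induction_on with
  | _ n ih =>
  intro u hu hmem
  have hAB : 0 ≤ A * B := mul_nonneg hA hB
  have hK := youngConst_pos hθ
  have hmono : ∀ i j, i ≤ j → j ≤ n → u i ≤ u j := by
    intro i j hij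
    induction j, hij using Nat.le_induction with
    | base => intro _; exact le_rfl
    | succ j _ ih => intro hj; exact (ih (by omega)).trans (hu j (by omega))
  rcases Nat.eq_zero_or_pos n with rfl | hn
  · simp [Real.zero_rpow (by linarith : lam + mu ≠ 0)]
  set L := u n - u 0 with hL
  have hL0 : 0 ≤ L := sub_nonneg.2 (hmono 0 n (Nat.zero_le _) le_rfl)
  classical
  -- The interval containing the midpoint is cut out: `j` is the last index below `n` with `u j` in
  -- the left half, so the blocks `0..j` and `j+1..n` both have length at most `L / 2`, and the
  -- induction hypothesis applies to each.
  set j := Nat.findGreatest (fun k => u k ≤ (u 0 + u n) / 2) (n - 1) with hj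
  have hjle : j ≤ n - 1 := Nat.findGreatest_le _
  have hjP : u j ≤ (u 0 + u n) / 2 :=
    Nat.findGreatest_spec (P := fun k => u k ≤ (u 0 + u n) / 2) (Nat.zero_le (n - 1))
      (by have := hmono 0 n (Nat.zero_le _) le_rfl; linarith)
  have hj1 : u n - u (j + 1) ≤ L / 2 := by
    rcases Nat.lt_or_ge j (n - 1) with h | h
    · have := Nat.findGreatest_is_greatest (P := fun k => u k ≤ (u 0 + u n) / 2)
        (n := n - 1) (k := j + 1) (by omega) (by omega)
      linarith
    · have : j + 1 = n := by omega
      rw [this]; linarith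
  obtain ⟨m, hm'⟩ : ∃ m, n = (j + 1) + m := ⟨n - (j + 1), by omega⟩
  have ih1 := ih j (by omega) u (fun k hk => hu k (by omega)) (fun k hk => hmem k (by omega))
  have ih2 := ih m (by omega) (fun k => u (j + 1 + k)) (fun k hk => hu _ (by omega))
    (fun k hk => hmem _ (by omega))
  simp only [add_zero, ← hm'] at ih2
  have hm0 := hmem 0 (Nat.zero_le _)
  have hmj := hmem j (by omega)
  have hmj1 := hmem (j + 1) (by omega)
  have hmn := hmem n le_rfl
  have m1 := hmono 0 j (Nat.zero_le _) (by omega)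
  have m2 := hu j (by omega)
  have m3 := hmono (j + 1) n (by omega) le_rfl
  have e1 := young_mul_le (L := L) hA hB hl hm hf hg hmj hm0 hmj1 hmj
    (by rw [abs_of_nonneg] <;> linarith) (by rw [abs_of_nonneg] <;> linarith)
  have e2 := young_mul_le (L := L) hA hB hl hm hf hg hmj1 hm0 hmn hmj1
    (by rw [abs_of_nonneg] <;> linarith) (by rw [abs_of_nonneg] <;> linarith)
  have hpow : ∀ x, 0 ≤ x → x ≤ L / 2 → x ^ (lam + mu) ≤ (L / 2) ^ (lam + mu) := fun x h0 h1 => by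
    gcongr
  have p1 := hpow (u j - u 0) (by linarith) (by linarith)
  have p2 := hpow (u n - u (j + 1)) (by linarith) hj1
  have hhalf : (L / 2) ^ (lam + mu) * 2 = 2 ^ (1 - (lam + mu)) * L ^ (lam + mu) := by
    rw [Real.div_rpow hL0 two_pos.le, Real.rpow_sub two_pos, Real.rpow_one]; ring
  -- This identity fixes the constant: two blocks of half length contribute the factor `2 ^ (1 - θ)
  -- < 1`, and the two cross terms of the recombination contribute `2`.
  have hKeq : youngConst (lam + mu) * 2 ^ (1 - (lam + mu)) + 2 = youngConst (lam + mu) := by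
    have : (1 : ℝ) - 2 ^ (1 - (lam + mu)) ≠ 0 := (sub_pos.2 (two_rpow_lt_one hθ)).ne'
    unfold youngConst; field_simp; ring
  have hsum : ∑ k ∈ Finset.range n, f (u k) * (g (u (k + 1)) - g (u k)) =
      ∑ k ∈ Finset.range j, f (u k) * (g (u (k + 1)) - g (u k))
      + f (u j) * (g (u (j + 1)) - g (u j))
      + ∑ k ∈ Finset.range m, f (u (j + 1 + k)) * (g (u (j + 1 + (k + 1))) - g (u (j + 1 + k))) := by
    rw [hm', Finset.sum_range_add, Finset.sum_range_succ]; rfl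
  have key : ∑ k ∈ Finset.range n, f (u k) * (g (u (k + 1)) - g (u k))
        - f (u 0) * (g (u n) - g (u 0)) =
      (∑ k ∈ Finset.range j, f (u k) * (g (u (k + 1)) - g (u k)) - f (u 0) * (g (u j) - g (u 0)))
      + (∑ k ∈ Finset.range m, f (u (j + 1 + k)) * (g (u (j + 1 + (k + 1))) - g (u (j + 1 + k)))
          - f (u (j + 1)) * (g (u n) - g (u (j + 1))))
      + (f (u j) - f (u 0)) * (g (u (j + 1)) - g (u j))
      + (f (u (j + 1)) - f (u 0)) * (g (u n) - g (u (j + 1))) := by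
    rw [hsum]; ring
  rw [key]
  refine (abs_add_le _ _).trans ((add_le_add ((abs_add_le _ _).trans
    (add_le_add ((abs_add_le _ _).trans (add_le_add ih1 ih2)) e1)) e2).trans ?_)
  have hc : 0 ≤ youngConst (lam + mu) * (A * B) := by positivity
  calc _ ≤ youngConst (lam + mu) * (A * B) * (L / 2) ^ (lam + mu)
        + youngConst (lam + mu) * (A * B) * (L / 2) ^ (lam + mu)
        + A * B * L ^ (lam + mu) + A * B * L ^ (lam + mu) := by gcongr
    _ = (A * B) * (youngConst (lam + mu) * ((L / 2) ^ (lam + mu) * 2) + 2 * L ^ (lam + mu)) := by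
        ring
    _ = (A * B) * L ^ (lam + mu) * (youngConst (lam + mu) * 2 ^ (1 - (lam + mu)) + 2) := by
        rw [hhalf]; ring
    _ = _ := by rw [hKeq]; ring

/-- Left Riemann–Stieltjes sums over the dyadic grid of `[0,T]`, stopped at `t`. -/
noncomputable def dyadicSum (f g : ℝ → ℝ) (T : ℝ) (n : ℕ) (t : ℝ) : ℝ :=
  ∑ k ∈ Finset.range (2 ^ n), f (k * T / 2 ^ n) *
    (g (min ((k + 1 : ℕ) * T / 2 ^ n) t) - g (min (k * T / 2 ^ n) t))

lemma grid_mem (hT : 0 ≤ T) {n k : ℕ} (hk : k ≤ 2 ^ n) : (k : ℝ) * T / 2 ^ n ∈ Icc 0 T := by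
  refine ⟨by positivity, ?_⟩
  rw [div_le_iff₀ (by positivity), mul_comm]
  gcongr
  exact_mod_cast hk

lemma grid_diff (T : ℝ) (n k : ℕ) :
    ((k + 1 : ℕ) : ℝ) * T / 2 ^ n - k * T / 2 ^ n = T / 2 ^ n := by
  push_cast; ring

/-- Halving a grid cell changes the tag on its right half only, so the difference is a sum of
products of increments of `f` and `g`. -/
lemma dyadicSum_succ_sub (f g : ℝ → ℝ) (T : ℝ) (n : ℕ) (t : ℝ) :
    dyadicSum f g T (n + 1) t - dyadicSum f g T n t = ∑ k ∈ Finset.range (2 ^ n),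
      (f ((2 * k + 1 : ℕ) * T / 2 ^ (n + 1)) - f ((2 * k : ℕ) * T / 2 ^ (n + 1))) *
      (g (min ((2 * k + 2 : ℕ) * T / 2 ^ (n + 1)) t)
        - g (min ((2 * k + 1 : ℕ) * T / 2 ^ (n + 1)) t)) := by
  unfold dyadicSum
  rw [pow_succ' 2 n, sum_range_two_mul, ← Finset.sum_sub_distrib]
  refine Finset.sum_congr rfl fun k _ => ?_
  have e1 : ((2 * k : ℕ) : ℝ) * T / 2 ^ (n + 1) = k * T / 2 ^ n := by
    rw [pow_succ]; push_cast; field_simp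
  have e2 : ((2 * k + 2 : ℕ) : ℝ) * T / 2 ^ (n + 1) = (k + 1 : ℕ) * T / 2 ^ n := by
    rw [pow_succ]; push_cast; field_simp
  simp only [show 2 * k + 1 + 1 = 2 * k + 2 from rfl, e1, e2]
  ring

lemma min_sub_min_abs_le {a b t : ℝ} (h : a ≤ b) : |min b t - min a t| ≤ b - a := by
  have := abs_min_sub_min_le_max b t a t
  simp only [sub_self, abs_zero] at this
  rw [abs_of_nonneg (sub_nonneg.2 h), max_eq_left (sub_nonneg.2 h)] at this
  exact this

/-- Passing from level `n` to `n + 1` costs `2 ^ n` products of size `(T / 2 ^ n) ^ θ` with `θ = lam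
+ mu`, hence a geometric term of ratio `2 ^ (1 - θ)`. -/
lemma dyadicSum_cauchy (hT : 0 ≤ T) (hA : 0 ≤ A) (hB : 0 ≤ B) (hl : 0 < lam) (hm : 0 < mu)
    (hθ : 1 < lam + mu)
    (hf : ∀ s ∈ Icc 0 T, ∀ t ∈ Icc 0 T, |f s - f t| ≤ A * |s - t| ^ lam)
    (hg : ∀ s ∈ Icc 0 T, ∀ t ∈ Icc 0 T, |g s - g t| ≤ B * |s - t| ^ mu) {t : ℝ}
    (ht : t ∈ Icc 0 T) : CauchySeq fun n => dyadicSum f g T n t := by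
  refine cauchySeq_of_le_geometric (2 ^ (1 - (lam + mu))) (A * B * T ^ (lam + mu))
    (two_rpow_lt_one hθ) fun n => ?_
  rw [dist_comm, Real.dist_eq, dyadicSum_succ_sub]
  have hb : ∀ k ∈ Finset.range (2 ^ n),
      |(f ((2 * k + 1 : ℕ) * T / 2 ^ (n + 1)) - f ((2 * k : ℕ) * T / 2 ^ (n + 1))) *
      (g (min ((2 * k + 2 : ℕ) * T / 2 ^ (n + 1)) t)
        - g (min ((2 * k + 1 : ℕ) * T / 2 ^ (n + 1)) t))| ≤
      A * B * (T / 2 ^ n) ^ (lam + mu) := by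
    intro k hk
    have hk := Finset.mem_range.1 hk
    have hmem : ∀ i ≤ 2 * k + 2, ((i : ℕ) : ℝ) * T / 2 ^ (n + 1) ∈ Icc 0 T := fun i hi =>
      grid_mem hT (by rw [pow_succ]; omega)
    have hmin : ∀ i ≤ 2 * k + 2, min (((i : ℕ) : ℝ) * T / 2 ^ (n + 1)) t ∈ Icc 0 T := fun i hi =>
      ⟨le_min (hmem i hi).1 ht.1, (min_le_right _ _).trans ht.2⟩
    have hd := grid_diff T (n + 1) (2 * k)
    have hd' := grid_diff T (n + 1) (2 * k + 1)
    have hn : T / 2 ^ (n + 1) ≤ T / 2 ^ n := by gcongr <;> simp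
    have h0 : 0 ≤ T / 2 ^ (n + 1) := by positivity
    refine young_mul_le hA hB hl hm hf hg (hmem _ (by omega)) (hmem _ (by omega))
      (hmin _ (by omega)) (hmin _ (by omega)) ?_ ?_
    · rw [hd, abs_of_nonneg h0]; exact hn
    · exact (min_sub_min_abs_le (by linarith)).trans (hd'.le.trans hn)
  refine (Finset.abs_sum_le_sum_abs _ _).trans ((Finset.sum_le_sum hb).trans_eq ?_)
  rw [Finset.sum_const, Finset.card_range, nsmul_eq_mul, Real.div_rpow hT (by positivity)]
  have : ((2 : ℝ) ^ (1 - (lam + mu))) ^ n * ((2 : ℝ) ^ n) ^ (lam + mu) = 2 ^ n := by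
    rw [← Real.rpow_natCast (2 ^ (1 - (lam + mu))) n, ← Real.rpow_natCast 2 n,
      ← Real.rpow_mul two_pos.le, ← Real.rpow_mul two_pos.le, ← Real.rpow_add two_pos]
    congr 1; ring
  have h2 : ((2 : ℝ) ^ n) ^ (lam + mu) ≠ 0 := by positivity
  push_cast
  generalize ((2 : ℝ) ^ n) ^ (lam + mu) = q at *
  rw [← this]
  field_simp

/-- Clipping the grid to `[s,t]` gives a partition `u` to which the Young–Loève estimate applies.
The tags `c k` of the dyadic sum differ from `u k` effectively only in the cell containing `s`; this
is the source of the second error term, which vanishes as `n → ∞`. -/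
lemma dyadicSum_sub_le (hT : 0 ≤ T) (hA : 0 ≤ A) (hB : 0 ≤ B) (hl : 0 < lam) (hm : 0 < mu)
    (hθ : 1 < lam + mu)
    (hf : ∀ s ∈ Icc 0 T, ∀ t ∈ Icc 0 T, |f s - f t| ≤ A * |s - t| ^ lam)
    (hg : ∀ s ∈ Icc 0 T, ∀ t ∈ Icc 0 T, |g s - g t| ≤ B * |s - t| ^ mu) {s t : ℝ}
    (hs : s ∈ Icc 0 T) (ht : t ∈ Icc 0 T) (hst : s ≤ t) (n : ℕ) :
    |dyadicSum f g T n t - dyadicSum f g T n s - f s * (g t - g s)| ≤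
      youngConst (lam + mu) * (A * B) * (t - s) ^ (lam + mu)
        + A * B * (T / 2 ^ n) ^ (lam + mu) := by
  set c : ℕ → ℝ := fun k => (k : ℝ) * T / 2 ^ n with hc
  set u : ℕ → ℝ := fun k => max s (min (c k) t) with hu
  have hcm : ∀ i j, i ≤ j → c i ≤ c j := fun i j hij => by
    simp only [hc]; gcongr
  have hcd : ∀ k, c (k + 1) - c k = T / 2 ^ n := grid_diff T n
  have hc0 : ∀ k, 0 ≤ c k := fun k => by simp only [hc]; positivity
  have hcT : ∀ k ≤ 2 ^ n, c k ∈ Icc 0 T := fun k hk => grid_mem hT hk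
  have h0 : 0 ≤ T / 2 ^ n := by positivity
  have hgu : ∀ k, g (min (c k) t) - g (min (c k) s) = g (u k) - g s := by
    intro k
    simp only [hu]
    rcases le_total (c k) s with h | h
    · rw [min_eq_left h, min_eq_left (h.trans hst), max_eq_left h]; ring
    · rw [min_eq_right h, max_eq_right (le_min h hst)]
  have hum : ∀ k, u k ≤ u (k + 1) := fun k =>
    max_le_max le_rfl (min_le_min (hcm _ _ (Nat.le_succ k)) le_rfl)
  have humem : ∀ k, u k ∈ Icc 0 T := fun k =>
    ⟨hs.1.trans (le_max_left _ _), max_le hs.2 ((min_le_right _ _).trans ht.2)⟩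
  have hu0 : u 0 = s := by simp [hu, hc, hs.1, ht.1]
  have hun : u (2 ^ n) = t := by
    have : c (2 ^ n) = T := by simp [hc]
    simp only [hu, this, min_eq_right ht.2, max_eq_right hst]
  have hS : dyadicSum f g T n t - dyadicSum f g T n s =
      ∑ k ∈ Finset.range (2 ^ n), f (c k) * (g (u (k + 1)) - g (u k)) := by
    unfold dyadicSum
    rw [← Finset.sum_sub_distrib]
    refine Finset.sum_congr rfl fun k _ => ?_
    have h1 := hgu k
    have h2 := hgu (k + 1)
    simp only [hc] at h1 h2 ⊢
    linear_combination f (k * T / 2 ^ n) * (h2 - h1)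
  have hmax := young_sum_le hA hB hl hm hθ hf hg (2 ^ n) u (fun k _ => hum k) (fun k _ => humem k)
  rw [hu0, hun] at hmax
  have hdiff : |∑ k ∈ Finset.range (2 ^ n), (f (c k) - f (u k)) * (g (u (k + 1)) - g (u k))| ≤
      A * B * (T / 2 ^ n) ^ (lam + mu) := by
    have hnn : 0 ≤ A * B * (T / 2 ^ n) ^ (lam + mu) := by positivity
    -- only the grid interval containing `s` contributes
    have hz : ∀ k ∈ Finset.range (2 ^ n), ¬ (c k < s ∧ s < c (k + 1)) →
        (f (c k) - f (u k)) * (g (u (k + 1)) - g (u k)) = 0 := by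
      intro k _ hk
      rcases le_or_gt s (c k) with h | h
      · rcases le_total (c k) t with h' | h'
        · simp only [hu, min_eq_left h', max_eq_right h, sub_self, zero_mul]
        · have : c (k + 1) ≥ t := h'.trans (hcm _ _ (Nat.le_succ k))
          simp only [hu, min_eq_right h', min_eq_right this, sub_self, mul_zero]
      · have h' : c (k + 1) ≤ s := not_lt.1 fun h' => hk ⟨h, h'⟩
        simp only [hu, min_eq_left (h'.trans hst), min_eq_left (h.le.trans hst), max_eq_left h',
          max_eq_left h.le, sub_self, mul_zero]
    by_cases hex : ∃ k ∈ Finset.range (2 ^ n), c k < s ∧ s < c (k + 1)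
    · obtain ⟨k, hk, h1, h2⟩ := hex
      rw [Finset.sum_eq_single_of_mem k hk]
      · have hk' := Finset.mem_range.1 hk
        refine young_mul_le hA hB hl hm hf hg (hcT k hk'.le) (humem _) (humem _) (humem _) ?_ ?_
        · have : u k = s := by simp only [hu, min_eq_left (h1.le.trans hst), max_eq_left h1.le]
          rw [this, abs_sub_comm, abs_of_nonneg (by linarith)]
          linarith [hcd k]
        · have e1 : u k = s := by simp only [hu, min_eq_left (h1.le.trans hst), max_eq_left h1.le]
          have e2 : u (k + 1) ≤ c (k + 1) := max_le h2.le (min_le_left _ _)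
          rw [abs_of_nonneg (sub_nonneg.2 (hum k)), e1]
          linarith [hcd k]
      · intro i hi hik
        refine hz i hi fun ⟨h3, h4⟩ => hik ?_
        rcases Nat.lt_trichotomy i k with h | h | h
        · linarith [hcm (i + 1) k h]
        · exact h
        · linarith [hcm (k + 1) i h]
    · rw [Finset.sum_eq_zero fun k hk => hz k hk fun h => hex ⟨k, hk, h⟩, abs_zero]
      exact hnn
  rw [hS]
  have : ∑ k ∈ Finset.range (2 ^ n), f (c k) * (g (u (k + 1)) - g (u k)) - f s * (g t - g s) =
      (∑ k ∈ Finset.range (2 ^ n), f (u k) * (g (u (k + 1)) - g (u k)) - f s * (g t - g s)) +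
      ∑ k ∈ Finset.range (2 ^ n), (f (c k) - f (u k)) * (g (u (k + 1)) - g (u k)) := by
    simp only [sub_mul, Finset.sum_sub_distrib]; ring
  rw [this]
  exact (abs_add_le _ _).trans (add_le_add hmax hdiff)

/-- Young's theorem: existence of the Riemann–Stieltjes integral of Hölder functions whose
exponents have a sum larger than `1`, with the Young–Loève estimate. -/
theorem exists_young_integral (hT : 0 ≤ T) (hA : 0 ≤ A) (hB : 0 ≤ B) (hl : 0 < lam) (hm : 0 < mu)
    (hθ : 1 < lam + mu)
    (hf : ∀ s ∈ Icc 0 T, ∀ t ∈ Icc 0 T, |f s - f t| ≤ A * |s - t| ^ lam)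
    (hg : ∀ s ∈ Icc 0 T, ∀ t ∈ Icc 0 T, |g s - g t| ≤ B * |s - t| ^ mu) :
    ∃ J : ℝ → ℝ, J 0 = 0 ∧ (∀ t ∈ Icc 0 T, HasRSIntegral f g 0 t (J t)) ∧
      ∀ s ∈ Icc 0 T, ∀ t ∈ Icc 0 T, s ≤ t →
        |J t - J s - f s * (g t - g s)| ≤
          youngConst (lam + mu) * (A * B) * (t - s) ^ (lam + mu) := by
  have hlim : ∀ t ∈ Icc 0 T, ∃ l, Tendsto (fun n => dyadicSum f g T n t) atTop (𝓝 l) :=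
    fun t ht => cauchySeq_tendsto_of_complete (dyadicSum_cauchy hT hA hB hl hm hθ hf hg ht)
  choose! J hJ using hlim
  have h0 : J 0 = 0 := by
    refine tendsto_nhds_unique (hJ 0 ⟨le_rfl, hT⟩) ?_
    have : ∀ n, dyadicSum f g T n 0 = 0 := fun n => by
      refine Finset.sum_eq_zero fun k _ => ?_
      have e : ∀ k : ℕ, min ((k : ℝ) * T / 2 ^ n) 0 = 0 := fun k => min_eq_right (by positivity)
      rw [e, e, sub_self, mul_zero]
    simp only [this]; exact tendsto_const_nhds
  have hest : ∀ s ∈ Icc 0 T, ∀ t ∈ Icc 0 T, s ≤ t → |J t - J s - f s * (g t - g s)| ≤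
      youngConst (lam + mu) * (A * B) * (t - s) ^ (lam + mu) := by
    intro s hs t ht hst
    have h2n : Tendsto (fun n : ℕ => T / 2 ^ n) atTop (𝓝 0) :=
      tendsto_const_nhds.div_atTop (tendsto_pow_atTop_atTop_of_one_lt one_lt_two)
    have hr : Tendsto (fun n : ℕ => youngConst (lam + mu) * (A * B) * (t - s) ^ (lam + mu)
        + A * B * (T / 2 ^ n) ^ (lam + mu)) atTop
        (𝓝 (youngConst (lam + mu) * (A * B) * (t - s) ^ (lam + mu)
          + A * B * 0 ^ (lam + mu))) :=
      tendsto_const_nhds.add (tendsto_const_nhds.mul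
        (((Real.continuous_rpow_const (by linarith)).tendsto 0).comp h2n))
    rw [Real.zero_rpow (by linarith), mul_zero, add_zero] at hr
    exact le_of_tendsto_of_tendsto (((hJ t ht).sub (hJ s hs)).sub_const _).abs hr
      (Eventually.of_forall fun n => dyadicSum_sub_le hT hA hB hl hm hθ hf hg hs ht hst n)
  refine ⟨J, h0, fun b hb ε hε => ?_, hest⟩
  set K := youngConst (lam + mu) * (A * B) + A * B with hK
  have hKpos : 0 ≤ K := by have := youngConst_pos hθ; positivity
  -- Over a partition of mesh below `δ`, each cell contributes an error of at most `K δ ^ (θ - 1)`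
  -- times its length, so the total error is at most `K δ ^ (θ - 1) b`. This tends to `0` because `θ
  -- > 1`.
  have hlim : Tendsto (fun δ : ℝ => K * δ ^ (lam + mu - 1) * b) (𝓝[>] 0) (𝓝 0) := by
    have : Tendsto (fun δ : ℝ => K * δ ^ (lam + mu - 1) * b) (𝓝 0)
        (𝓝 (K * 0 ^ (lam + mu - 1) * b)) :=
      ((((Real.continuous_rpow_const (by linarith)).tendsto 0).const_mul K).mul_const b)
    rw [Real.zero_rpow (by linarith), mul_zero, zero_mul] at this
    exact this.mono_left nhdsWithin_le_nhds
  obtain ⟨δ, hδε, hδ⟩ := ((hlim.eventually (gt_mem_nhds hε)).and self_mem_nhdsWithin).exists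
  have hδ : 0 < δ := hδ
  refine ⟨δ, hδ, fun n t ξ ht0 htn ht => ?_⟩
  have hmono : ∀ i j, i ≤ j → j ≤ n → t i ≤ t j := by
    intro i j hij
    induction j, hij using Nat.le_induction with
    | base => intro _; exact le_rfl
    | succ j _ ih => intro hj; exact (ih (by omega)).trans (ht j (by omega)).1
  have hmem : ∀ k ≤ n, t k ∈ Icc 0 T := fun k hk =>
    ⟨ht0 ▸ hmono 0 k (Nat.zero_le _) hk, (hmono k n hk le_rfl).trans (htn ▸ hb.2)⟩
  have htel : J b = ∑ k ∈ Finset.range n, (J (t (k + 1)) - J (t k)) := by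
    rw [Finset.sum_range_sub (fun k => J (t k)), ht0, htn, h0, sub_zero]
  rw [htel, ← Finset.sum_sub_distrib]
  have hterm : ∀ k ∈ Finset.range n,
      |f (ξ k) * (g (t (k + 1)) - g (t k)) - (J (t (k + 1)) - J (t k))| ≤
        K * δ ^ (lam + mu - 1) * (t (k + 1) - t k) := by
    intro k hk
    have hk := Finset.mem_range.1 hk
    obtain ⟨h1, h2, h3⟩ := ht k hk
    have hm1 := hmem k hk.le
    have hm2 := hmem (k + 1) hk
    have e1 := hest _ hm1 _ hm2 h1
    have e2 := young_mul_le (L := t (k + 1) - t k) (s := ξ k) hA hB hl hm hf hg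
      ⟨hm1.1.trans h3.1, h3.2.trans hm2.2⟩ hm1 hm2 hm1
      (by rw [abs_of_nonneg (sub_nonneg.2 h3.1)]; linarith [h3.2])
      (by rw [abs_of_nonneg (sub_nonneg.2 h1)])
    have hpow : (t (k + 1) - t k) ^ (lam + mu) ≤ δ ^ (lam + mu - 1) * (t (k + 1) - t k) := by
      have hx : 0 ≤ t (k + 1) - t k := sub_nonneg.2 h1
      calc (t (k + 1) - t k) ^ (lam + mu)
          = (t (k + 1) - t k) ^ (lam + mu - 1) * (t (k + 1) - t k) := by
            rw [← Real.rpow_add_one' hx (by linarith)]; congr 1; ring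
        _ ≤ _ := by gcongr
    -- One error comes from the tag `ξ k` not being the left endpoint, the other from the
    -- Young–Loève estimate on the cell.
    calc _ = |(f (ξ k) - f (t k)) * (g (t (k + 1)) - g (t k))
          - (J (t (k + 1)) - J (t k) - f (t k) * (g (t (k + 1)) - g (t k)))| := by
          congr 1; ring
      _ ≤ _ := abs_sub _ _
      _ ≤ K * (t (k + 1) - t k) ^ (lam + mu) := by rw [hK]; linarith
      _ ≤ K * (δ ^ (lam + mu - 1) * (t (k + 1) - t k)) := by gcongr
      _ = _ := by ring
  refine (Finset.abs_sum_le_sum_abs _ _).trans_lt ((Finset.sum_le_sum hterm).trans_lt ?_)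
  rw [← Finset.mul_sum, Finset.sum_range_sub (fun k => t k), ht0, htn, sub_zero]
  exact hδε

end Young

/-! ### The drift equation -/

lemma integral_exp_mul {a : ℝ} (ha : a ≠ 0) (t : ℝ) :
    ∫ s in (0 : ℝ)..t, Real.exp (a * s) = (Real.exp (a * t) - 1) / a := by
  rw [intervalIntegral.integral_comp_mul_left (fun s => Real.exp s) ha, integral_exp]
  simp [div_eq_inv_mul]

lemma pathSup_le {d : ℕ} {r T t c : ℝ} {x : C(Icc (-r) T, E d)} (hc : 0 ≤ c)
    (h : ∀ s : Icc (-r) T, (s : ℝ) ≤ t → ‖x s‖ ≤ c) : pathSup t x ≤ c := by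
  refine Real.sSup_le ?_ hc
  rintro _ ⟨s, hs, rfl⟩
  exact h s hs

/-- Hölder's inequality for the primitive of an `L^p` function, `p = 1/α`. -/
lemma exists_primitive_bound {T α : ℝ} {b₀ : ℝ → ℝ} (hα : 0 < α) (hα1 : α < 1)
    (hb : MemLp b₀ (ENNReal.ofReal (1 / α)) (volume.restrict (Icc 0 T))) :
    ∃ C, 0 ≤ C ∧ ∀ s t, 0 ≤ s → s ≤ t → t ≤ T →
      ∫ u in s..t, |b₀ u| ≤ C * (t - s) ^ (1 - α) := by
  refine ⟨(eLpNorm b₀ (ENNReal.ofReal (1 / α)) (volume.restrict (Icc 0 T))).toReal,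
    ENNReal.toReal_nonneg, fun s t hs hst ht => ?_⟩
  have hsub : Ioc s t ⊆ Icc 0 T := fun u hu => ⟨hs.trans hu.1.le, hu.2.trans ht⟩
  have hr : volume.restrict (Ioc s t) ≤ (volume : Measure ℝ).restrict (Icc 0 T) :=
    Measure.restrict_mono hsub le_rfl
  have hmeas : AEStronglyMeasurable b₀ (volume.restrict (Ioc s t)) :=
    hb.aestronglyMeasurable.mono_measure hr
  have h1 : (1 : ℝ≥0∞) ≤ ENNReal.ofReal (1 / α) := by
    rw [← ENNReal.ofReal_one]
    exact ENNReal.ofReal_le_ofReal ((one_le_div hα).2 hα1.le)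
  have key := eLpNorm_le_eLpNorm_mul_rpow_measure_univ h1 hmeas
  have e1 : ∫ u in s..t, |b₀ u| = (eLpNorm b₀ 1 (volume.restrict (Ioc s t))).toReal := by
    rw [intervalIntegral.integral_of_le hst, eLpNorm_one_eq_lintegral_enorm,
      ← integral_norm_eq_lintegral_enorm hmeas]
    rfl
  rw [e1]
  have hts : 0 ≤ t - s := sub_nonneg.2 hst
  -- The Hölder exponent is `1/1 - 1/p` with `p = 1/α`, that is `1 - α`.
  have e2 : (volume.restrict (Ioc s t)) univ ^ (1 / (1 : ℝ≥0∞).toReal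
      - 1 / (ENNReal.ofReal (1 / α)).toReal) = ENNReal.ofReal ((t - s) ^ (1 - α)) := by
    rw [Measure.restrict_apply_univ, Real.volume_Ioc, ENNReal.toReal_ofReal (by positivity),
      ENNReal.ofReal_rpow_of_nonneg hts (by simp; linarith)]
    simp
  rw [e2] at key
  have key2 := key.trans (mul_le_mul_left (eLpNorm_mono_measure b₀ hr) _)
  have := ENNReal.toReal_mono (ENNReal.mul_ne_top hb.eLpNorm_ne_top ENNReal.ofReal_ne_top) key2
  rwa [ENNReal.toReal_mul, ENNReal.toReal_ofReal (by positivity)] at this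

/-- Bounds on the drift: integrability along paths, local Lipschitz continuity and linear growth
with respect to the running supremum, and a Hölder bound for the primitive of the inhomogeneity. -/
structure DriftBounds {d : ℕ} (r T α : ℝ) (b : ℝ → C(Icc (-r) T, E d) → E d) (b₀ L : ℝ → ℝ)
    (C : ℝ) : Prop where
  integrable : ∀ x, IntervalIntegrable (fun s => b s x) volume 0 T
  integrable₀ : IntervalIntegrable b₀ volume 0 T
  pos : ∀ N, 0 ≤ N → 0 < L N
  lipschitz : ∀ N, 0 ≤ N → ∀ t ∈ Icc 0 T, ∀ x y : C(Icc (-r) T, E d), ‖x‖ ≤ N → ‖y‖ ≤ N →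
      ‖b t x - b t y‖ ≤ L N * pathSup t (x - y)
  growth : ∀ t ∈ Icc 0 T, ∀ x : C(Icc (-r) T, E d), ‖b t x‖ ≤ L 0 * pathSup t x + |b₀ t|
  const_nonneg : 0 ≤ C
  primitive : ∀ s t, 0 ≤ s → s ≤ t → t ≤ T → ∫ u in s..t, |b₀ u| ≤ C * (t - s) ^ (1 - α)

lemma HypH2.exists_driftBounds {d : ℕ} {r T α : ℝ} {ρ : ℝ≥0∞}
    {b : ℝ → C(Icc (-r) T, E d) → E d} (h : HypH2 r T ρ b) (hT : 0 ≤ T) (hα : 0 < α) (hα1 : α < 1)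
    (hρ : ENNReal.ofReal (1 / α) ≤ ρ) : ∃ b₀ L C, DriftBounds r T α b b₀ L C := by
  obtain ⟨b₀, L, hb₀, hL, hlip, hgr⟩ := h.bounds
  obtain ⟨C, hC, hprim⟩ := exists_primitive_bound hα hα1 (hb₀.mono_exponent hρ)
  have h1ρ : (1 : ℝ≥0∞) ≤ ρ := le_trans (by norm_num) h.two_le
  have hint0 : IntegrableOn b₀ (Icc 0 T) volume := hb₀.integrable h1ρ
  have hgr' : ∀ t ∈ Icc 0 T, ∀ x : C(Icc (-r) T, E d), ‖b t x‖ ≤ L 0 * pathSup t x + |b₀ t| :=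
    fun t ht x => (hgr t ht x).trans (by gcongr; exact le_abs_self _)
  refine ⟨b₀, L, C, ⟨fun x => ?_, ?_, hL, hlip, hgr', hC, hprim⟩⟩
  · rw [intervalIntegrable_iff_integrableOn_Icc_of_le hT]
    have hmeas : AEMeasurable (fun s => b s x) (volume.restrict (Icc 0 T)) := by
      refine aemeasurable_restrict_of_measurable_subtype measurableSet_Icc ?_
      let _ : MeasurableSpace C(Icc (-r) T, E d) := borel _
      exact h.measurable.comp measurable_prodMk_right
    refine Integrable.mono' (g := fun t => L 0 * ‖x‖ + |b₀ t|)
      ((integrable_const _).add hint0.abs) hmeas.aestronglyMeasurable ?_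
    filter_upwards [ae_restrict_mem measurableSet_Icc] with t ht
    refine (hgr' t ht x).trans ?_
    have := (hL 0 le_rfl).le
    gcongr
    exact pathSup_le (norm_nonneg _) fun s _ => x.norm_coe_le_norm s
  · rw [intervalIntegrable_iff_integrableOn_Icc_of_le hT]
    exact hint0

/-! ### Picard iteration and Gronwall estimates with exponential weights -/

namespace DriftBounds

variable {d : ℕ} {r T α : ℝ} {b : ℝ → C(Icc (-r) T, E d) → E d} {b₀ L : ℝ → ℝ} {C : ℝ}

lemma intervalIntegrable_sub (hb : DriftBounds r T α b b₀ L C) {x : C(Icc (-r) T, E d)} {s t : ℝ}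
    (hs : s ∈ Icc 0 T) (ht : t ∈ Icc 0 T) :
    IntervalIntegrable (fun s => b s x) volume s t :=
  (hb.integrable x).mono_set (by
    rw [uIcc_of_le (hs.1.trans hs.2)]
    exact uIcc_subset_Icc hs ht)

lemma intervalIntegrable_sub₀ (hb : DriftBounds r T α b b₀ L C) {s t : ℝ}
    (hs : s ∈ Icc 0 T) (ht : t ∈ Icc 0 T) :
    IntervalIntegrable b₀ volume s t :=
  hb.integrable₀.mono_set (by
    rw [uIcc_of_le (hs.1.trans hs.2)]
    exact uIcc_subset_Icc hs ht)

/-- A continuous majorant `φ` stands in for the running supremum of `x - y`, so that no regularity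
of that supremum in time has to be established. -/
lemma norm_integral_sub_le (hb : DriftBounds r T α b b₀ L C) {N : ℝ} (hN : 0 ≤ N)
    {x y : C(Icc (-r) T, E d)} (hx : ‖x‖ ≤ N) (hy : ‖y‖ ≤ N) {t : ℝ} (ht : t ∈ Icc 0 T)
    {φ : ℝ → ℝ} (hφ : Continuous φ) (hφ0 : ∀ s, 0 ≤ φ s)
    (h : ∀ s ∈ Icc 0 t, ∀ u : Icc (-r) T, (u : ℝ) ≤ s → ‖x u - y u‖ ≤ φ s) :
    ‖(∫ s in (0 : ℝ)..t, b s x) - ∫ s in (0 : ℝ)..t, b s y‖ ≤ L N * ∫ s in (0 : ℝ)..t, φ s := by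
  have h0 : (0 : ℝ) ∈ Icc 0 T := ⟨le_rfl, ht.1.trans ht.2⟩
  rw [← intervalIntegral.integral_sub (hb.intervalIntegrable_sub h0 ht)
    (hb.intervalIntegrable_sub h0 ht), ← intervalIntegral.integral_const_mul]
  refine intervalIntegral.norm_integral_le_of_norm_le ht.1 ?_
    ((hφ.const_mul _).intervalIntegrable _ _)
  refine Eventually.of_forall fun s hs => ?_
  refine (hb.lipschitz N hN s ⟨hs.1.le, hs.2.trans ht.2⟩ x y hx hy).trans ?_
  have := (hb.pos N hN).le
  gcongr
  exact pathSup_le (hφ0 s) fun u hu => h s ⟨hs.1.le, hs.2⟩ u hu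

lemma norm_integral_le (hb : DriftBounds r T α b b₀ L C) {x : C(Icc (-r) T, E d)} {s t : ℝ}
    (hs : 0 ≤ s) (hst : s ≤ t) (ht : t ≤ T) {φ : ℝ → ℝ} (hφ : Continuous φ) (hφ0 : ∀ s, 0 ≤ φ s)
    (h : ∀ v ∈ Icc s t, ∀ u : Icc (-r) T, (u : ℝ) ≤ v → ‖x u‖ ≤ φ v) :
    ‖∫ v in s..t, b v x‖ ≤ L 0 * (∫ v in s..t, φ v) + C * (t - s) ^ (1 - α) := by
  have hint : IntervalIntegrable (fun v => |b₀ v|) volume s t :=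
    (hb.intervalIntegrable_sub₀ ⟨hs, hst.trans ht⟩ ⟨hs.trans hst, ht⟩).abs
  have hφi : IntervalIntegrable (fun v => L 0 * φ v) volume s t :=
    (hφ.const_mul _).intervalIntegrable _ _
  have h1 : ‖∫ v in s..t, b v x‖ ≤ ∫ v in s..t, (L 0 * φ v + |b₀ v|) := by
    refine intervalIntegral.norm_integral_le_of_norm_le hst ?_ (hφi.add hint)
    refine Eventually.of_forall fun v hv => ?_
    refine (hb.growth v ⟨hs.trans hv.1.le, hv.2.trans ht⟩ x).trans ?_
    have := (hb.pos 0 le_rfl).le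
    gcongr
    exact pathSup_le (hφ0 v) fun u hu => h v ⟨hv.1.le, hv.2⟩ u hu
  rw [intervalIntegral.integral_add hφi hint, intervalIntegral.integral_const_mul] at h1
  linarith [hb.primitive s t hs hst ht]

lemma max_mem {u : ℝ} (hT : 0 ≤ T) (hu : u ≤ T) : max u 0 ∈ Icc 0 T :=
  ⟨le_max_right _ _, max_le hu hT⟩

/-- The map whose fixed points solve `x = z + ∫ b(s,x) ds`. -/
noncomputable def picard (hb : DriftBounds r T α b b₀ L C) (hT : 0 ≤ T) (z x : C(Icc (-r) T, E d)) :
    C(Icc (-r) T, E d) where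
  -- With the upper limit `max t 0` the drift term vanishes on `[-r,0]`, where the path has to
  -- follow `z`.
  toFun t := z t + ∫ s in (0 : ℝ)..max (t : ℝ) 0, b s x
  continuous_toFun := by
    refine z.continuous.add ?_
    have h := intervalIntegral.continuousOn_primitive_interval' (hb.integrable x)
      (left_mem_uIcc (a := (0 : ℝ)) (b := T))
    rw [uIcc_of_le hT] at h
    exact h.comp_continuous (continuous_subtype_val.max continuous_const)
      fun t => max_mem hT t.2.2

lemma picard_apply (hb : DriftBounds r T α b b₀ L C) (hT : 0 ≤ T) (z x : C(Icc (-r) T, E d))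
    (t : Icc (-r) T) : hb.picard hT z x t = z t + ∫ s in (0 : ℝ)..max (t : ℝ) 0, b s x := rfl

/-- If `x - y` is dominated by `c e^{Λ t} + M e^{2 Λ t}`, then so is the difference of the images
under the Picard maps, with `M` replaced by `M / 2`. -/
lemma norm_picard_sub_le (hb : DriftBounds r T α b b₀ L C) (hT : 0 ≤ T) {N c M τ : ℝ} (hN : 0 ≤ N)
    (hc : 0 ≤ c) (hM : 0 ≤ M) {z z' x y : C(Icc (-r) T, E d)} (hx : ‖x‖ ≤ N) (hy : ‖y‖ ≤ N)
    (hz : ∀ u : Icc (-r) T, (u : ℝ) ≤ τ → ‖z u - z' u‖ ≤ c)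
    (h : ∀ u : Icc (-r) T, (u : ℝ) ≤ τ → ‖x u - y u‖ ≤
      c * Real.exp (L N * max (u : ℝ) 0) + M * Real.exp (2 * L N * max (u : ℝ) 0))
    (u : Icc (-r) T) (hu : (u : ℝ) ≤ τ) :
    ‖hb.picard hT z x u - hb.picard hT z' y u‖ ≤
      c * Real.exp (L N * max (u : ℝ) 0) + M / 2 * Real.exp (2 * L N * max (u : ℝ) 0) := by
  have hL := hb.pos N hN
  rw [picard_apply, picard_apply, add_sub_add_comm]
  refine (norm_add_le _ _).trans ?_
  set t := max (u : ℝ) 0 with ht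
  have htm : t ∈ Icc 0 T := max_mem hT u.2.2
  by_cases hu0 : (u : ℝ) ≤ 0
  · have : t = 0 := max_eq_right hu0
    simp only [this, intervalIntegral.integral_same, sub_self, norm_zero, add_zero, mul_zero,
      Real.exp_zero, mul_one]
    linarith [hz u hu]
  have htu : t = u := max_eq_left (not_le.1 hu0).le
  have hint := hb.norm_integral_sub_le hN hx hy htm
    (φ := fun s => c * Real.exp (L N * s) + M * Real.exp (2 * L N * s)) (by fun_prop)
    (fun s => by positivity) (fun s hs v hv => by
      refine (h v (by linarith [hs.2])).trans ?_
      have : max (v : ℝ) 0 ≤ s := max_le hv hs.1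
      gcongr)
  have hI : ∫ s in (0 : ℝ)..t, (c * Real.exp (L N * s) + M * Real.exp (2 * L N * s)) =
      c * ((Real.exp (L N * t) - 1) / L N) + M * ((Real.exp (2 * L N * t) - 1) / (2 * L N)) := by
    rw [intervalIntegral.integral_add (Continuous.intervalIntegrable (by fun_prop) _ _)
      (Continuous.intervalIntegrable (by fun_prop) _ _), intervalIntegral.integral_const_mul,
      intervalIntegral.integral_const_mul, integral_exp_mul hL.ne',
      integral_exp_mul (by positivity)]
  rw [hI] at hint
  -- Integration at rate `L N` reproduces the first weight up to `-c`, which absorbs the bound on `z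
  -- - z'`; the doubled rate of the second weight produces the factor `1/2`.
  have e : L N * (c * ((Real.exp (L N * t) - 1) / L N)
      + M * ((Real.exp (2 * L N * t) - 1) / (2 * L N))) =
      c * Real.exp (L N * t) - c + M / 2 * Real.exp (2 * L N * t) - M / 2 := by
    field_simp; ring
  rw [e] at hint
  linarith [hz u hu]

/-- Gronwall's inequality for solutions of the drift equation. -/
lemma norm_sub_le_of_fixed (hb : DriftBounds r T α b b₀ L C) (hT : 0 ≤ T) {N c τ : ℝ} (hN : 0 ≤ N)
    (hc : 0 ≤ c) {z z' x y : C(Icc (-r) T, E d)} (hx : ‖x‖ ≤ N) (hy : ‖y‖ ≤ N)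
    (hz : ∀ u : Icc (-r) T, (u : ℝ) ≤ τ → ‖z u - z' u‖ ≤ c)
    (hfx : ∀ u : Icc (-r) T, (u : ℝ) ≤ τ → x u = hb.picard hT z x u)
    (hfy : ∀ u : Icc (-r) T, (u : ℝ) ≤ τ → y u = hb.picard hT z' y u)
    (u : Icc (-r) T) (hu : (u : ℝ) ≤ τ) :
    ‖x u - y u‖ ≤ c * Real.exp (L N * max (u : ℝ) 0) := by
  have hL := hb.pos N hN
  -- Both paths are fixed by their Picard maps, so the estimate can be fed into itself: the crude
  -- term `‖x - y‖` is halved each time, and only the Gronwall term survives in the limit.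
  have key : ∀ n : ℕ, ∀ u : Icc (-r) T, (u : ℝ) ≤ τ → ‖x u - y u‖ ≤
      c * Real.exp (L N * max (u : ℝ) 0)
        + ‖x - y‖ * (1 / 2) ^ n * Real.exp (2 * L N * max (u : ℝ) 0) := by
    intro n
    induction n with
    | zero =>
      intro u _
      have h1 : ‖x u - y u‖ ≤ ‖x - y‖ := (x - y).norm_coe_le_norm u
      have h2 : 1 ≤ Real.exp (2 * L N * max (u : ℝ) 0) := Real.one_le_exp (by positivity)
      have h3 : 0 ≤ c * Real.exp (L N * max (u : ℝ) 0) := by positivity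
      simp only [pow_zero, mul_one]
      nlinarith [norm_nonneg (x - y)]
    | succ n ih =>
      intro u hu
      rw [hfx u hu, hfy u hu]
      have := hb.norm_picard_sub_le hT hN hc (by positivity) hx hy hz ih u hu
      rw [pow_succ]
      convert this using 3
      ring
  have hlim : Tendsto (fun n : ℕ => c * Real.exp (L N * max (u : ℝ) 0)
        + ‖x - y‖ * (1 / 2) ^ n * Real.exp (2 * L N * max (u : ℝ) 0)) atTop
        (𝓝 (c * Real.exp (L N * max (u : ℝ) 0)
        + ‖x - y‖ * 0 * Real.exp (2 * L N * max (u : ℝ) 0))) :=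
    ((tendsto_pow_atTop_nhds_zero_of_lt_one (by norm_num) (by norm_num)).const_mul _
      |>.mul_const _).const_add _
  rw [mul_zero, zero_mul, add_zero] at hlim
  exact ge_of_tendsto' hlim fun n => key n u hu

/-- The a priori bound on solutions of the drift equation. -/
noncomputable def aprioriBound (_ : DriftBounds r T α b b₀ L C) (z : C(Icc (-r) T, E d)) : ℝ :=
  (‖z‖ + C * T ^ (1 - α)) * Real.exp (L 0 * T)

lemma aprioriBound_nonneg (hb : DriftBounds r T α b b₀ L C) (hT : 0 ≤ T)
    (z : C(Icc (-r) T, E d)) : 0 ≤ hb.aprioriBound z := by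
  have := hb.const_nonneg
  unfold aprioriBound; positivity

/-- The bound is a supersolution: with `K = ‖z‖ + C T ^ (1 - α)`, the function `K e ^ (L 0 t)`
equals `K + L 0 ∫ K e ^ (L 0 s) ds`. It is therefore preserved by the Picard map, which confines the
iterates to a ball with a single Lipschitz constant `L N`. -/
lemma norm_picard_le (hb : DriftBounds r T α b b₀ L C) (hT : 0 ≤ T) (hα1 : α < 1)
    {z x : C(Icc (-r) T, E d)}
    (h : ∀ u : Icc (-r) T, ‖x u‖ ≤ (‖z‖ + C * T ^ (1 - α)) * Real.exp (L 0 * max (u : ℝ) 0))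
    (u : Icc (-r) T) :
    ‖hb.picard hT z x u‖ ≤ (‖z‖ + C * T ^ (1 - α)) * Real.exp (L 0 * max (u : ℝ) 0) := by
  have hL := hb.pos 0 le_rfl
  have hC := hb.const_nonneg
  set K := ‖z‖ + C * T ^ (1 - α) with hK
  have hK0 : 0 ≤ K := by positivity
  rw [picard_apply]
  refine (norm_add_le _ _).trans ?_
  by_cases hu0 : (u : ℝ) ≤ 0
  · have : max (u : ℝ) 0 = 0 := max_eq_right hu0
    simp only [this, intervalIntegral.integral_same, norm_zero, add_zero, mul_zero,
      Real.exp_zero, mul_one]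
    exact (z.norm_coe_le_norm u).trans (by rw [hK]; have : 0 ≤ C * T ^ (1 - α) := by positivity
                                           linarith)
  have htu : max (u : ℝ) 0 = u := max_eq_left (not_le.1 hu0).le
  rw [htu]
  have hint := hb.norm_integral_le (x := x) le_rfl (not_le.1 hu0).le u.2.2
    (φ := fun s => K * Real.exp (L 0 * s)) (by fun_prop)
    (fun s => by positivity) (fun s hs v hv => by
      refine (h v).trans ?_
      have : max (v : ℝ) 0 ≤ s := max_le hv hs.1
      gcongr)
  rw [intervalIntegral.integral_const_mul, integral_exp_mul hL.ne', sub_zero] at hint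
  have e : L 0 * (K * ((Real.exp (L 0 * u) - 1) / L 0)) = K * Real.exp (L 0 * u) - K := by
    field_simp
  have h2 : C * (u : ℝ) ^ (1 - α) ≤ C * T ^ (1 - α) := by
    have h0 : (0 : ℝ) ≤ u := (not_le.1 hu0).le
    have := u.2.2
    have : 0 ≤ 1 - α := by linarith
    gcongr
  rw [e] at hint
  have h3 := z.norm_coe_le_norm u
  linarith

/-- Existence for the drift equation, by Picard iteration. -/
theorem exists_fixed (hb : DriftBounds r T α b b₀ L C) (hT : 0 ≤ T) (hα1 : α < 1)
    (z : C(Icc (-r) T, E d)) :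
    ∃ x : C(Icc (-r) T, E d), hb.picard hT z x = x ∧ ‖x‖ ≤ hb.aprioriBound z := by
  have hC := hb.const_nonneg
  set X : ℕ → C(Icc (-r) T, E d) := fun n => (hb.picard hT z)^[n] 0 with hX
  have hsucc : ∀ n, X (n + 1) = hb.picard hT z (X n) := fun n =>
    Function.iterate_succ_apply' _ _ _
  set N := hb.aprioriBound z with hNdef
  have hN : 0 ≤ N := hb.aprioriBound_nonneg hT z
  have hL := hb.pos N hN
  have hbd' : ∀ n, ∀ u : Icc (-r) T,
      ‖X n u‖ ≤ (‖z‖ + C * T ^ (1 - α)) * Real.exp (L 0 * max (u : ℝ) 0) := by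
    intro n
    induction n with
    | zero => intro u; simp only [hX, Function.iterate_zero, id, ContinuousMap.zero_apply,
        norm_zero]; positivity
    | succ n ih => rw [hsucc]; exact hb.norm_picard_le hT hα1 ih
  have hbd : ∀ n, ‖X n‖ ≤ N := by
    intro n
    refine (ContinuousMap.norm_le _ hN).2 fun u => (hbd' n u).trans ?_
    have := (hb.pos 0 le_rfl).le
    have := (max_mem hT u.2.2).2
    rw [hNdef]; unfold aprioriBound
    gcongr
  -- The contraction estimate with `c = 0`: consecutive iterates have the same `z`, so only the
  -- halved term remains.
  have hdiff : ∀ n, ∀ u : Icc (-r) T, ‖X n u - X (n + 1) u‖ ≤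
      0 * Real.exp (L N * max (u : ℝ) 0)
        + N * (1 / 2) ^ n * Real.exp (2 * L N * max (u : ℝ) 0) := by
    intro n
    induction n with
    | zero =>
      intro u
      have h1 : ‖X 1 u‖ ≤ N := ((X 1).norm_coe_le_norm u).trans (hbd 1)
      have h2 : 1 ≤ Real.exp (2 * L N * max (u : ℝ) 0) := Real.one_le_exp (by positivity)
      simp only [hX, Function.iterate_zero, id, ContinuousMap.zero_apply, zero_sub, norm_neg]
      simp only [pow_zero, mul_one, zero_mul, zero_add]
      exact h1.trans (le_mul_of_one_le_right hN h2)
    | succ n ih =>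
      intro u
      rw [hsucc, hsucc (n + 1)]
      have := hb.norm_picard_sub_le (τ := u) hT hN le_rfl (by positivity) (hbd n) (hbd (n + 1))
        (z := z) (z' := z) (fun u _ => by simp) (fun v _ => ih v) u le_rfl
      rw [pow_succ]
      convert this using 3
      ring
  have hcauchy : CauchySeq X := by
    refine cauchySeq_of_le_geometric (1 / 2) (N * Real.exp (2 * L N * T)) (by norm_num) fun n => ?_
    rw [dist_eq_norm]
    refine (ContinuousMap.norm_le _ (by positivity)).2 fun u => ?_
    refine (hdiff n u).trans ?_
    have := (max_mem hT u.2.2).2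
    calc _ = N * Real.exp (2 * L N * max (u : ℝ) 0) * (1 / 2) ^ n := by ring
      _ ≤ _ := by gcongr
  obtain ⟨x, hx⟩ := cauchySeq_tendsto_of_complete hcauchy
  have hxN : ‖x‖ ≤ N := le_of_tendsto' hx.norm hbd
  refine ⟨x, ?_, hxN⟩
  have hlim2 : Tendsto (fun n => hb.picard hT z (X n)) atTop (𝓝 (hb.picard hT z x)) := by
    rw [tendsto_iff_norm_sub_tendsto_zero]
    have hx' := (tendsto_iff_norm_sub_tendsto_zero.1 hx).mul_const (L N * T)
    rw [zero_mul] at hx'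
    refine squeeze_zero (fun n => norm_nonneg _) (fun n => ?_) hx'
    refine (ContinuousMap.norm_le _ (by positivity)).2 fun u => ?_
    have htm := max_mem hT u.2.2
    have := hb.norm_integral_sub_le hN (hbd n) hxN htm (φ := fun _ => ‖X n - x‖)
      continuous_const (fun _ => norm_nonneg _)
      (fun s _ v _ => (X n - x).norm_coe_le_norm v)
    rw [ContinuousMap.sub_apply, picard_apply, picard_apply, add_sub_add_left_eq_sub]
    refine this.trans ?_
    rw [intervalIntegral.integral_const, smul_eq_mul, sub_zero]
    calc _ ≤ L N * (T * ‖X n - x‖) := by gcongr; exact htm.2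
      _ = _ := by ring
  refine tendsto_nhds_unique hlim2 ?_
  simp only [← hsucc]
  exact hx.comp (tendsto_add_atTop_nat 1)

/-- The solution of the drift equation `x = z + ∫ b(s,x) ds`. -/
noncomputable def solve (hb : DriftBounds r T α b b₀ L C) (hT : 0 ≤ T) (hα1 : α < 1)
    (z : C(Icc (-r) T, E d)) : C(Icc (-r) T, E d) := (hb.exists_fixed hT hα1 z).choose

lemma picard_solve (hb : DriftBounds r T α b b₀ L C) (hT : 0 ≤ T) (hα1 : α < 1)
    (z : C(Icc (-r) T, E d)) : hb.picard hT z (hb.solve hT hα1 z) = hb.solve hT hα1 z :=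
  (hb.exists_fixed hT hα1 z).choose_spec.1

lemma norm_solve_le (hb : DriftBounds r T α b b₀ L C) (hT : 0 ≤ T) (hα1 : α < 1)
    (z : C(Icc (-r) T, E d)) : ‖hb.solve hT hα1 z‖ ≤ hb.aprioriBound z :=
  (hb.exists_fixed hT hα1 z).choose_spec.2

lemma solve_apply (hb : DriftBounds r T α b b₀ L C) (hT : 0 ≤ T) (hα1 : α < 1)
    (z : C(Icc (-r) T, E d)) (u : Icc (-r) T) :
    hb.solve hT hα1 z u = z u + ∫ s in (0 : ℝ)..max (u : ℝ) 0, b s (hb.solve hT hα1 z) := by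
  conv_lhs => rw [← picard_solve]
  rfl

/-- Paths that agree up to time `τ` have solutions that agree up to time `τ`. -/
lemma eqOn_of_fixed (hb : DriftBounds r T α b b₀ L C) (hT : 0 ≤ T) {τ : ℝ}
    {z z' x y : C(Icc (-r) T, E d)}
    (hz : ∀ u : Icc (-r) T, (u : ℝ) ≤ τ → z u = z' u)
    (hfx : ∀ u : Icc (-r) T, (u : ℝ) ≤ τ → x u = hb.picard hT z x u)
    (hfy : ∀ u : Icc (-r) T, (u : ℝ) ≤ τ → y u = hb.picard hT z' y u)
    (u : Icc (-r) T) (hu : (u : ℝ) ≤ τ) : x u = y u := by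
  have := hb.norm_sub_le_of_fixed hT (N := max ‖x‖ ‖y‖) (by positivity) (le_refl 0)
    (le_max_left _ _) (le_max_right _ _) (fun u hu => by rw [hz u hu, sub_self, norm_zero])
    hfx hfy u hu
  rw [zero_mul] at this
  exact sub_eq_zero.1 (norm_le_zero_iff.1 this)

/-- For `z'` within distance `1` of `z` the a priori bounds share one constant `N`, and Gronwall's
inequality gives local Lipschitz continuity with factor `e ^ (L N T)`. Continuity is what later
makes random solutions measurable. -/
lemma continuous_solve (hb : DriftBounds r T α b b₀ L C) (hT : 0 ≤ T) (hα1 : α < 1) :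
    Continuous (hb.solve hT hα1) := by
  have hC := hb.const_nonneg
  rw [continuous_iff_continuousAt]
  intro z
  set N := (‖z‖ + 1 + C * T ^ (1 - α)) * Real.exp (L 0 * T) with hNdef
  have hN : 0 ≤ N := by positivity
  have hLN := hb.pos N hN
  have hloc : ∀ᶠ z' in 𝓝 z, ‖z' - z‖ ≤ 1 := by
    filter_upwards [Metric.closedBall_mem_nhds z one_pos] with z' hz'
    rwa [← dist_eq_norm]
  have hbound : ∀ z' : C(Icc (-r) T, E d), ‖z' - z‖ ≤ 1 → ‖hb.solve hT hα1 z'‖ ≤ N := by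
    intro z' hz'
    refine (hb.norm_solve_le hT hα1 z').trans ?_
    have : ‖z'‖ ≤ ‖z‖ + 1 := by
      have := norm_add_le (z' - z) z
      rw [sub_add_cancel] at this; linarith
    unfold aprioriBound
    rw [hNdef]
    gcongr
  show Tendsto _ _ _
  rw [tendsto_iff_norm_sub_tendsto_zero]
  have hlim : Tendsto (fun z' => ‖z' - z‖ * Real.exp (L N * T)) (𝓝 z) (𝓝 0) := by
    have hcont : Continuous fun z' : C(Icc (-r) T, E d) => ‖z' - z‖ * Real.exp (L N * T) := by
      fun_prop
    have := hcont.tendsto z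
    simp only [sub_self, norm_zero, zero_mul] at this
    exact this
  refine squeeze_zero' (Eventually.of_forall fun _ => norm_nonneg _) ?_ hlim
  filter_upwards [hloc] with z' hz'
  refine (ContinuousMap.norm_le _ (by positivity)).2 fun u => ?_
  refine (hb.norm_sub_le_of_fixed (τ := u) hT hN (norm_nonneg (z' - z)) (hbound z' hz')
    (hbound z (by simp)) (fun v _ => (z' - z).norm_coe_le_norm v)
    (fun v _ => by rw [picard_solve]) (fun v _ => by rw [picard_solve]) u le_rfl).trans ?_
  have := (max_mem hT u.2.2).2
  gcongr

/-- The solution map preserves Hölder continuity of exponent `1 - α`. -/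
lemma holder_solve (hb : DriftBounds r T α b b₀ L C) (hT : 0 ≤ T) (hα0 : 0 < α) (hα1 : α < 1)
    {z : C(Icc (-r) T, E d)} {A : ℝ}
    (hz : ∀ s t : Icc (-r) T, ‖z s - z t‖ ≤ A * |(s : ℝ) - t| ^ (1 - α)) (s t : Icc (-r) T) :
    ‖hb.solve hT hα1 z s - hb.solve hT hα1 z t‖ ≤
      (A + L 0 * hb.aprioriBound z * T ^ α + C) * |(s : ℝ) - t| ^ (1 - α) := by
  have hC := hb.const_nonneg
  have hL := (hb.pos 0 le_rfl).le
  have hK := hb.aprioriBound_nonneg hT z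
  wlog hst : (t : ℝ) ≤ s generalizing s t
  · rw [norm_sub_rev, abs_sub_comm]
    exact this t s (not_le.1 hst).le
  set x := hb.solve hT hα1 z with hx
  rw [hx, solve_apply hb hT hα1 z s, solve_apply hb hT hα1 z t, ← hx, add_sub_add_comm]
  have h0 : (0 : ℝ) ∈ Icc 0 T := ⟨le_rfl, hT⟩
  have hs := max_mem hT s.2.2
  have ht := max_mem hT t.2.2
  have hmm : max (t : ℝ) 0 ≤ max (s : ℝ) 0 := max_le_max hst le_rfl
  rw [intervalIntegral.integral_interval_sub_left (hb.intervalIntegrable_sub h0 hs)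
    (hb.intervalIntegrable_sub h0 ht)]
  have h1 := hb.norm_integral_le (x := x) ht.1 hmm hs.2 (φ := fun _ => hb.aprioriBound z)
    continuous_const (fun _ => hK)
    (fun v _ u _ => (x.norm_coe_le_norm u).trans (hb.norm_solve_le hT hα1 z))
  rw [intervalIntegral.integral_const, smul_eq_mul] at h1
  set D := max (s : ℝ) 0 - max (t : ℝ) 0 with hD
  have hD0 : 0 ≤ D := sub_nonneg.2 hmm
  have hDT : D ≤ T := by linarith [hs.2, ht.1]
  have hDst : D ≤ |(s : ℝ) - t| := by
    have := abs_max_sub_max_le_abs (s : ℝ) t 0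
    exact (le_abs_self _).trans this
  have hpow : D ^ (1 - α) ≤ |(s : ℝ) - t| ^ (1 - α) := by
    have : 0 ≤ 1 - α := by linarith
    gcongr
  -- The bounded part of the drift gives a Lipschitz term, which is turned into a `(1-α)`-Hölder one
  -- at the price of `T ^ α`.
  have hDpow : D ≤ T ^ α * D ^ (1 - α) := by
    calc D = D ^ α * D ^ (1 - α) := by
          rw [← Real.rpow_add_of_nonneg hD0 hα0.le (by linarith)]; simp
      _ ≤ _ := by gcongr
  refine (norm_add_le _ _).trans ((add_le_add (hz s t) h1).trans ?_)
  calc _ ≤ A * |(s : ℝ) - t| ^ (1 - α)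
        + (L 0 * (T ^ α * |(s : ℝ) - t| ^ (1 - α) * hb.aprioriBound z)
          + C * |(s : ℝ) - t| ^ (1 - α)) := by
        gcongr
        exact hDpow.trans (by gcongr)
    _ = _ := by ring

end DriftBounds

/-! ### The pathwise equation -/

lemma norm_le_sum_abs {d : ℕ} (v : E d) : ‖v‖ ≤ ∑ i, |v i| := by
  rw [EuclideanSpace.norm_eq]
  refine Real.sqrt_le_iff.2 ⟨Finset.sum_nonneg fun i _ => abs_nonneg _, ?_⟩
  exact Finset.sum_sq_le_sq_sum_of_nonneg fun i _ => abs_nonneg _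

lemma rpow_le_one_add {T e : ℝ} (hT : 0 ≤ T) (he : 0 ≤ e) (he1 : e ≤ 1) : T ^ e ≤ 1 + T := by
  rcases le_total T 1 with h | h
  · linarith [Real.rpow_le_one hT h he]
  · calc T ^ e ≤ T ^ (1 : ℝ) := Real.rpow_le_rpow_of_exponent_le h he1
      _ ≤ _ := by rw [Real.rpow_one]; linarith

/-- On a bounded interval a Hölder exponent may be lowered; the factor `1 + T` serves for all
exponents that occur. -/
lemma rpow_le_mul_rpow {T h lam e : ℝ} (hh : 0 ≤ h) (hhT : h ≤ T) (hlam : 0 ≤ lam)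
    (hle : lam ≤ e) (he : e ≤ lam + 1) : h ^ e ≤ (1 + T) * h ^ lam := by
  have : h ^ e = h ^ (e - lam) * h ^ lam := by
    rw [← Real.rpow_add_of_nonneg hh (by linarith) hlam]; congr 1; ring
  rw [this]
  gcongr
  exact (rpow_le_one_add hh (by linarith) (by linarith)).trans (by linarith)

/-- Lipschitz continuity in space and Hölder continuity in time of the diffusion coefficient. -/
structure DiffusionBounds {d m : ℕ} (T β M : ℝ) (σ : ℝ → E d → Mat d m) : Prop where
  pos : 0 < M
  lipschitz : ∀ t ∈ Icc 0 T, ∀ x y, ‖σ t x - σ t y‖ ≤ M * ‖x - y‖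
  holder : ∀ t ∈ Icc 0 T, ∀ s ∈ Icc 0 T, ∀ x, ‖σ t x - σ s x‖ ≤ M * |t - s| ^ β

lemma HypH1.exists_diffusionBounds {d m : ℕ} {T β δ : ℝ} {σ : ℝ → E d → Mat d m}
    (h : HypH1 T β δ σ) : ∃ M, DiffusionBounds T β M σ := by
  obtain ⟨M, hM, hlip, -, htime⟩ := h.bounds
  refine ⟨M 0, hM 0 le_rfl, hlip, fun t ht s hs x => ?_⟩
  -- The time regularity in (H1) is quantified over the coordinates `i`, hence says nothing when `d
  -- = 0`; then the matrices have no entries.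
  rcases Nat.eq_zero_or_pos d with rfl | hd
  · rw [Subsingleton.elim (σ t x) (σ s x), sub_self, norm_zero]
    have := hM 0 le_rfl
    positivity
  · exact (le_add_of_nonneg_right (norm_nonneg _)).trans (htime t ht s hs x ⟨0, hd⟩)

section Pathwise

variable {d m : ℕ} {r T α β M : ℝ}

/-- `z = η` on `[-r,0]`, and `z(t) = η(0) + ∫_0^t σ(s,x(s-r)) dg_s` on `[0,T]`. -/
def IsYoungPath (hrT : -r ≤ T) (η : ℝ → E d) (σ : ℝ → E d → Mat d m) (g : Fin m → ℝ → ℝ)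
    (x z : C(Icc (-r) T, E d)) : Prop :=
  (∀ u : Icc (-r) T, (u : ℝ) ≤ 0 → z u = η u) ∧
  ∀ u : Icc (-r) T, 0 ≤ (u : ℝ) → ∃ J : Fin d → Fin m → ℝ,
    (∀ i j, HasRSIntegral (fun s => σ s (IccExtend hrT x (s - r)) (i, j)) (g j) 0 u (J i j)) ∧
    ∀ i, z u i = η 0 i + ∑ j, J i j

/-- The delay gains a time span `r`: the integral up to `u` evaluates `x` only at times `s - r ≤ u -
r ≤ τ`. -/
lemma IsYoungPath.eqOn {hrT : -r ≤ T} {η : ℝ → E d} {σ : ℝ → E d → Mat d m} {g : Fin m → ℝ → ℝ}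
    {x x' z z' : C(Icc (-r) T, E d)} (hr : 0 ≤ r) (h : IsYoungPath hrT η σ g x z)
    (h' : IsYoungPath hrT η σ g x' z') {τ : ℝ}
    (hx : ∀ u : Icc (-r) T, (u : ℝ) ≤ τ → x u = x' u) (u : Icc (-r) T) (hu : (u : ℝ) ≤ τ + r) :
    z u = z' u := by
  rcases le_total (u : ℝ) 0 with h0 | h0
  · rw [h.1 u h0, h'.1 u h0]
  · obtain ⟨J, hJ, hz⟩ := h.2 u h0
    obtain ⟨J', hJ', hz'⟩ := h'.2 u h0
    ext i
    rw [hz, hz']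
    congr 1
    refine Finset.sum_congr rfl fun j _ => ?_
    refine ((hJ i j).congr (fun s hs => ?_) fun _ _ => rfl).unique h0 (hJ' i j)
    have hmem : s - r ∈ Icc (-r) T := ⟨by linarith [hs.1], by linarith [hs.2, u.2.2]⟩
    rw [IccExtend_of_mem _ _ hmem, IccExtend_of_mem _ _ hmem, hx _ (by
      show s - r ≤ τ
      linarith [hs.2])]

lemma DiffusionBounds.holder_comp {σ : ℝ → E d → Mat d m} (hσ : DiffusionBounds T β M σ)
    (hr : 0 ≤ r) (hrT : -r ≤ T) (hα0 : 0 < α) (hα1 : α < 1) (hβ0 : 0 < β) (hβ : β ≤ 1) {A : ℝ}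
    (hA : 0 ≤ A) {x : C(Icc (-r) T, E d)}
    (hx : ∀ s t : Icc (-r) T, ‖x s - x t‖ ≤ A * |(s : ℝ) - t| ^ (1 - α)) (i : Fin d) (j : Fin m) :
    ∀ s ∈ Icc 0 T, ∀ t ∈ Icc 0 T,
      |σ s (IccExtend hrT x (s - r)) (i, j) - σ t (IccExtend hrT x (t - r)) (i, j)| ≤
        M * (1 + T) * (1 + A) * |s - t| ^ min β (1 - α) := by
  intro s hs t ht
  have hM := hσ.pos
  have hms : s - r ∈ Icc (-r) T := ⟨by linarith [hs.1], by linarith [hs.2]⟩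
  have hmt : t - r ∈ Icc (-r) T := ⟨by linarith [ht.1], by linarith [ht.2]⟩
  rw [IccExtend_of_mem _ _ hms, IccExtend_of_mem _ _ hmt]
  set y := x ⟨s - r, hms⟩
  set y' := x ⟨t - r, hmt⟩
  have h1 : |σ s y (i, j) - σ t y' (i, j)| ≤ ‖σ s y - σ t y'‖ :=
    PiLp.norm_apply_le (σ s y - σ t y') (i, j)
  have h2 : ‖σ s y - σ t y'‖ ≤ M * ‖y - y'‖ + M * |s - t| ^ β := by
    have := norm_add_le (σ s y - σ s y') (σ s y' - σ t y')
    rw [sub_add_sub_cancel] at this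
    linarith [hσ.lipschitz s hs y y', hσ.holder s hs t ht y']
  have h3 : ‖y - y'‖ ≤ A * |s - t| ^ (1 - α) := by
    have := hx ⟨s - r, hms⟩ ⟨t - r, hmt⟩
    simpa using this
  have hst : |s - t| ≤ T := abs_sub_le_iff.2 ⟨by linarith [hs.2, ht.1], by linarith [hs.1, ht.2]⟩
  have hlam : 0 ≤ min β (1 - α) := le_min hβ0.le (by linarith)
  have h4 := rpow_le_mul_rpow (abs_nonneg (s - t)) hst hlam (min_le_left β (1 - α)) (by linarith)
  have h5 := rpow_le_mul_rpow (abs_nonneg (s - t)) hst hlam (min_le_right β (1 - α)) (by linarith)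
  calc _ ≤ M * (A * ((1 + T) * |s - t| ^ min β (1 - α)))
        + M * ((1 + T) * |s - t| ^ min β (1 - α)) := by
        refine h1.trans (h2.trans ?_)
        gcongr
        exact h3.trans (by gcongr)
    _ = _ := by ring

/-- The constant in the bound on the Young integral of `σ(s,x(s-r))`. -/
noncomputable def youngPathConst (d m : ℕ) (T α β M S D : ℝ) : ℝ :=
  D + d * (m * (S + (1 + youngConst (min β (1 - α) + (1 - α))) * (M * (1 + T) * (1 + T))))

/-- The integrand has Hölder order `min β (1 - α)` and the driver has order `1 - α`; the orders sum
to more than `1` because `α < β` and `α < 1/2`. The bound is of first order in `A` and in `B`, since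
`σ` is Lipschitz in space and the Young integral is bilinear. This keeps the iterated bounds
polynomial. -/
lemma DiffusionBounds.exists_isYoungPath {σ : ℝ → E d → Mat d m} (hσ : DiffusionBounds T β M σ)
    (hr : 0 ≤ r) (hT : 0 ≤ T) (hrT : -r ≤ T) (hα0 : 0 < α) (hα1 : α < 1 / 2) (hαβ : α < β)
    (hβ : β ≤ 1)
    {η : ℝ → E d} {D : ℝ} (hD : 0 ≤ D)
    (hη : ∀ s ∈ Icc (-r) 0, ∀ t ∈ Icc (-r) 0, ‖η s - η t‖ ≤ D * |s - t| ^ (1 - α))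
    {g : Fin m → ℝ → ℝ} {B : ℝ} (hB : 0 ≤ B)
    (hg : ∀ j, ∀ s ∈ Icc 0 T, ∀ t ∈ Icc 0 T, |g j s - g j t| ≤ B * |s - t| ^ (1 - α))
    {x : C(Icc (-r) T, E d)} {A : ℝ} (hA : 0 ≤ A)
    (hx : ∀ s t : Icc (-r) T, ‖x s - x t‖ ≤ A * |(s : ℝ) - t| ^ (1 - α))
    (hx0 : x ⟨-r, left_mem_Icc.2 hrT⟩ = η (-r)) :
    ∃ z : C(Icc (-r) T, E d), IsYoungPath hrT η σ g x z ∧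
      ∀ s t : Icc (-r) T, ‖z s - z t‖ ≤
        youngPathConst d m T α β M ‖σ 0 (η (-r))‖ D * ((1 + A) * (1 + B)) *
          |(s : ℝ) - t| ^ (1 - α) := by
  have hM := hσ.pos
  set lam := min β (1 - α) with hlam
  have hlam0 : 0 < lam := lt_min (by linarith) (by linarith)
  have hlam1 : lam ≤ 1 := (min_le_left _ _).trans hβ
  have hθ : 1 < lam + (1 - α) := by
    have : α < lam := lt_min hαβ (by linarith)
    linarith
  set K := youngConst (lam + (1 - α)) with hK
  have hK0 : 0 < K := youngConst_pos hθ
  set S := ‖σ 0 (η (-r))‖ with hS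
  set F := M * (1 + T) * (1 + A) with hF
  have hF0 : 0 ≤ F := by positivity
  have hfH := fun i j => hσ.holder_comp hr hrT hα0 (by linarith) (by linarith) hβ hA hx i j
  choose J hJ0 hJ hJest using fun i j =>
    exists_young_integral hT hF0 hB hlam0 (by linarith : 0 < 1 - α) hθ (hfH i j) (hg j)
  set c := S + (1 + K) * (M * (1 + T) * (1 + T)) with hc
  have hc0 : 0 ≤ c := by positivity
  have h0T : (0 : ℝ) ∈ Icc 0 T := ⟨le_rfl, hT⟩
  -- Hölder continuity of the integrals
  have hJH' : ∀ i j, ∀ s ∈ Icc 0 T, ∀ t ∈ Icc 0 T, s ≤ t →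
      |J i j t - J i j s| ≤ c * (1 + A) * B * |t - s| ^ (1 - α) := by
    intro i j s hs t ht hst
    set f := fun s => σ s (IccExtend hrT x (s - r)) (i, j) with hf
    have hts : 0 ≤ t - s := sub_nonneg.2 hst
    have hf0 : |f 0| ≤ S := by
      have hm0 : (0 : ℝ) - r ∈ Icc (-r) T := ⟨by linarith, by linarith⟩
      have : IccExtend hrT x (0 - r) = η (-r) := by
        rw [IccExtend_of_mem _ _ hm0, ← hx0]; congr 2; ring
      simp only [hf, this]
      exact PiLp.norm_apply_le (σ 0 (η (-r))) (i, j)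
    -- The integrand is bounded by its value at time `0`, which depends only on `η (-r)`, plus its
    -- Hölder oscillation.
    have hfs : |f s| ≤ S + F * (1 + T) := by
      have h1 := hfH i j s hs 0 h0T
      have h2 : |s - 0| ^ lam ≤ 1 + T := by
        rw [sub_zero, abs_of_nonneg hs.1]
        exact (rpow_le_one_add hs.1 hlam0.le hlam1).trans (by linarith [hs.2])
      have h3 : |f s| ≤ |f s - f 0| + |f 0| := by
        have := abs_add_le (f s - f 0) (f 0)
        rwa [sub_add_cancel] at this
      have h4 : F * |s - 0| ^ lam ≤ F * (1 + T) := by gcongr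
      linarith [h1.trans h4]
    have hpow : (t - s) ^ (lam + (1 - α)) ≤ (1 + T) * (t - s) ^ (1 - α) :=
      rpow_le_mul_rpow hts (by linarith [ht.2, hs.1]) (by linarith) (by linarith) (by linarith)
    have hgb := hg j t ht s hs
    rw [abs_of_nonneg hts] at hgb ⊢
    have hfg : |f s * (g j t - g j s)| ≤ (S + F * (1 + T)) * (B * (t - s) ^ (1 - α)) := by
      rw [abs_mul]; gcongr
    have h5 : |J i j t - J i j s| ≤
        |J i j t - J i j s - f s * (g j t - g j s)| + |f s * (g j t - g j s)| := by
      have := abs_add_le (J i j t - J i j s - f s * (g j t - g j s)) (f s * (g j t - g j s))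
      rwa [sub_add_cancel] at this
    have hS1 : S ≤ S * (1 + A) := le_mul_of_one_le_right (norm_nonneg _) (by linarith)
    calc _ ≤ K * (F * B) * ((1 + T) * (t - s) ^ (1 - α))
          + (S + F * (1 + T)) * (B * (t - s) ^ (1 - α)) := by
          refine h5.trans (add_le_add ((hJest i j s hs t ht hst).trans ?_) hfg)
          gcongr
      _ = (S + (1 + K) * (F * (1 + T))) * (B * (t - s) ^ (1 - α)) := by ring
      _ ≤ (S * (1 + A) + (1 + K) * (F * (1 + T))) * (B * (t - s) ^ (1 - α)) := by gcongr
      _ = _ := by rw [hc, hF]; ring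
  have hJH : ∀ i j, ∀ s ∈ Icc 0 T, ∀ t ∈ Icc 0 T,
      |J i j s - J i j t| ≤ c * (1 + A) * B * |s - t| ^ (1 - α) := by
    intro i j s hs t ht
    rcases le_total s t with h | h
    · rw [abs_sub_comm, abs_sub_comm s t]; exact hJH' i j s hs t ht h
    · exact hJH' i j t ht s hs h
  set V : ℝ → E d := fun t => WithLp.toLp 2 fun i => ∑ j, J i j t with hV
  have hV0 : V 0 = 0 := by ext i; simp [hV, hJ0]
  have hVH : ∀ s ∈ Icc 0 T, ∀ t ∈ Icc 0 T,
      ‖V s - V t‖ ≤ d * (m * c) * ((1 + A) * B) * |s - t| ^ (1 - α) := by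
    intro s hs t ht
    refine (norm_le_sum_abs _).trans ?_
    have : ∀ i ∈ Finset.univ, |(V s - V t) i| ≤ m * (c * (1 + A) * B * |s - t| ^ (1 - α)) := by
      intro i _
      have e : (V s - V t) i = ∑ j, (J i j s - J i j t) := by
        simp [hV, Finset.sum_sub_distrib]
      rw [e]
      refine (Finset.abs_sum_le_sum_abs _ _).trans
        ((Finset.sum_le_sum fun j _ => hJH i j s hs t ht).trans_eq ?_)
      simp
    refine (Finset.sum_le_sum this).trans_eq ?_
    simp only [Finset.sum_const, Finset.card_univ, Fintype.card_fin, nsmul_eq_mul]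
    ring
  -- `η` stopped at `0` plus the integral started at `0`; both clippings are `1`-Lipschitz in time,
  -- so the Hölder bounds of the two pieces simply add.
  set Z : Icc (-r) T → E d := fun u => η (min (u : ℝ) 0) + V (max (u : ℝ) 0) with hZ
  have hmin : ∀ u : Icc (-r) T, min (u : ℝ) 0 ∈ Icc (-r) 0 := fun u =>
    ⟨le_min u.2.1 (by linarith), min_le_right _ _⟩
  have hmax : ∀ u : Icc (-r) T, max (u : ℝ) 0 ∈ Icc 0 T := fun u =>
    ⟨le_max_right _ _, max_le u.2.2 hT⟩
  have hZH : ∀ s t : Icc (-r) T, ‖Z s - Z t‖ ≤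
      youngPathConst d m T α β M S D * ((1 + A) * (1 + B)) * |(s : ℝ) - t| ^ (1 - α) := by
    intro s t
    have h1 := hη _ (hmin s) _ (hmin t)
    have h2 := hVH _ (hmax s) _ (hmax t)
    have h3 : |min (s : ℝ) 0 - min (t : ℝ) 0| ≤ |(s : ℝ) - t| := by
      have := abs_min_sub_min_le_max (s : ℝ) 0 t 0
      simpa using this
    have h4 : |max (s : ℝ) 0 - max (t : ℝ) 0| ≤ |(s : ℝ) - t| := abs_max_sub_max_le_abs _ _ _
    have h1α : 0 ≤ 1 - α := by linarith
    have hAB : 1 ≤ (1 + A) * (1 + B) := one_le_mul_of_one_le_of_one_le (by linarith) (by linarith)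
    simp only [hZ]
    rw [add_sub_add_comm]
    refine (norm_add_le _ _).trans ?_
    calc _ ≤ D * |(s : ℝ) - t| ^ (1 - α)
          + d * (m * c) * ((1 + A) * B) * |(s : ℝ) - t| ^ (1 - α) := by
          refine add_le_add (h1.trans ?_) (h2.trans ?_) <;> gcongr
      _ = (D * 1 + d * (m * c) * ((1 + A) * B)) * |(s : ℝ) - t| ^ (1 - α) := by ring
      _ ≤ (D * ((1 + A) * (1 + B)) + d * (m * c) * ((1 + A) * (1 + B)))
            * |(s : ℝ) - t| ^ (1 - α) := by
          gcongr
          linarith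
      _ = _ := by unfold youngPathConst; rw [← hlam, ← hK, ← hc]; ring
  have hcont : Continuous Z := by
    refine (HolderWith.continuous (C := (youngPathConst d m T α β M S D
      * ((1 + A) * (1 + B))).toNNReal) (r := (1 - α).toNNReal) ?_ (by simp; linarith))
    intro s t
    rw [edist_eq_enorm_sub, edist_dist, Subtype.dist_eq, Real.dist_eq, Real.coe_toNNReal _ (by linarith),
      ENNReal.ofReal_rpow_of_nonneg (abs_nonneg _) (by linarith), ← ofReal_norm]
    rw [← ENNReal.ofReal, ← ENNReal.ofReal_mul' (by positivity)]
    exact ENNReal.ofReal_le_ofReal (hZH s t)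
  refine ⟨⟨Z, hcont⟩, ⟨fun u hu => ?_, fun u hu => ⟨fun i j => J i j u, fun i j =>
    hJ i j u ⟨hu, u.2.2⟩, fun i => ?_⟩⟩, hZH⟩
  · show Z u = _
    simp only [hZ, min_eq_left hu, max_eq_right hu, hV0, add_zero]
  · show Z u i = _
    simp only [hZ, min_eq_right hu, max_eq_left hu]
    simp [hV]

variable {b : ℝ → C(Icc (-r) T, E d) → E d} {b₀ L : ℝ → ℝ} {C : ℝ}

lemma solvesDelayEq_of_fixed (hb : DriftBounds r T α b b₀ L C) (hT : 0 ≤ T) (hrT : -r ≤ T)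
    {η : ℝ → E d} {σ : ℝ → E d → Mat d m} {g : Fin m → ℝ → ℝ} {x z : C(Icc (-r) T, E d)}
    (hz : IsYoungPath hrT η σ g x z) (hx : hb.picard hT z x = x) (hr : 0 ≤ r) :
    SolvesDelayEq r T η b σ g (IccExtend hrT x) := by
  have hcont : ContinuousOn (IccExtend hrT x) (Icc (-r) T) := x.continuous.Icc_extend'.continuousOn
  have hpath : pathOf hcont = x := by
    ext1 u
    exact IccExtend_val hrT x u
  have hval : ∀ u : Icc (-r) T, x u = z u + ∫ s in (0 : ℝ)..max (u : ℝ) 0, b s x := fun u => by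
    rw [← hb.picard_apply hT, hx]
  refine ⟨fun t ht => ?_, hcont, ?_, fun t ht => ?_⟩
  · have hm : t ∈ Icc (-r) T := ⟨ht.1, ht.2.trans hT⟩
    rw [IccExtend_of_mem _ _ hm, hval, hz.1 _ ht.2]
    simp [max_eq_right ht.2]
  · rw [hpath]; exact hb.integrable x
  · have hm : t ∈ Icc (-r) T := ⟨by linarith [ht.1], ht.2⟩
    obtain ⟨J, hJ, hJz⟩ := hz.2 ⟨t, hm⟩ ht.1.le
    refine ⟨J, hJ, fun i => ?_⟩
    rw [hpath, IccExtend_of_mem _ _ hm, hval, PiLp.add_apply, hJz]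
    simp only [max_eq_left ht.1.le]
    ring

/-- Subtracting the drift integral from a solution leaves its Young part `z`, so solutions are fixed
points of the Picard map of `z`. -/
lemma SolvesDelayEq.exists_fixed (hb : DriftBounds r T α b b₀ L C) (hr : 0 ≤ r) (hT : 0 ≤ T)
    (hrT : -r ≤ T)
    {η : ℝ → E d} {σ : ℝ → E d → Mat d m} {g : Fin m → ℝ → ℝ} {f : ℝ → E d}
    (hf : SolvesDelayEq r T η b σ g f) :
    ∃ x z : C(Icc (-r) T, E d), (∀ t (ht : t ∈ Icc (-r) T), f t = x ⟨t, ht⟩) ∧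
      IsYoungPath hrT η σ g x z ∧ hb.picard hT z x = x := by
  obtain ⟨h0, hcont, -, heq⟩ := hf
  set x := pathOf hcont with hx
  have hfx : ∀ t (ht : t ∈ Icc (-r) T), f t = x ⟨t, ht⟩ := fun t ht => rfl
  set z := x - hb.picard hT 0 x with hz
  have hzv : ∀ u : Icc (-r) T, z u = x u - ∫ s in (0 : ℝ)..max (u : ℝ) 0, b s x := fun u => by
    rw [hz, ContinuousMap.sub_apply, hb.picard_apply, ContinuousMap.zero_apply, zero_add]
  have hz0 : ∀ u : Icc (-r) T, (u : ℝ) ≤ 0 → z u = η u := fun u hu => by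
    rw [hzv, max_eq_right hu, intervalIntegral.integral_same, sub_zero, ← h0 u ⟨u.2.1, hu⟩]
    rfl
  refine ⟨x, z, hfx, ⟨hz0, fun u hu => ?_⟩, ?_⟩
  · rcases hu.eq_or_lt with hu0 | hu0
    -- At time `0` the equation provides no integral, as it is imposed on `(0,T]` only; all
    -- partitions of `[0,0]` are constant, so the integral is `0`.
    · refine ⟨fun _ _ => 0, fun i j ε hε => ⟨1, one_pos, fun n t ξ ht0 htn ht => ?_⟩, fun i => ?_⟩
      · have hmono : ∀ i j, i ≤ j → j ≤ n → t i ≤ t j := by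
          intro i j hij
          induction j, hij using Nat.le_induction with
          | base => intro _; exact le_rfl
          | succ j _ ih => intro hj; exact (ih (by omega)).trans (ht j (by omega)).1
        have hz : ∀ k ≤ n, t k = 0 := fun k hk => le_antisymm
          ((hmono k n hk le_rfl).trans (by rw [htn, ← hu0])) (ht0 ▸ hmono 0 k (Nat.zero_le _) hk)
        rw [Finset.sum_eq_zero, sub_zero, abs_zero]
        · exact hε
        · intro k hk
          have := Finset.mem_range.1 hk
          rw [hz k this.le, hz (k + 1) this, sub_self, mul_zero]
      · rw [hz0 u hu0.symm.le, ← hu0]; simp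
    · obtain ⟨J, hJ, hJf⟩ := heq u ⟨hu0, u.2.2⟩
      refine ⟨J, fun i j => (hJ i j).congr (fun s hs => ?_) fun _ _ => rfl, fun i => ?_⟩
      · have hmem : s - r ∈ Icc (-r) T := ⟨by linarith [hs.1], by linarith [hs.2, u.2.2]⟩
        rw [IccExtend_of_mem _ _ hmem, hfx _ hmem]
      · have e : x u i = f u i := rfl
        rw [hzv, PiLp.sub_apply, e, hJf i, max_eq_left hu]
        ring
  · ext1 u
    rw [hb.picard_apply, hzv, sub_add_cancel]

/-- Pathwise uniqueness. -/
lemma SolvesDelayEq.eqOn (hb : DriftBounds r T α b b₀ L C) (hr : 0 < r) (hT : 0 ≤ T)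
    {η : ℝ → E d} {σ : ℝ → E d → Mat d m} {g : Fin m → ℝ → ℝ} {f f' : ℝ → E d}
    (hf : SolvesDelayEq r T η b σ g f) (hf' : SolvesDelayEq r T η b σ g f') :
    ∀ t ∈ Icc (-r) T, f t = f' t := by
  have hrT : -r ≤ T := by linarith
  obtain ⟨x, z, hfx, hz, hx⟩ := hf.exists_fixed hb hr.le hT hrT
  obtain ⟨x', z', hfx', hz', hx'⟩ := hf'.exists_fixed hb hr.le hT hrT
  -- Agreement up to `n r` makes the Young parts agree up to `(n + 1) r`, and uniqueness for the
  -- drift equation transfers this to the solutions.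
  have key : ∀ n : ℕ, ∀ u : Icc (-r) T, (u : ℝ) ≤ n * r → x u = x' u := by
    intro n
    induction n with
    | zero =>
      intro u hu
      have hu : (u : ℝ) ≤ 0 := by simpa using hu
      rw [← hx, ← hx', hb.picard_apply, hb.picard_apply, hz.1 u hu, hz'.1 u hu, max_eq_right hu]
      simp
    | succ n ih =>
      refine hb.eqOn_of_fixed hT (z := z) (z' := z') (fun u hu => hz.eqOn hr.le hz' ih u ?_)
        (fun u _ => by rw [hx]) (fun u _ => by rw [hx'])
      push_cast at hu; linarith
  obtain ⟨n, hn⟩ := exists_nat_gt (T / r)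
  rw [div_lt_iff₀ hr] at hn
  intro t ht
  rw [hfx t ht, hfx' t ht]
  exact key n _ (ht.2.trans hn.le)

/-- Used to return from the regular measurable version of the driver to the given process. -/
lemma SolvesDelayEq.congr_driver {η : ℝ → E d} {σ : ℝ → E d → Mat d m} {g g' : Fin m → ℝ → ℝ}
    {f : ℝ → E d} (hf : SolvesDelayEq r T η b σ g f)
    (hg : ∀ j, ∀ t ∈ Icc 0 T, g j t = g' j t) : SolvesDelayEq r T η b σ g' f := by
  obtain ⟨h0, hcont, hint, heq⟩ := hf
  refine ⟨h0, hcont, hint, fun t ht => ?_⟩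
  obtain ⟨J, hJ, hJf⟩ := heq t ht
  exact ⟨J, fun i j => (hJ i j).congr (fun _ _ => rfl)
    fun s hs => hg j s ⟨hs.1, hs.2.trans ht.2⟩, hJf⟩

end Pathwise

/-! ### Regularity of fractional Brownian motion -/

/-- The constant in the dyadic chaining argument. -/
noncomputable def chainConst (lam : ℝ) : ℝ := (1 + 2 / (1 - 2 ^ (-lam))) * 2 ^ lam

lemma two_rpow_neg_lt_one {lam : ℝ} (hl : 0 < lam) : (2 : ℝ) ^ (-lam) < 1 :=
  Real.rpow_lt_one_of_one_lt_of_neg (by norm_num) (by linarith)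

lemma chainConst_pos {lam : ℝ} (hl : 0 < lam) : 0 < chainConst lam := by
  have := sub_pos.2 (two_rpow_neg_lt_one hl)
  unfold chainConst; positivity

lemma floor_grid_mem {t : ℝ} (ht : t ∈ Icc (0 : ℝ) 1) (n : ℕ) :
    (⌊t * 2 ^ n⌋₊ : ℝ) / 2 ^ n ∈ Icc (0 : ℝ) 1 := by
  have h0 : 0 ≤ t * 2 ^ n := mul_nonneg ht.1 (by positivity)
  refine ⟨by positivity, ?_⟩
  rw [div_le_one (by positivity)]
  exact (Nat.floor_le h0).trans (mul_le_of_le_one_left (by positivity) ht.2)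

lemma tendsto_floor_grid {t : ℝ} (ht : 0 ≤ t) :
    Tendsto (fun n : ℕ => (⌊t * 2 ^ n⌋₊ : ℝ) / 2 ^ n) atTop (𝓝 t) := by
  have h := (tendsto_nat_floor_mul_div_atTop ht).comp
    (tendsto_pow_atTop_atTop_of_one_lt (one_lt_two (α := ℝ)))
  exact h

/-- A continuous function on `[0,1]` with controlled dyadic increments is Hölder continuous. -/
lemma holder_of_dyadic {f : ℝ → ℝ} (hf : ContinuousOn f (Icc 0 1)) {G lam : ℝ} (hG : 0 ≤ G)
    (hl : 0 < lam)
    (h : ∀ n k : ℕ, k < 2 ^ n →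
      |f ((k + 1 : ℕ) / 2 ^ n) - f (k / 2 ^ n)| ≤ G * ((2 : ℝ) ^ (-lam)) ^ n) :
    ∀ s ∈ Icc (0 : ℝ) 1, ∀ t ∈ Icc (0 : ℝ) 1, |f s - f t| ≤ chainConst lam * G * |s - t| ^ lam := by
  set q := (2 : ℝ) ^ (-lam) with hq
  have hq0 : 0 < q := by positivity
  have hq1 : q < 1 := two_rpow_neg_lt_one hl
  -- The largest dyadic point of level `n` not exceeding `t`. Successive approximations are equal or
  -- neighbours on the finer grid, so `f (a n t)` converges geometrically.
  set a : ℕ → ℝ → ℝ := fun n t => (⌊t * 2 ^ n⌋₊ : ℝ) / 2 ^ n with ha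
  have hstep : ∀ t ∈ Icc (0 : ℝ) 1, ∀ n, dist (f (a n t)) (f (a (n + 1) t)) ≤ G * q ^ n := by
    intro t ht n
    have h0 : 0 ≤ t * 2 ^ n := mul_nonneg ht.1 (by positivity)
    have h0' : 0 ≤ t * 2 ^ (n + 1) := mul_nonneg ht.1 (by positivity)
    set k := ⌊t * 2 ^ n⌋₊ with hk
    have e1 : a n t = (2 * k : ℕ) / 2 ^ (n + 1) := by
      simp only [ha, ← hk]; rw [pow_succ]; push_cast; field_simp
    have hk1 : 2 * k ≤ ⌊t * 2 ^ (n + 1)⌋₊ := by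
      refine Nat.le_floor ?_
      have := Nat.floor_le h0
      push_cast; rw [pow_succ]; linarith
    have hk2 : ⌊t * 2 ^ (n + 1)⌋₊ < 2 * k + 2 := by
      refine (Nat.floor_lt h0').2 ?_
      have := Nat.lt_floor_add_one (t * 2 ^ n)
      push_cast; rw [pow_succ]; linarith
    rcases (by omega : ⌊t * 2 ^ (n + 1)⌋₊ = 2 * k ∨ ⌊t * 2 ^ (n + 1)⌋₊ = 2 * k + 1) with hc | hc
    · have e2 : a (n + 1) t = (2 * k : ℕ) / 2 ^ (n + 1) := by simp only [ha, hc]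
      rw [e1, e2, dist_self]; positivity
    · have e2 : a (n + 1) t = (2 * k + 1 : ℕ) / 2 ^ (n + 1) := by simp only [ha, hc]
      have hlt : 2 * k < 2 ^ (n + 1) := by
        have h1 := (floor_grid_mem ht (n + 1)).2
        rw [div_le_one (by positivity), hc] at h1
        have : 2 * k + 1 ≤ 2 ^ (n + 1) := by exact_mod_cast h1
        omega
      rw [e1, e2, dist_comm, Real.dist_eq]
      refine (h (n + 1) (2 * k) hlt).trans ?_
      gcongr ?_ * ?_
      exact pow_le_pow_of_le_one hq0.le hq1.le (Nat.le_succ n)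
  have hlim : ∀ t ∈ Icc (0 : ℝ) 1, Tendsto (fun n => f (a n t)) atTop (𝓝 (f t)) := by
    intro t ht
    refine (hf t ht).tendsto.comp (tendsto_nhdsWithin_iff.2 ⟨tendsto_floor_grid ht.1, ?_⟩)
    exact Eventually.of_forall fun n => floor_grid_mem ht n
  have htail : ∀ t ∈ Icc (0 : ℝ) 1, ∀ n, |f (a n t) - f t| ≤ G * q ^ n / (1 - q) := fun t ht n =>
    dist_le_of_le_geometric_of_tendsto q G hq1 (hstep t ht) (hlim t ht) n
  have key : ∀ s ∈ Icc (0 : ℝ) 1, ∀ t ∈ Icc (0 : ℝ) 1, s < t →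
      |f s - f t| ≤ chainConst lam * G * |s - t| ^ lam := by
    intro s hs t ht hst
    have hts : 0 < t - s := sub_pos.2 hst
    -- The level with `2 ^ -(n+1) < t - s ≤ 2 ^ -n`: there the approximations of `s` and `t` are
    -- equal or adjacent, while `2 ^ -n` is still at most `2 (t - s)`.
    obtain ⟨n, hn1, hn2⟩ := exists_nat_pow_near_of_lt_one hts (by linarith [hs.1, ht.2])
      (by norm_num : (0 : ℝ) < 1 / 2) (by norm_num)
    have h0s : 0 ≤ s * 2 ^ n := mul_nonneg hs.1 (by positivity)
    have h0t : 0 ≤ t * 2 ^ n := mul_nonneg ht.1 (by positivity)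
    have hmid : |f (a n s) - f (a n t)| ≤ G * q ^ n := by
      set k := ⌊s * 2 ^ n⌋₊ with hk
      have hk1 : k ≤ ⌊t * 2 ^ n⌋₊ := Nat.floor_mono (by gcongr)
      have hk2 : ⌊t * 2 ^ n⌋₊ < k + 2 := by
        refine (Nat.floor_lt h0t).2 ?_
        have h1 := Nat.lt_floor_add_one (s * 2 ^ n)
        have h2 : (t - s) * 2 ^ n ≤ 1 := by
          calc (t - s) * 2 ^ n ≤ (1 / 2) ^ n * 2 ^ n := by gcongr
            _ = 1 := by rw [← mul_pow]; norm_num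
        push_cast; linarith
      rcases (by omega : ⌊t * 2 ^ n⌋₊ = k ∨ ⌊t * 2 ^ n⌋₊ = k + 1) with hc | hc
      · have : a n t = a n s := by simp only [ha, hc, ← hk]
        rw [this, sub_self, abs_zero]; positivity
      · have e : a n t = (k + 1 : ℕ) / 2 ^ n := by simp only [ha, hc]
        have e' : a n s = (k : ℝ) / 2 ^ n := by simp only [ha, ← hk]
        have hlt : k < 2 ^ n := by
          have h1 := (floor_grid_mem ht n).2
          rw [div_le_one (by positivity), hc] at h1
          have : k + 1 ≤ 2 ^ n := by exact_mod_cast h1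
          omega
        rw [e, e', abs_sub_comm]
        exact h n k hlt
    have hqn : q ^ n ≤ 2 ^ lam * |s - t| ^ lam := by
      rw [abs_sub_comm, abs_of_pos hts, ← Real.mul_rpow two_pos.le hts.le, hq,
        ← Real.rpow_natCast, ← Real.rpow_mul two_pos.le, mul_comm, Real.rpow_mul two_pos.le]
      have h1 : ((2 : ℝ) ^ (n : ℝ)) ^ (-lam) = ((1 / 2) ^ n) ^ lam := by
        rw [Real.rpow_natCast, Real.rpow_neg (by positivity), ← Real.inv_rpow (by positivity)]
        congr 1; rw [one_div, inv_pow]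
      rw [h1]
      have : ((1 : ℝ) / 2) ^ n ≤ 2 * (t - s) := by
        rw [pow_succ] at hn1; linarith
      gcongr
    have h1q : 0 < 1 - q := sub_pos.2 hq1
    have e1 := htail s hs n
    have e2 := htail t ht n
    rw [abs_sub_comm] at e1
    calc |f s - f t| = |(f s - f (a n s)) + (f (a n s) - f (a n t)) + (f (a n t) - f t)| := by
          congr 1; ring
      _ ≤ G * q ^ n / (1 - q) + G * q ^ n + G * q ^ n / (1 - q) :=
          (abs_add_le _ _).trans (add_le_add ((abs_add_le _ _).trans (add_le_add e1 hmid)) e2)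
      _ = (1 + 2 / (1 - q)) * G * q ^ n := by field_simp; ring
      _ ≤ (1 + 2 / (1 - q)) * G * (2 ^ lam * |s - t| ^ lam) := by gcongr
      _ = _ := by unfold chainConst; rw [← hq]; ring
  intro s hs t ht
  rcases lt_trichotomy s t with hst | rfl | hst
  · exact key s hs t ht hst
  · rw [sub_self, abs_zero]
    have := chainConst_pos hl
    positivity
  · rw [abs_sub_comm, abs_sub_comm s t]; exact key t ht s hs hst

/-! ### Kolmogorov's continuity criterion with moments -/

section FBM

variable {Ω : Type*} [MeasurableSpace Ω] {P : Measure Ω} {H T : ℝ} {B : ℝ → Ω → ℝ}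

lemma IsFBM.aemeasurable (hB : IsFBM H T B P) {t : ℝ} (ht : t ∈ Icc 0 T) : AEMeasurable (B t) P :=
  hB.gaussian.aemeasurable ⟨t, ht⟩

/-- By the covariance formula the increment is centered Gaussian with variance `|s - t| ^ (2H)`,
that is, a standard normal variable scaled by `|s - t| ^ H`; `c` is the `p`-th absolute moment of
the standard normal law. -/
lemma IsFBM.exists_increment_moment (hB : IsFBM H T B P) (hH : 0 < H) (p : ℕ) :
    ∃ c : ℝ≥0∞, c ≠ ∞ ∧ ∀ s ∈ Icc 0 T, ∀ t ∈ Icc 0 T,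
      ∫⁻ ω, ‖B s ω - B t ω‖ₑ ^ p ∂P ≤ c * ENNReal.ofReal (|s - t| ^ H) ^ p := by
  have : IsProbabilityMeasure P := hB.gaussian.isProbabilityMeasure
  refine ⟨∫⁻ y, ‖y‖ₑ ^ p ∂(gaussianReal 0 1), ?_, fun s hs t ht => ?_⟩
  · rcases Nat.eq_zero_or_pos p with rfl | hp
    · simp
    have hm : MemLp id (p : ℝ≥0∞) (gaussianReal 0 1) :=
      IsGaussian.memLp_id _ _ (ENNReal.natCast_ne_top p)
    have := lintegral_rpow_enorm_lt_top_of_eLpNorm_lt_top (p := (p : ℝ≥0∞))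
      (by exact_mod_cast hp.ne') (ENNReal.natCast_ne_top p) hm.2
    simpa using this.ne
  · have hg := hB.gaussian.hasGaussianLaw_fun_sub (s := ⟨s, hs⟩) (t := ⟨t, ht⟩)
    simp only at hg
    have hms : MemLp (B s) 2 P := (hB.gaussian.hasGaussianLaw_eval ⟨s, hs⟩).memLp_two
    have hmt : MemLp (B t) 2 P := (hB.gaussian.hasGaussianLaw_eval ⟨t, ht⟩).memLp_two
    have hmean : ∫ ω, (B s ω - B t ω) ∂P = 0 := by
      rw [integral_sub (hms.integrable (by norm_num)) (hmt.integrable (by norm_num)),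
        hB.centered s hs, hB.centered t ht, sub_zero]
    have hvar : Var[fun ω => B s ω - B t ω; P] = (|s - t| ^ H) ^ 2 := by
      rw [variance_fun_sub hms hmt, ← covariance_self hms.aemeasurable,
        ← covariance_self hmt.aemeasurable, hB.covariance s hs s hs, hB.covariance t ht t ht,
        hB.covariance s hs t ht, ← Real.rpow_natCast, ← Real.rpow_mul (abs_nonneg _),
        abs_sub_comm t s]
      have : (0 : ℝ) ^ (2 * H) = 0 := Real.zero_rpow (by positivity)
      simp only [sub_self, abs_zero, this, Nat.cast_ofNat]
      rw [mul_comm H 2]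
      ring
    have hlaw := hg.map_eq_gaussianReal
    rw [hmean, hvar] at hlaw
    have hscale : gaussianReal 0 ((|s - t| ^ H) ^ 2).toNNReal =
        (gaussianReal 0 1).map ((|s - t| ^ H) * ·) := by
      rw [gaussianReal_map_const_mul, mul_zero, mul_one]
      congr 1
      ext
      rw [Real.coe_toNNReal _ (by positivity)]
      rfl
    have e1 : ∫⁻ ω, ‖B s ω - B t ω‖ₑ ^ p ∂P =
        ∫⁻ y, ‖y‖ₑ ^ p ∂(P.map fun ω => B s ω - B t ω) := by
      rw [lintegral_map' (by fun_prop) hg.aemeasurable]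
    rw [e1, hlaw, hscale, lintegral_map (by fun_prop) (by fun_prop)]
    simp only [enorm_mul, mul_pow]
    rw [lintegral_const_mul _ (by fun_prop), mul_comm, Real.enorm_of_nonneg (by positivity)]

/-- The sequence of dyadic maxima that controls the Hölder norm of a path. -/
noncomputable def dyadicHolder (V : ℕ → ℕ → Ω → ℝ) (lam : ℝ) (ω : Ω) : ℝ≥0∞ :=
  ⨆ n, ⨆ k ∈ Finset.range (2 ^ n),
    ENNReal.ofReal (((2 : ℝ) ^ lam) ^ n) * ‖V n (k + 1) ω - V n k ω‖ₑ

lemma measurable_dyadicHolder {V : ℕ → ℕ → Ω → ℝ} (hV : ∀ n k, Measurable (V n k)) (lam : ℝ) :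
    Measurable (dyadicHolder V lam) := by
  unfold dyadicHolder
  refine Measurable.iSup fun n => ?_
  refine Measurable.iSup fun k => Measurable.iSup_Prop _ ?_
  have h1 := hV n (k + 1)
  have h2 := hV n k
  fun_prop

/-- The `p`-th power of the supremum is at most the sum of the `p`-th powers. Level `n` has `2 ^ n`
increments, which together contribute a constant times `2 ^ (n (1 - p (H - lam)))`, and this is
summable for `p (H - lam) > 1`. The variables `V n k` are indexed by level and position, so no
consistency between levels is needed. -/
lemma lintegral_dyadicHolder_pow_lt_top {V : ℕ → ℕ → Ω → ℝ} (hV : ∀ n k, Measurable (V n k))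
    {lam : ℝ} (hT : 0 ≤ T) {p : ℕ} {c : ℝ≥0∞} (hc : c ≠ ∞) (hp : 1 < p * (H - lam))
    (hmom : ∀ n, ∀ k < 2 ^ n, ∫⁻ ω, ‖V n (k + 1) ω - V n k ω‖ₑ ^ p ∂P ≤
      c * ENNReal.ofReal ((T / 2 ^ n) ^ H) ^ p) :
    ∫⁻ ω, dyadicHolder V lam ω ^ p ∂P < ∞ := by
  have hle : ∀ ω, dyadicHolder V lam ω ^ p ≤ ∑' n, ∑ k ∈ Finset.range (2 ^ n),
      ENNReal.ofReal (((2 : ℝ) ^ lam) ^ n) ^ p * ‖V n (k + 1) ω - V n k ω‖ₑ ^ p := by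
    intro ω
    have hp0 : p ≠ 0 := by rintro rfl; norm_num at hp
    set S := ∑' n, ∑ k ∈ Finset.range (2 ^ n),
      ENNReal.ofReal (((2 : ℝ) ^ lam) ^ n) ^ p * ‖V n (k + 1) ω - V n k ω‖ₑ ^ p with hS
    have : dyadicHolder V lam ω ≤ S ^ (p : ℝ)⁻¹ := by
      refine iSup_le fun n => iSup₂_le fun k hk => ?_
      have hterm : (ENNReal.ofReal (((2 : ℝ) ^ lam) ^ n) * ‖V n (k + 1) ω - V n k ω‖ₑ) ^ p ≤ S := by
        rw [mul_pow]
        refine le_trans ?_ (ENNReal.le_tsum n)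
        exact Finset.single_le_sum (f := fun k => ENNReal.ofReal (((2 : ℝ) ^ lam) ^ n) ^ p
          * ‖V n (k + 1) ω - V n k ω‖ₑ ^ p) (fun _ _ => zero_le) hk
      rw [ENNReal.le_rpow_inv_iff (by positivity), ENNReal.rpow_natCast]
      exact hterm
    rw [ENNReal.le_rpow_inv_iff (by positivity), ENNReal.rpow_natCast] at this
    exact this
  refine (lintegral_mono hle).trans_lt ?_
  have hmeas : ∀ n k, Measurable fun ω => ENNReal.ofReal (((2 : ℝ) ^ lam) ^ n) ^ p *
      ‖V n (k + 1) ω - V n k ω‖ₑ ^ p := fun n k => by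
    have h1 := hV n (k + 1)
    have h2 := hV n k
    fun_prop
  rw [lintegral_tsum fun n => (Finset.measurable_fun_sum _ fun k _ => hmeas n k).aemeasurable]
  have hb : ∀ n, ∫⁻ ω, ∑ k ∈ Finset.range (2 ^ n),
      ENNReal.ofReal (((2 : ℝ) ^ lam) ^ n) ^ p * ‖V n (k + 1) ω - V n k ω‖ₑ ^ p ∂P ≤
      c * ENNReal.ofReal ((T ^ H) ^ p) * ENNReal.ofReal ((2 : ℝ) ^ (1 - p * (H - lam))) ^ n := by
    intro n
    rw [lintegral_finsetSum _ fun k _ => hmeas n k]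
    have h1 : ∀ k ∈ Finset.range (2 ^ n),
        ∫⁻ ω, ENNReal.ofReal (((2 : ℝ) ^ lam) ^ n) ^ p * ‖V n (k + 1) ω - V n k ω‖ₑ ^ p ∂P ≤
        ENNReal.ofReal (((2 : ℝ) ^ lam) ^ n) ^ p * (c * ENNReal.ofReal ((T / 2 ^ n) ^ H) ^ p) := by
      intro k hk
      have h2 := hV n k
      have h3 := hV n (k + 1)
      rw [lintegral_const_mul _ (by fun_prop)]
      gcongr
      exact hmom n k (Finset.mem_range.1 hk)
    refine (Finset.sum_le_sum h1).trans_eq ?_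
    rw [Finset.sum_const, Finset.card_range, nsmul_eq_mul]
    have e : (2 : ℝ) ^ n * ((((2 : ℝ) ^ lam) ^ n) ^ p * ((T / 2 ^ n) ^ H) ^ p) =
        (T ^ H) ^ p * ((2 : ℝ) ^ (1 - p * (H - lam))) ^ n := by
      rw [Real.div_rpow hT (by positivity), div_pow]
      have e2 : (2 : ℝ) ^ n * (((2 : ℝ) ^ lam) ^ n) ^ p =
          ((2 : ℝ) ^ (1 - p * (H - lam))) ^ n * (((2 : ℝ) ^ n) ^ H) ^ p := by
        simp only [← Real.rpow_natCast, ← Real.rpow_mul two_pos.le]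
        rw [← Real.rpow_add two_pos, ← Real.rpow_add two_pos]
        congr 1; ring
      have hne : (((2 : ℝ) ^ n) ^ H) ^ p ≠ 0 := by positivity
      field_simp
      linear_combination (T ^ H) ^ p * e2
    have e' := congrArg ENNReal.ofReal e
    rw [ENNReal.ofReal_mul (by positivity), ENNReal.ofReal_mul (by positivity),
      ENNReal.ofReal_mul (by positivity), ENNReal.ofReal_pow (by positivity) p,
      ENNReal.ofReal_pow (by positivity) p, ENNReal.ofReal_pow (by positivity) n,
      ENNReal.ofReal_pow (p := (2 : ℝ) ^ (1 - p * (H - lam))) (by positivity) n] at e'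
    have e2 : ((2 ^ n : ℕ) : ℝ≥0∞) = ENNReal.ofReal 2 ^ n := by simp
    rw [e2]
    calc _ = c * (ENNReal.ofReal 2 ^ n * (ENNReal.ofReal (((2 : ℝ) ^ lam) ^ n) ^ p
          * ENNReal.ofReal ((T / 2 ^ n) ^ H) ^ p)) := by ring
      _ = _ := by rw [e']; ring
  refine (ENNReal.tsum_le_tsum hb).trans_lt ?_
  rw [ENNReal.tsum_mul_left, ENNReal.tsum_geometric]
  refine ENNReal.mul_lt_top (ENNReal.mul_lt_top hc.lt_top ENNReal.ofReal_lt_top) ?_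
  rw [ENNReal.inv_lt_top, tsub_pos_iff_lt]
  rw [← ENNReal.ofReal_one]
  exact (ENNReal.ofReal_lt_ofReal_iff one_pos).2
    (Real.rpow_lt_one_of_one_lt_of_neg (by norm_num) (by linarith))

lemma rpow_le_one_add_pow {x : ℝ≥0∞} {p : ℝ} {n : ℕ} (hp : 0 ≤ p) (hpn : p ≤ n) :
    x ^ p ≤ 1 + x ^ n := by
  rcases le_total x 1 with h | h
  · exact (ENNReal.rpow_le_one h hp).trans le_self_add
  · rw [← ENNReal.rpow_natCast]
    exact (ENNReal.rpow_le_rpow_of_exponent_le h hpn).trans le_add_self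

/-- A fractional Brownian motion agrees almost surely with a measurable process all of whose paths
are Hölder continuous of a given order `< H`, with a Hölder constant that has all moments. -/
theorem IsFBM.exists_holder_version (hB : IsFBM H T B P) (hT : 0 < T) {lam : ℝ} (hl : 0 < lam)
    (hlH : lam < H) :
    ∃ (B' : ℝ → Ω → ℝ) (G : Ω → ℝ), (∀ t, Measurable (B' t)) ∧ Measurable G ∧ (∀ ω, 0 ≤ G ω) ∧
      (∀ ω, ∀ s ∈ Icc 0 T, ∀ t ∈ Icc 0 T, |B' s ω - B' t ω| ≤ G ω * |s - t| ^ lam) ∧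
      (∀ p : ℝ, 1 ≤ p → ∫⁻ ω, ENNReal.ofReal (G ω) ^ p ∂P < ∞) ∧
      ∀ᵐ ω ∂P, ∀ t ∈ Icc 0 T, B' t ω = B t ω := by
  have hP : IsProbabilityMeasure P := hB.gaussian.isProbabilityMeasure
  have hH : 0 < H := hl.trans hlH
  classical
  -- a measurable version at the dyadic times
  have hgrid : ∀ n k : ℕ, k ≤ 2 ^ n → T * ((k : ℝ) / 2 ^ n) ∈ Icc 0 T := fun n k hk => by
    have := grid_mem hT.le hk
    rwa [mul_comm, div_mul_eq_mul_div]
  -- The process is only almost everywhere measurable at each time, so measurable representatives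
  -- are taken at the countably many dyadic times.
  have hver : ∀ n k : ℕ, ∃ V : Ω → ℝ, Measurable V ∧
      (k ≤ 2 ^ n → B (T * ((k : ℝ) / 2 ^ n)) =ᵐ[P] V) := by
    intro n k
    by_cases hk : k ≤ 2 ^ n
    · obtain ⟨V, hV, hVe⟩ := hB.aemeasurable (hgrid n k hk)
      exact ⟨V, hV, fun _ => hVe⟩
    · exact ⟨0, measurable_const, fun h => absurd h hk⟩
  choose V hVm hVe using hver
  have hmom : ∀ p : ℕ, 1 < p * (H - lam) → ∫⁻ ω, dyadicHolder V lam ω ^ p ∂P < ∞ := by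
    intro p hp
    obtain ⟨c, hc, hcb⟩ := hB.exists_increment_moment hH p
    refine lintegral_dyadicHolder_pow_lt_top hVm hT.le hc hp fun n k hk => ?_
    have h1 := hcb _ (hgrid n (k + 1) hk) _ (hgrid n k hk.le)
    have e : |T * (((k + 1 : ℕ) : ℝ) / 2 ^ n) - T * ((k : ℝ) / 2 ^ n)| = T / 2 ^ n := by
      rw [abs_of_nonneg] <;> push_cast
      · ring
      · have : T * (((k : ℝ) + 1) / 2 ^ n) - T * ((k : ℝ) / 2 ^ n) = T / 2 ^ n := by ring
        rw [this]; positivity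
    rw [e] at h1
    refine le_trans (le_of_eq ?_) h1
    refine lintegral_congr_ae ?_
    filter_upwards [hVe n k hk.le, hVe n (k + 1) hk] with ω h2 h3
    rw [h2, h3]
  have hfin : ∀ᵐ ω ∂P, dyadicHolder V lam ω < ∞ := by
    obtain ⟨p, hp⟩ := exists_nat_gt (1 / (H - lam))
    rw [div_lt_iff₀ (by linarith)] at hp
    have hp0 : p ≠ 0 := by rintro rfl; norm_num at hp
    filter_upwards [ae_lt_top ((measurable_dyadicHolder hVm lam).pow_const p) (hmom p hp).ne]
      with ω hω
    by_contra hcon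
    rw [not_lt_top_iff.1 hcon, ENNReal.top_pow hp0] at hω
    exact lt_irrefl _ hω
  have hall : ∀ᵐ ω ∂P, ∀ n k : ℕ, k ≤ 2 ^ n → B (T * ((k : ℝ) / 2 ^ n)) ω = V n k ω := by
    rw [ae_all_iff]; intro n
    rw [ae_all_iff]; intro k
    by_cases hk : k ≤ 2 ^ n
    · filter_upwards [hVe n k hk] with ω hω _ using hω
    · exact Eventually.of_forall fun ω h => absurd h hk
  -- The exceptional set need not be measurable; `Ω₀` is the complement of a measurable null set
  -- containing it.
  obtain ⟨Ω₀, hsub, hΩm, hΩ0⟩ : ∃ S : Set Ω, (∀ ω ∈ S, dyadicHolder V lam ω < ∞ ∧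
      (∀ n k : ℕ, k ≤ 2 ^ n → B (T * ((k : ℝ) / 2 ^ n)) ω = V n k ω) ∧
      ContinuousOn (fun t => B t ω) (Icc 0 T)) ∧ MeasurableSet S ∧ ∀ᵐ ω ∂P, ω ∈ S := by
    obtain ⟨N, hN, hNm, hN0⟩ := exists_measurable_superset_of_null
      (ae_iff.1 (hfin.and (hall.and hB.continuous)))
    refine ⟨Nᶜ, fun ω hω => ?_, hNm.compl, ?_⟩
    · by_contra hcon
      exact hω (hN hcon)
    · rw [ae_iff]; simpa using hN0
  set B' : ℝ → Ω → ℝ := fun t ω => if ω ∈ Ω₀ then B (projIcc 0 T hT.le t) ω else 0 with hB'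
  -- The chaining estimate lives on `[0,1]`; the factor `T ^ lam` undoes the change of time scale.
  set G : Ω → ℝ := fun ω =>
    if ω ∈ Ω₀ then chainConst lam / T ^ lam * (dyadicHolder V lam ω).toReal else 0 with hG
  have hchain := chainConst_pos hl
  have hGle : ∀ ω, ENNReal.ofReal (G ω) ≤
      ENNReal.ofReal (chainConst lam / T ^ lam) * dyadicHolder V lam ω := by
    intro ω
    simp only [hG]
    split_ifs with h
    · rw [ENNReal.ofReal_mul (by positivity), ENNReal.ofReal_toReal (hsub ω h).1.ne]
    · simp
  have hBH : ∀ ω ∈ Ω₀, ∀ s ∈ Icc 0 T, ∀ t ∈ Icc 0 T, |B s ω - B t ω| ≤ G ω * |s - t| ^ lam := by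
    intro ω hω s hs t ht
    obtain ⟨h1, h2, h3⟩ := hsub ω hω
    have hcont : ContinuousOn (fun u => B (T * u) ω) (Icc 0 1) := by
      refine h3.comp (f := fun u : ℝ => T * u) (by fun_prop) fun u hu => ?_
      exact ⟨mul_nonneg hT.le hu.1, mul_le_of_le_one_right hT.le hu.2⟩
    have hd := holder_of_dyadic hcont (G := (dyadicHolder V lam ω).toReal)
      ENNReal.toReal_nonneg hl (fun n k hk => by
        rw [h2 n (k + 1) hk, h2 n k hk.le]
        have hle : ENNReal.ofReal (((2 : ℝ) ^ lam) ^ n) * ‖V n (k + 1) ω - V n k ω‖ₑ ≤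
            dyadicHolder V lam ω :=
          le_iSup_of_le n (le_iSup₂_of_le k (Finset.mem_range.2 hk) le_rfl)
        have hle' := ENNReal.toReal_mono h1.ne hle
        rw [ENNReal.toReal_mul, ENNReal.toReal_ofReal (by positivity), toReal_enorm,
          Real.norm_eq_abs] at hle'
        rw [Real.rpow_neg two_pos.le, inv_pow, ← div_eq_mul_inv, le_div_iff₀ (by positivity)]
        linarith)
    have hs' : s / T ∈ Icc (0 : ℝ) 1 := ⟨div_nonneg hs.1 hT.le, (div_le_one hT).2 hs.2⟩
    have ht' : t / T ∈ Icc (0 : ℝ) 1 := ⟨div_nonneg ht.1 hT.le, (div_le_one hT).2 ht.2⟩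
    have := hd _ hs' _ ht'
    simp only [mul_div_cancel₀ _ hT.ne'] at this
    rw [← sub_div, abs_div, abs_of_pos hT, Real.div_rpow (abs_nonneg _) hT.le] at this
    simp only [hG, if_pos hω]
    refine this.trans_eq ?_
    field_simp
  refine ⟨B', G, fun t => ?_, ?_, fun ω => ?_, fun ω s hs t ht => ?_, fun p hp => ?_, ?_⟩
  · -- limit of the values at dyadic times
    set u : ℝ := ((projIcc 0 T hT.le t : Icc 0 T) : ℝ) with hu
    have hum : u ∈ Icc 0 T := (projIcc 0 T hT.le t).2
    have hu' : u / T ∈ Icc (0 : ℝ) 1 := ⟨div_nonneg hum.1 hT.le, (div_le_one hT).2 hum.2⟩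
    refine measurable_of_tendsto_metrizable
      (f := fun n ω => Ω₀.indicator (V n ⌊u / T * 2 ^ n⌋₊) ω)
      (fun n => (hVm n _).indicator hΩm) ?_
    rw [tendsto_pi_nhds]
    intro ω
    by_cases hω : ω ∈ Ω₀
    · obtain ⟨-, h2, h3⟩ := hsub ω hω
      simp only [hB', if_pos hω, indicator_of_mem hω]
      have hfl : ∀ n : ℕ, ⌊u / T * 2 ^ n⌋₊ ≤ 2 ^ n := fun n => by
        have := (floor_grid_mem hu' n).2
        rw [div_le_one (by positivity)] at this
        exact_mod_cast this
      have hrw : ∀ n, V n ⌊u / T * 2 ^ n⌋₊ ω =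
          B (T * ((⌊u / T * 2 ^ n⌋₊ : ℝ) / 2 ^ n)) ω := fun n => (h2 n _ (hfl n)).symm
      simp only [hrw]
      refine (h3 u hum).tendsto.comp (tendsto_nhdsWithin_iff.2 ⟨?_, ?_⟩)
      · have := (tendsto_floor_grid hu'.1).const_mul T
        rwa [mul_div_cancel₀ _ hT.ne'] at this
      · exact Eventually.of_forall fun n => hgrid n _ (hfl n)
    · simp only [hB', if_neg hω, indicator_of_notMem hω]
      exact tendsto_const_nhds
  · exact Measurable.ite hΩm ((measurable_dyadicHolder hVm lam).ennreal_toReal.const_mul _)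
      measurable_const
  · simp only [hG]; split_ifs <;> positivity
  · by_cases hω : ω ∈ Ω₀
    · simp only [hB', if_pos hω, projIcc_of_mem hT.le hs, projIcc_of_mem hT.le ht]
      exact hBH ω hω s hs t ht
    · simp [hB', hG, hω]
  · obtain ⟨n, hn⟩ := exists_nat_gt (max p (1 / (H - lam)))
    have hpn : p ≤ n := (le_max_left _ _).trans hn.le
    have hnH := (le_max_right _ _).trans_lt hn
    rw [div_lt_iff₀ (by linarith)] at hnH
    calc ∫⁻ ω, ENNReal.ofReal (G ω) ^ p ∂P
        ≤ ∫⁻ ω, (1 + ENNReal.ofReal (chainConst lam / T ^ lam) ^ n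
            * dyadicHolder V lam ω ^ n) ∂P := by
          refine lintegral_mono fun ω => ?_
          refine (rpow_le_one_add_pow (by linarith) hpn).trans ?_
          rw [← mul_pow]
          gcongr
          exact hGle ω
      _ < ∞ := by
          have := (measurable_dyadicHolder hVm lam).pow_const n
          rw [lintegral_add_left measurable_const, lintegral_const_mul _ this]
          refine ENNReal.add_lt_top.2 ⟨by simp, ENNReal.mul_lt_top ?_ (hmom n hnH)⟩
          exact ENNReal.pow_lt_top ENNReal.ofReal_lt_top
  · filter_upwards [hΩ0] with ω hω t ht
    simp only [hB', if_pos hω, projIcc_of_mem hT.le ht]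

end FBM

/-! ### The space `W_0^{α,∞}` -/

lemma lintegral_sub_rpow {a t κ : ℝ} (hat : a ≤ t) (hκ : 0 < κ) :
    ∫⁻ s in Ioo a t, ENNReal.ofReal ((t - s) ^ (κ - 1)) = ENNReal.ofReal ((t - a) ^ κ / κ) := by
  have hint : IntervalIntegrable (fun s => (t - s) ^ (κ - 1)) volume a t := by
    have := (intervalIntegral.intervalIntegrable_rpow' (a := t - a) (b := 0)
      (by linarith : -1 < κ - 1)).comp_sub_left t
    simpa using this
  have hval : ∫ s in a..t, (t - s) ^ (κ - 1) = (t - a) ^ κ / κ := by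
    rw [intervalIntegral.integral_comp_sub_left (fun u => u ^ (κ - 1)),
      integral_rpow (Or.inl (by linarith))]
    simp [Real.zero_rpow hκ.ne']
  rw [restrict_Ioo_eq_restrict_Ioc, ← hval, intervalIntegral.integral_of_le hat,
    ofReal_integral_eq_lintegral_ofReal ((intervalIntegrable_iff_integrableOn_Ioc_of_le hat).1 hint)]
  filter_upwards [ae_restrict_mem measurableSet_Ioc] with s hs
  exact Real.rpow_nonneg (sub_nonneg.2 hs.2) _

/-- Hölder functions of order `lam > α` belong to `W_0^{α,∞}`. -/
lemma wNorm_le_of_holder {d : ℕ} {α lam a b S A : ℝ} {f : ℝ → E d} (hαl : α < lam)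
    (hA : 0 ≤ A) (hS : ∀ t ∈ Icc a b, ‖f t‖ ≤ S)
    (hf : ∀ s ∈ Icc a b, ∀ t ∈ Icc a b, ‖f s - f t‖ ≤ A * |s - t| ^ lam) :
    wNorm α a b f ≤ ENNReal.ofReal (S + A * ((b - a) ^ (lam - α) / (lam - α))) := by
  refine iSup₂_le fun t ht => ?_
  have hκ : 0 < lam - α := sub_pos.2 hαl
  have h1 : ‖f t‖ₑ ≤ ENNReal.ofReal S := by
    rw [← ofReal_norm]; exact ENNReal.ofReal_le_ofReal (hS t ht)
  have h2 : ∫⁻ s in Ioo a t, ‖f t - f s‖ₑ / ENNReal.ofReal ((t - s) ^ (α + 1)) ≤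
      ENNReal.ofReal (A * ((b - a) ^ (lam - α) / (lam - α))) := by
    calc _ ≤ ∫⁻ s in Ioo a t, ENNReal.ofReal A * ENNReal.ofReal ((t - s) ^ (lam - α - 1)) := by
          refine setLIntegral_mono (by fun_prop) fun s hs => ?_
          have hts : 0 < t - s := sub_pos.2 hs.2
          rw [← ofReal_norm, ← ENNReal.ofReal_div_of_pos (by positivity), ← ENNReal.ofReal_mul hA]
          refine ENNReal.ofReal_le_ofReal ?_
          rw [div_le_iff₀ (by positivity), mul_assoc, ← Real.rpow_add hts]
          have := hf t ht s ⟨hs.1.le, hs.2.le.trans ht.2⟩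
          rw [abs_of_pos hts] at this
          refine this.trans_eq ?_
          congr 2; ring
      _ = ENNReal.ofReal A * ENNReal.ofReal ((t - a) ^ (lam - α) / (lam - α)) := by
          rw [lintegral_const_mul _ (by fun_prop), lintegral_sub_rpow ht.1 hκ]
      _ ≤ _ := by
          rw [← ENNReal.ofReal_mul hA]
          refine ENNReal.ofReal_le_ofReal ?_
          have h1 : 0 ≤ t - a := sub_nonneg.2 ht.1
          have h2 : t - a ≤ b - a := by linarith [ht.2]
          gcongr
  have hS0 : 0 ≤ S := (norm_nonneg _).trans (hS t ht)
  have hba : 0 ≤ b - a := by linarith [ht.1, ht.2]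
  rw [ENNReal.ofReal_add hS0 (by positivity)]
  exact add_le_add h1 h2

/-- On sets of uniformly Hölder continuous functions, uniform convergence implies convergence in
`W_0^{α,∞}`. -/
lemma exists_wNorm_le {d : ℕ} {α lam a b K : ℝ} (hα : 0 ≤ α) (hαl : α < lam)
    (hK : 0 ≤ K) {ε : ℝ≥0∞} (hε : 0 < ε) :
    ∃ ρ > 0, ∀ f : ℝ → E d, (∀ t ∈ Icc a b, ‖f t‖ ≤ ρ) →
      (∀ s ∈ Icc a b, ∀ t ∈ Icc a b, ‖f s - f t‖ ≤ K * |s - t| ^ lam) → wNorm α a b f ≤ ε := by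
  have hl : 0 < lam := hα.trans_lt hαl
  -- Interpolation: with `θ = κ / lam`, increments are at most `(2ρ) ^ (1 - θ) (K |s - t| ^ lam) ^
  -- θ`. This is of order `κ > α` with a coefficient that is small with `ρ`.
  obtain ⟨κ, hκ1, hκ2⟩ := exists_between hαl
  set θ := κ / lam with hθ
  have hθ1 : θ < 1 := (div_lt_one hl).2 hκ2
  have hκ0 : 0 < κ := hα.trans_lt hκ1
  have hθ0 : 0 < θ := div_pos hκ0 hl
  have hθl : lam * θ = κ := by rw [hθ]; field_simp
  set c := (b - a) ^ (κ - α) / (κ - α) with hc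
  set Φ : ℝ → ℝ := fun ρ => ρ + (2 * ρ) ^ (1 - θ) * K ^ θ * c with hΦ
  have hlim : Tendsto (fun ρ => ENNReal.ofReal (Φ ρ)) (𝓝[>] 0) (𝓝 0) := by
    have h1 : Tendsto Φ (𝓝 0) (𝓝 (Φ 0)) := by
      refine Continuous.tendsto ?_ 0
      have : Continuous fun x : ℝ => x ^ (1 - θ) := Real.continuous_rpow_const (by linarith)
      have h2 : Continuous fun ρ : ℝ => (2 * ρ) ^ (1 - θ) := this.comp (by fun_prop)
      exact continuous_id.add ((h2.mul continuous_const).mul continuous_const)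
    have h0 : Φ 0 = 0 := by simp [hΦ, Real.zero_rpow (by linarith : 1 - θ ≠ 0)]
    rw [h0] at h1
    have := (ENNReal.continuous_ofReal.tendsto 0).comp h1
    rw [ENNReal.ofReal_zero] at this
    exact this.mono_left nhdsWithin_le_nhds
  obtain ⟨ρ, hρε, hρ⟩ := ((hlim.eventually (gt_mem_nhds hε)).and self_mem_nhdsWithin).exists
  have hρ : 0 < ρ := hρ
  refine ⟨ρ, hρ, fun f hf hfK => le_trans ?_ hρε.le⟩
  refine wNorm_le_of_holder hκ1 (by positivity) hf fun s hs t ht => ?_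
  have h1 : ‖f s - f t‖ ≤ 2 * ρ := by
    have := norm_sub_le (f s) (f t)
    linarith [hf s hs, hf t ht]
  calc ‖f s - f t‖ = ‖f s - f t‖ ^ (1 - θ) * ‖f s - f t‖ ^ θ := by
        rw [← Real.rpow_add_of_nonneg (norm_nonneg _) (by linarith) hθ0.le]; simp
    _ ≤ (2 * ρ) ^ (1 - θ) * (K * |s - t| ^ lam) ^ θ := by
        have : 0 ≤ 1 - θ := by linarith
        gcongr
        exact hfK s hs t ht
    _ = _ := by
        rw [Real.mul_rpow hK (by positivity), ← Real.rpow_mul (abs_nonneg _), hθl]; ring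

/-! ### Measurability of random paths in the uniform topology and in the space W -/

section Borel

variable {d : ℕ} {a b : ℝ}

/-- Uniform convergence does not control the singular integral, but Fatou's lemma bounds it from
below, and suprema preserve lower semicontinuity. This suffices for Borel measurability. -/
lemma lowerSemicontinuous_wNorm (hab : a ≤ b) (α : ℝ) :
    LowerSemicontinuous fun x : C(Icc a b, E d) => wNorm α a b (IccExtend hab x) := by
  have heval : ∀ t, Continuous fun x : C(Icc a b, E d) => IccExtend hab x t := fun t =>
    continuous_eval_const (projIcc a b hab t)
  refine lowerSemicontinuous_biSup fun t _ => ?_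
  refine LowerSemicontinuous.add (heval t).enorm.lowerSemicontinuous ?_
  rw [lowerSemicontinuous_iff_isClosed_preimage]
  intro c
  refine IsSeqClosed.isClosed fun x y hx hxy => ?_
  have hlim : ∀ s, Tendsto (fun n => ‖IccExtend hab (x n) t - IccExtend hab (x n) s‖ₑ /
      ENNReal.ofReal ((t - s) ^ (α + 1))) atTop (𝓝 (‖IccExtend hab y t - IccExtend hab y s‖ₑ /
      ENNReal.ofReal ((t - s) ^ (α + 1)))) ∨ ¬ s < t := by
    intro s
    by_cases hs : s < t
    · left
      have h1 := ((((heval t).sub (heval s)).enorm).tendsto y).comp hxy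
      refine ENNReal.Tendsto.div_const h1 (Or.inr ?_)
      simpa using Real.rpow_pos_of_pos (sub_pos.2 hs) _
    · right; exact hs
  have hmeas : ∀ n, Measurable fun s => ‖IccExtend hab (x n) t - IccExtend hab (x n) s‖ₑ /
      ENNReal.ofReal ((t - s) ^ (α + 1)) := fun n => by
    have : Measurable (IccExtend hab (x n)) := (x n).continuous.Icc_extend'.measurable
    fun_prop
  show ∫⁻ s in Ioo a t, _ ≤ c
  calc ∫⁻ s in Ioo a t, ‖IccExtend hab y t - IccExtend hab y s‖ₑ / ENNReal.ofReal ((t - s) ^ (α + 1))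
      = ∫⁻ s in Ioo a t, liminf (fun n => ‖IccExtend hab (x n) t - IccExtend hab (x n) s‖ₑ /
          ENNReal.ofReal ((t - s) ^ (α + 1))) atTop := by
        refine setLIntegral_congr_fun measurableSet_Ioo fun s hs => ?_
        exact (((hlim s).resolve_right (not_not.2 hs.2)).liminf_eq).symm
    _ ≤ liminf (fun n => ∫⁻ s in Ioo a t, ‖IccExtend hab (x n) t - IccExtend hab (x n) s‖ₑ /
          ENNReal.ofReal ((t - s) ^ (α + 1))) atTop := lintegral_liminf_le hmeas
    _ ≤ c := by
        refine liminf_le_of_le (by isBoundedDefault) fun e he => ?_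
        obtain ⟨n, hn⟩ := he.exists
        exact hn.trans (hx n)

lemma measurable_wNorm (hab : a ≤ b) (α : ℝ) :
    Measurable[borel _] fun x : C(Icc a b, E d) => wNorm α a b (IccExtend hab x) := by
  borelize C(Icc a b, E d)
  exact (lowerSemicontinuous_wNorm hab α).measurable

/-- A random continuous path is Borel measurable if its values at fixed times are measurable. -/
lemma measurable_path_of_eval {Ω : Type*} [MeasurableSpace Ω] {X : Ω → C(Icc a b, E d)}
    (hX : ∀ t, Measurable fun ω => X ω t) : Measurable[_, borel _] X := by
  have hbasis : TopologicalSpace.IsTopologicalBasis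
      {U : Set C(Icc a b, E d) | ∃ y R, U = Metric.ball y R} := by
    refine TopologicalSpace.isTopologicalBasis_of_isOpen_of_nhds ?_ ?_
    · rintro _ ⟨y, R, rfl⟩; exact Metric.isOpen_ball
    · intro x U hx hU
      obtain ⟨ε, hε, hsub⟩ := Metric.isOpen_iff.1 hU x hx
      exact ⟨_, ⟨x, ε, rfl⟩, Metric.mem_ball_self hε, hsub⟩
  -- The path space is second countable, so open balls generate its Borel sets. The distance to the
  -- centre is measurable because, by continuity, it is determined by countably many times.
  rw [hbasis.borel_eq_generateFrom]
  refine measurable_generateFrom ?_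
  rintro _ ⟨y, R, rfl⟩
  obtain ⟨D, hDc, hD⟩ := TopologicalSpace.exists_countable_dense (Icc a b)
  have hdist : Measurable fun ω => dist (X ω) y := by
    refine measurable_of_Iic fun c => ?_
    rcases lt_or_ge c 0 with hc | hc
    · have : (fun ω => dist (X ω) y) ⁻¹' Iic c = ∅ := by
        ext ω
        simp only [mem_preimage, mem_Iic, mem_empty_iff_false, iff_false, not_le]
        exact hc.trans_le dist_nonneg
      rw [this]; exact MeasurableSet.empty
    · have : (fun ω => dist (X ω) y) ⁻¹' Iic c = ⋂ t ∈ D, {ω | dist (X ω t) (y t) ≤ c} := by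
        ext ω
        simp only [mem_preimage, mem_Iic, mem_iInter, mem_ofPred_eq]
        rw [ContinuousMap.dist_le hc]
        refine ⟨fun h t _ => h t, fun h t => ?_⟩
        have hcl : IsClosed {t | dist (X ω t) (y t) ≤ c} :=
          isClosed_le (by fun_prop) continuous_const
        exact (hcl.closure_subset_iff.2 (fun t ht => h t ht) : closure D ⊆ _) (hD t)
      rw [this]
      exact MeasurableSet.biInter hDc fun t _ =>
        measurableSet_le ((hX t).dist measurable_const) measurable_const
  exact measurableSet_lt hdist measurable_const

lemma holder_extend {lam K : ℝ} (hab : a ≤ b) {x : C(Icc a b, E d)}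
    (hx : ∀ s t : Icc a b, ‖x s - x t‖ ≤ K * |(s : ℝ) - t| ^ lam) :
    ∀ s ∈ Icc a b, ∀ t ∈ Icc a b,
      ‖IccExtend hab x s - IccExtend hab x t‖ ≤ K * |s - t| ^ lam := by
  intro s hs t ht
  rw [IccExtend_of_mem _ _ hs, IccExtend_of_mem _ _ ht]
  exact hx ⟨s, hs⟩ ⟨t, ht⟩

lemma memW_of_holder {α lam K : ℝ} (hab : a ≤ b) (hαl : α < lam) (hK : 0 ≤ K)
    {x : C(Icc a b, E d)} (hx : ∀ s t : Icc a b, ‖x s - x t‖ ≤ K * |(s : ℝ) - t| ^ lam) :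
    MemW α a b (IccExtend hab x) := by
  refine ⟨(x.continuous.Icc_extend'.measurable).comp measurable_subtype_coe, ?_⟩
  refine (wNorm_le_of_holder (S := ‖x‖) hαl hK (fun t ht => ?_) (holder_extend hab hx)).trans_lt
    ENNReal.ofReal_lt_top
  exact x.norm_coe_le_norm _

/-- A Borel measurable random path with Hölder continuous realizations of order `lam > α` is
strongly measurable in `W_0^{α,∞}`. -/
theorem memL0W_of_holder {Ω : Type*} [MeasurableSpace Ω] (P : Measure Ω) {α lam : ℝ} (hab : a ≤ b)
    (hα : 0 ≤ α) (hαl : α < lam) {X : Ω → C(Icc a b, E d)} (hX : Measurable[_, borel _] X)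
    (hH : ∀ ω, ∃ K : ℝ, ∀ s t : Icc a b, ‖X ω s - X ω t‖ ≤ K * |(s : ℝ) - t| ^ lam) :
    MemL0W P α a b fun ω => IccExtend hab (X ω) := by
  borelize C(Icc a b, E d)
  -- Uniform density alone does not yield density in `W_0^{α,∞}`; hence dense countable sets are
  -- chosen inside the classes of paths with a fixed Hölder constant, where `exists_wNorm_le`
  -- upgrades the convergence.
  set S : ℕ → Set C(Icc a b, E d) := fun K =>
    {x | ∀ s t : Icc a b, ‖x s - x t‖ ≤ K * |(s : ℝ) - t| ^ lam} with hS
  choose D hDS hDc hDd using fun K =>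
    (TopologicalSpace.IsSeparable.of_separableSpace (S K)).exists_countable_dense_subset
  have h0 : (0 : C(Icc a b, E d)) ∈ S 0 := fun s t => by simp
  have hne : (⋃ K, D K).Nonempty := by
    obtain ⟨y, hy⟩ := closure_nonempty_iff.1 ⟨_, hDd 0 h0⟩
    exact ⟨y, mem_iUnion.2 ⟨0, hy⟩⟩
  obtain ⟨e, he⟩ := (countable_iUnion hDc).exists_eq_range hne
  have heS : ∀ n, ∃ K, e n ∈ S K := fun n => by
    have : e n ∈ ⋃ K, D K := he ▸ mem_range_self n
    obtain ⟨K, hK⟩ := mem_iUnion.1 this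
    exact ⟨K, hDS K hK⟩
  have hXS : ∀ ω, ∃ K, X ω ∈ S K := fun ω => by
    obtain ⟨K, hK⟩ := hH ω
    obtain ⟨n, hn⟩ := exists_nat_ge K
    exact ⟨n, fun s t => (hK s t).trans (by gcongr)⟩
  set w : C(Icc a b, E d) → ℝ≥0∞ := fun x => wNorm α a b (IccExtend hab x) with hw
  have hwm : Measurable w := (lowerSemicontinuous_wNorm hab α).measurable
  -- the best approximation among the first elements of the dense sequence
  have hmeas : ∀ (n : ℕ) (V : SimpleFunc Ω C(Icc a b, E d)),
      MeasurableSet {ω | w (e n - X ω) < w (V ω - X ω)} := fun n V =>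
    measurableSet_lt (hwm.comp (measurable_const.sub hX)) (hwm.comp (V.measurable.sub hX))
  set V : ℕ → SimpleFunc Ω C(Icc a b, E d) := fun n => Nat.rec (SimpleFunc.const Ω (e 0))
    (fun n V => SimpleFunc.piecewise _ (hmeas (n + 1) V) (SimpleFunc.const Ω (e (n + 1))) V) n
    with hV
  have hVs : ∀ n ω, w (e (n + 1) - X ω) < w (V n ω - X ω) ∧ V (n + 1) ω = e (n + 1) ∨
      ¬ w (e (n + 1) - X ω) < w (V n ω - X ω) ∧ V (n + 1) ω = V n ω := by
    intro n ω
    have hdef : V (n + 1) = SimpleFunc.piecewise _ (hmeas (n + 1) (V n))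
      (SimpleFunc.const Ω (e (n + 1))) (V n) := rfl
    by_cases h : w (e (n + 1) - X ω) < w (V n ω - X ω)
    · refine Or.inl ⟨h, ?_⟩
      rw [hdef]
      exact if_pos h
    · refine Or.inr ⟨h, ?_⟩
      rw [hdef]
      exact if_neg h
  have hVmem : ∀ n ω, ∃ K, V n ω ∈ S K := by
    intro n ω
    induction n with
    | zero => exact heS 0
    | succ n ih =>
      rcases hVs n ω with ⟨-, h⟩ | ⟨-, h⟩
      · rw [h]; exact heS _
      · rw [h]; exact ih
  have hVbest : ∀ ω n i, i ≤ n → w (V n ω - X ω) ≤ w (e i - X ω) := by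
    intro ω n
    induction n with
    | zero => intro i hi; rw [Nat.le_zero.1 hi]; exact le_rfl
    | succ n ih =>
      intro i hi
      rcases hVs n ω with ⟨h1, h2⟩ | ⟨h1, h2⟩ <;> rw [h2]
      · rcases Nat.le_succ_iff.1 hi with h | rfl
        · exact h1.le.trans (ih i h)
        · exact le_rfl
      · rcases Nat.le_succ_iff.1 hi with h | rfl
        · exact ih i h
        · exact not_lt.1 h1
  have happrox : ∀ ω, ∀ ε > 0, ∃ i, w (e i - X ω) ≤ ε := by
    intro ω ε hε
    obtain ⟨K, hK⟩ := hXS ω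
    -- The constant is doubled because the difference of two paths in `S K` is estimated.
    obtain ⟨ρ, hρ, H⟩ := exists_wNorm_le (d := d) (a := a) (b := b) (K := 2 * K) hα hαl
      (by positivity) hε
    obtain ⟨y, hy, hyd⟩ := Metric.mem_closure_iff.1 (hDd K hK) ρ hρ
    have : y ∈ ⋃ K, D K := mem_iUnion.2 ⟨K, hy⟩
    rw [he] at this
    obtain ⟨i, rfl⟩ := this
    refine ⟨i, H _ (fun t ht => ?_) (holder_extend hab fun s t => ?_)⟩
    · refine ((e i - X ω).norm_coe_le_norm _).trans ?_
      rw [← dist_eq_norm, dist_comm]; exact hyd.le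
    · have h1 := hDS K hy s t
      have h2 := hK s t
      rw [ContinuousMap.sub_apply, ContinuousMap.sub_apply, sub_sub_sub_comm]
      refine (norm_sub_le _ _).trans ?_
      linarith
  refine ⟨Eventually.of_forall fun ω => ?_, fun n => (V n).map fun x : C(Icc a b, E d) => IccExtend hab x, fun n ω => ?_,
    Eventually.of_forall fun ω => ?_⟩
  · obtain ⟨K, hK⟩ := hXS ω
    exact memW_of_holder hab hαl (Nat.cast_nonneg K) hK
  · obtain ⟨K, hK⟩ := hVmem n ω
    exact memW_of_holder hab hαl (Nat.cast_nonneg K) hK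
  · rw [ENNReal.tendsto_atTop_zero]
    intro ε hε
    obtain ⟨i, hi⟩ := happrox ω ε hε
    exact ⟨i, fun n hn => (hVbest ω n i hn).trans hi⟩

end Borel

/-! ### Construction of the solution -/

lemma MemHolder.exists_bound {d : ℕ} {lam a b : ℝ} {f : ℝ → E d} (hl : 0 ≤ lam)
    (h : MemHolder lam a b f) :
    ∃ D, 0 ≤ D ∧ ∀ s ∈ Icc a b, ∀ t ∈ Icc a b, ‖f s - f t‖ ≤ D * |s - t| ^ lam := by
  obtain ⟨C, hC⟩ := h
  refine ⟨C, C.coe_nonneg, fun s hs t ht => ?_⟩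
  have := hC s hs t ht
  rw [edist_dist, edist_dist, Real.coe_toNNReal _ hl, ENNReal.ofReal_rpow_of_nonneg dist_nonneg hl,
    ← ENNReal.ofReal_coe_nnreal, ← ENNReal.ofReal_mul C.coe_nonneg,
    ENNReal.ofReal_le_ofReal_iff (by positivity), dist_eq_norm, Real.dist_eq] at this
  exact this

lemma memHolder_of_bound {d : ℕ} {lam a b D : ℝ} {f : ℝ → E d} (hl : 0 ≤ lam)
    (h : ∀ s ∈ Icc a b, ∀ t ∈ Icc a b, ‖f s - f t‖ ≤ D * |s - t| ^ lam) :
    MemHolder lam a b f := by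
  refine ⟨D.toNNReal, fun s hs t ht => ?_⟩
  rw [edist_dist, edist_dist, Real.coe_toNNReal _ hl, ENNReal.ofReal_rpow_of_nonneg dist_nonneg hl,
    ← ENNReal.ofReal, ← ENNReal.ofReal_mul' (by positivity), dist_eq_norm, Real.dist_eq]
  exact ENNReal.ofReal_le_ofReal (h s hs t ht)

lemma norm_path_le {d : ℕ} {r T lam A : ℝ} (hr : 0 ≤ r) (hT : 0 ≤ T) (hl : 0 ≤ lam) (hA : 0 ≤ A)
    {x : C(Icc (-r) T, E d)} {v : E d} (h0 : ∀ u : Icc (-r) T, (u : ℝ) = 0 → x u = v)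
    (hx : ∀ s t : Icc (-r) T, ‖x s - x t‖ ≤ A * |(s : ℝ) - t| ^ lam) :
    ‖x‖ ≤ ‖v‖ + A * (T + r) ^ lam := by
  refine (ContinuousMap.norm_le _ (by positivity)).2 fun u => ?_
  have hm : (0 : ℝ) ∈ Icc (-r) T := ⟨by linarith, hT⟩
  have h1 := hx u ⟨0, hm⟩
  rw [h0 ⟨0, hm⟩ rfl] at h1
  have h2 : |(u : ℝ) - 0| ≤ T + r := by
    rw [sub_zero]; exact abs_le.2 ⟨by linarith [u.2.1], by linarith [u.2.2]⟩
  have h3 : ‖x u‖ ≤ ‖x u - v‖ + ‖v‖ := by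
    have := norm_add_le (x u - v) v
    rwa [sub_add_cancel] at this
  have h4 : A * |(u : ℝ) - 0| ^ lam ≤ A * (T + r) ^ lam := by gcongr
  linarith

/-! ### The method of steps for random drivers -/

section Construction

variable {d m : ℕ} {r T α β M : ℝ} {b : ℝ → C(Icc (-r) T, E d) → E d} {b₀ L : ℝ → ℝ} {C : ℝ}
  {σ : ℝ → E d → Mat d m} {η : ℝ → E d}

/-- One step of the method of steps, with a bound on the Hölder constants. -/
lemma exists_step (hb : DriftBounds r T α b b₀ L C) (hσ : DiffusionBounds T β M σ)
    (hr : 0 ≤ r) (hT : 0 ≤ T) (hrT : -r ≤ T) (hα0 : 0 < α) (hα1 : α < 1) (hα2 : α < 1 / 2)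
    (hαβ : α < β) (hβ : β ≤ 1)
    {D : ℝ} (hD : 0 ≤ D)
    (hη : ∀ s ∈ Icc (-r) 0, ∀ t ∈ Icc (-r) 0, ‖η s - η t‖ ≤ D * |s - t| ^ (1 - α)) :
    ∃ c : ℝ, 0 ≤ c ∧ ∀ (g : Fin m → ℝ → ℝ) (B : ℝ), 0 ≤ B →
      (∀ j, ∀ s ∈ Icc 0 T, ∀ t ∈ Icc 0 T, |g j s - g j t| ≤ B * |s - t| ^ (1 - α)) →
      ∀ (x : C(Icc (-r) T, E d)) (A : ℝ), 0 ≤ A →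
      (∀ s t : Icc (-r) T, ‖x s - x t‖ ≤ A * |(s : ℝ) - t| ^ (1 - α)) →
      (∀ u : Icc (-r) T, (u : ℝ) ≤ 0 → x u = η u) →
      ∃ z : C(Icc (-r) T, E d), IsYoungPath hrT η σ g x z ∧
        (∀ u : Icc (-r) T, (u : ℝ) ≤ 0 → hb.solve hT hα1 z u = η u) ∧
        ∀ s t : Icc (-r) T, ‖hb.solve hT hα1 z s - hb.solve hT hα1 z t‖ ≤
          c * ((1 + A) * (1 + B)) * |(s : ℝ) - t| ^ (1 - α) := by
  have hC := hb.const_nonneg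
  have hL := (hb.pos 0 le_rfl).le
  have hM := hσ.pos
  set K := youngPathConst d m T α β M ‖σ 0 (η (-r))‖ D with hK
  have hK0 : 0 ≤ K := by
    have : α < min β (1 - α) := lt_min hαβ (by linarith)
    have := youngConst_pos (θ := min β (1 - α) + (1 - α)) (by linarith)
    rw [hK]; unfold youngPathConst; positivity
  set R := Real.exp (L 0 * T) with hR
  have hR0 : 0 < R := Real.exp_pos _
  -- The Hölder constant from `holder_solve` with `Q = (1 + A) (1 + B)` factored out: both the
  -- Hölder constant of `z` and the a priori bound are at most linear in `Q`, and terms free of `Q`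
  -- are absorbed because `Q ≥ 1`.
  refine ⟨K + L 0 * ((‖η 0‖ + K * (T + r) ^ (1 - α) + C * T ^ (1 - α)) * R) * T ^ α + C,
    by positivity, fun g B hB hg x A hA hx hx0 => ?_⟩
  obtain ⟨z, hz, hzH⟩ := hσ.exists_isYoungPath hr hT hrT hα0 hα2 hαβ hβ hD hη hB hg hA hx
    (hx0 ⟨-r, left_mem_Icc.2 hrT⟩ (by simpa using hr))
  rw [← hK] at hzH
  refine ⟨z, hz, fun u hu => ?_, fun s t => ?_⟩
  · rw [hb.solve_apply, hz.1 u hu, max_eq_right hu, intervalIntegral.integral_same, add_zero]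
  · have hQ : 1 ≤ (1 + A) * (1 + B) := one_le_mul_of_one_le_of_one_le (by linarith) (by linarith)
    set Q := (1 + A) * (1 + B) with hQdef
    have hzn := norm_path_le hr hT (by linarith : 0 ≤ 1 - α) (by positivity : 0 ≤ K * Q)
      (v := η 0) (fun u hu => by rw [hz.1 u hu.le, hu]) hzH
    refine (hb.holder_solve hT hα0 hα1 hzH s t).trans ?_
    gcongr
    have hap : hb.aprioriBound z ≤
        (‖η 0‖ + K * (T + r) ^ (1 - α) + C * T ^ (1 - α)) * R * Q := by
      unfold DriftBounds.aprioriBound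
      rw [← hR]
      have h1 : ‖η 0‖ ≤ ‖η 0‖ * Q := le_mul_of_one_le_right (norm_nonneg _) hQ
      have h2 : C * T ^ (1 - α) ≤ C * T ^ (1 - α) * Q :=
        le_mul_of_one_le_right (by positivity) hQ
      calc (‖z‖ + C * T ^ (1 - α)) * R
          ≤ (‖η 0‖ * Q + K * Q * (T + r) ^ (1 - α) + C * T ^ (1 - α) * Q) * R := by
            gcongr; linarith
        _ = _ := by ring
    calc K * Q + L 0 * hb.aprioriBound z * T ^ α + C
        ≤ K * Q + L 0 * ((‖η 0‖ + K * (T + r) ^ (1 - α) + C * T ^ (1 - α)) * R * Q) * T ^ α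
          + C * Q := by
          gcongr
          exact le_mul_of_one_le_right hC hQ
      _ = _ := by ring

variable {Ω : Type*} [MeasurableSpace Ω]

/-- At each time the Young integral is the limit of sums over uniform partitions that do not depend
on `ω`, and these sums are measurable in `ω`. -/
lemma measurable_isYoungPath (hσ : DiffusionBounds T β M σ) (hrT : -r ≤ T)
    {W : Fin m → ℝ → Ω → ℝ} (hW : ∀ j t, Measurable (W j t)) {X Z : Ω → C(Icc (-r) T, E d)}
    (hX : Measurable[_, borel _] X)
    (hZ : ∀ ω, IsYoungPath hrT η σ (fun j t => W j t ω) (X ω) (Z ω)) :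
    Measurable[_, borel _] Z := by
  borelize C(Icc (-r) T, E d)
  have hXt : ∀ t, Measurable fun ω => IccExtend hrT (X ω) t := fun t =>
    (continuous_eval_const (F := C(Icc (-r) T, E d)) (projIcc (-r) T hrT t)).measurable.comp hX
  have hσm : ∀ t ∈ Icc 0 T, Measurable (σ t) := fun t ht =>
    (LipschitzWith.of_dist_le_mul (K := M.toNNReal) fun x y => by
      rw [dist_eq_norm, dist_eq_norm, Real.coe_toNNReal _ hσ.pos.le]
      exact hσ.lipschitz t ht x y).continuous.measurable
  have := measurable_path_of_eval (X := Z) fun u => ?_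
  · rwa [← BorelSpace.measurable_eq (α := C(Icc (-r) T, E d))] at this
  rcases le_total (u : ℝ) 0 with hu | hu
  · have : (fun ω => Z ω u) = fun _ => η u := funext fun ω => (hZ ω).1 u hu
    rw [this]; exact measurable_const
  · choose J hJ hJz using fun ω => (hZ ω).2 u hu
    have hJm : ∀ i j, Measurable fun ω => J ω i j := by
      intro i j
      refine measurable_of_tendsto_metrizable (fun n => ?_)
        (tendsto_pi_nhds.2 fun ω => (hJ ω i j).tendsto_uniform hu)
      refine Finset.measurable_fun_sum _ fun k hk => ?_
      have hk' : (k : ℝ) ≤ n + 1 := by exact_mod_cast (Finset.mem_range.1 hk).le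
      have hmem : (k : ℝ) * u / (n + 1) ∈ Icc 0 T := by
        refine ⟨by positivity, ?_⟩
        rw [div_le_iff₀ (by positivity)]
        have := u.2.2
        calc (k : ℝ) * u ≤ (n + 1) * T := by gcongr
          _ = _ := by ring
      refine Measurable.mul ?_ ((hW j _).sub (hW j _))
      exact (PiLp.continuous_apply 2 (fun _ : Fin d × Fin m => ℝ) (i, j)).measurable.comp
        ((hσm _ hmem).comp (hXt _))
    have heq : (fun ω => Z ω u) =
        fun ω => WithLp.toLp 2 fun i => η 0 i + ∑ j, J ω i j := by
      funext ω; ext i; exact hJz ω i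
    rw [heq]
    refine (PiLp.continuous_toLp 2 (fun _ : Fin d => ℝ)).measurable.comp
      (measurable_pi_lambda _ fun i => ?_)
    exact measurable_const.add (Finset.measurable_fun_sum _ fun j _ => hJm i j)

/-- The method of steps: for a measurable driver with `(1-α)`-Hölder paths there is a Borel
measurable random path solving the equation, whose Hölder constant is bounded by a polynomial of
the Hölder constant of the driver. -/
theorem exists_solution (hb : DriftBounds r T α b b₀ L C) (hσ : DiffusionBounds T β M σ)
    (hr : 0 < r) (hT : 0 ≤ T) (hrT : -r ≤ T) (hα0 : 0 < α) (hα2 : α < 1 / 2)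
    (hαβ : α < β) (hβ : β ≤ 1) {D : ℝ} (hD : 0 ≤ D)
    (hη : ∀ s ∈ Icc (-r) 0, ∀ t ∈ Icc (-r) 0, ‖η s - η t‖ ≤ D * |s - t| ^ (1 - α))
    {W : Fin m → ℝ → Ω → ℝ} (hW : ∀ j t, Measurable (W j t)) {B : Ω → ℝ} (hB : ∀ ω, 0 ≤ B ω)
    (hWH : ∀ ω j, ∀ s ∈ Icc 0 T, ∀ t ∈ Icc 0 T,
      |W j s ω - W j t ω| ≤ B ω * |s - t| ^ (1 - α)) :
    ∃ X : Ω → C(Icc (-r) T, E d), Measurable[_, borel _] X ∧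
      (∀ ω, SolvesDelayEq r T η b σ (fun j t => W j t ω) (IccExtend hrT (X ω))) ∧
      (∀ ω, ∀ u : Icc (-r) T, (u : ℝ) ≤ 0 → X ω u = η u) ∧
      ∃ (c : ℝ) (k : ℕ), 0 ≤ c ∧ ∀ ω, ∀ s t : Icc (-r) T,
        ‖X ω s - X ω t‖ ≤ c * (1 + B ω) ^ k * |(s : ℝ) - t| ^ (1 - α) := by
  have hα1 : α < 1 := by linarith
  obtain ⟨c, hc, hstep⟩ := exists_step hb hσ hr.le hT hrT hα0 hα1 hα2 hαβ hβ hD hη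
  -- The invariant of the iteration: measurability, the initial condition, and a Hölder constant
  -- polynomial in that of the driver, uniformly in `ω`.
  let Good : (Ω → C(Icc (-r) T, E d)) → Prop := fun X => Measurable[_, borel _] X ∧
    (∀ ω, ∀ u : Icc (-r) T, (u : ℝ) ≤ 0 → X ω u = η u) ∧
    ∃ (c : ℝ) (k : ℕ), 0 ≤ c ∧ ∀ ω, ∀ s t : Icc (-r) T,
      ‖X ω s - X ω t‖ ≤ c * (1 + B ω) ^ k * |(s : ℝ) - t| ^ (1 - α)
  have hnext : ∀ X, Good X → ∃ Z : Ω → C(Icc (-r) T, E d),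
      (∀ ω, IsYoungPath hrT η σ (fun j t => W j t ω) (X ω) (Z ω)) ∧
      Good fun ω => hb.solve hT hα1 (Z ω) := by
    rintro X ⟨hXm, hX0, c', k, hc', hXH⟩
    choose Z hZ hZ0 hZH using fun ω => hstep (fun j t => W j t ω) (B ω) (hB ω) (hWH ω) (X ω)
      (c' * (1 + B ω) ^ k) (by have := hB ω; positivity) (hXH ω) (hX0 ω)
    refine ⟨Z, hZ, ?_, hZ0, c * (1 + c'), k + 1, by positivity, fun ω s t => ?_⟩
    · have hZm := measurable_isYoungPath hσ hrT hW hXm hZ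
      borelize C(Icc (-r) T, E d)
      exact (hb.continuous_solve hT hα1).measurable.comp hZm
    · refine (hZH ω s t).trans ?_
      have h1 : 1 ≤ (1 + B ω) ^ k := one_le_pow₀ (by linarith [hB ω])
      have h2 := hB ω
      refine mul_le_mul_of_nonneg_right ?_ (by positivity)
      calc c * ((1 + c' * (1 + B ω) ^ k) * (1 + B ω))
          ≤ c * (((1 + B ω) ^ k + c' * (1 + B ω) ^ k) * (1 + B ω)) := by gcongr
        _ = _ := by ring
  choose! Z hZ hgood using hnext
  have hmin : ∀ u : Icc (-r) T, min (u : ℝ) 0 ∈ Icc (-r) 0 := fun u =>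
    ⟨le_min u.2.1 (by linarith), min_le_right _ _⟩
  have hH0 : ∀ s t : Icc (-r) T, ‖η (min (s : ℝ) 0) - η (min (t : ℝ) 0)‖ ≤
      D * |(s : ℝ) - t| ^ (1 - α) := fun s t => by
    refine (hη _ (hmin s) _ (hmin t)).trans ?_
    have h3 : |min (s : ℝ) 0 - min (t : ℝ) 0| ≤ |(s : ℝ) - t| := by
      have := abs_min_sub_min_le_max (s : ℝ) 0 t 0
      simpa using this
    have : 0 ≤ 1 - α := by linarith
    gcongr
  have hηc : ContinuousOn η (Icc (-r) 0) := by
    obtain ⟨K, hK⟩ := memHolder_of_bound (by linarith : 0 ≤ 1 - α) hη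
    exact hK.continuousOn (by simpa using hα1)
  have hcont0 : Continuous fun u : Icc (-r) T => η (min (u : ℝ) 0) :=
    hηc.comp_continuous (by fun_prop) hmin
  -- The iteration starts from `η` frozen at its value `η 0` after time `0`.
  let X₀ : Ω → C(Icc (-r) T, E d) := fun _ => ⟨fun u => η (min (u : ℝ) 0), hcont0⟩
  have hX₀ : Good X₀ := by
    refine ⟨?_, fun ω u hu => ?_, D, 0, hD, fun ω s t => ?_⟩
    · borelize C(Icc (-r) T, E d)
      exact measurable_const
    · show η (min (u : ℝ) 0) = _
      rw [min_eq_left hu]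
    · rw [pow_zero, mul_one]; exact hH0 s t
  let X : ℕ → Ω → C(Icc (-r) T, E d) := fun n => (fun Y ω => hb.solve hT hα1 (Z Y ω))^[n] X₀
  have hXs : ∀ n ω, X (n + 1) ω = hb.solve hT hα1 (Z (X n) ω) := fun n ω =>
    congrFun (Function.iterate_succ_apply' (fun Y ω => hb.solve hT hα1 (Z Y ω)) n X₀) ω
  have hXgood : ∀ n, Good (X n) := by
    intro n
    induction n with
    | zero => exact hX₀
    | succ n ih =>
      have : X (n + 1) = fun ω => hb.solve hT hα1 (Z (X n) ω) := funext (hXs n)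
      rw [this]; exact hgood _ ih
  -- Each application of the map extends the interval of agreement by `r`.
  have hagree : ∀ ω, ∀ n : ℕ, ∀ u : Icc (-r) T, (u : ℝ) ≤ n * r → X n ω u = X (n + 1) ω u := by
    intro ω n
    induction n with
    | zero =>
      intro u hu
      have hu : (u : ℝ) ≤ 0 := by simpa using hu
      rw [(hXgood 0).2.1 ω u hu, (hXgood 1).2.1 ω u hu]
    | succ n ih =>
      rw [hXs n, hXs (n + 1)]
      refine hb.eqOn_of_fixed hT (z := Z (X n) ω) (z' := Z (X (n + 1)) ω) (fun u hu => ?_)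
        (fun u _ => by rw [hb.picard_solve]) (fun u _ => by rw [hb.picard_solve])
      refine (hZ _ (hXgood n) ω).eqOn hr.le (hZ _ (hXgood (n + 1)) ω) ih u ?_
      push_cast at hu; linarith
  -- Once `n r > T`, the iterates `n` and `n + 1` coincide on all of `[-r,T]`, so `X n` is an exact
  -- solution; `n` does not depend on `ω`.
  obtain ⟨n, hn⟩ := exists_nat_gt (T / r)
  rw [div_lt_iff₀ hr] at hn
  have hfix : ∀ ω, hb.picard hT (Z (X n) ω) (X n ω) = X n ω := fun ω => by
    have : X n ω = X (n + 1) ω := by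
      ext1 u
      exact hagree ω n u (u.2.2.trans hn.le)
    rw [this, hXs, hb.picard_solve]
  obtain ⟨hm, h0, c', k, hc', hH⟩ := hXgood n
  exact ⟨X n, hm, fun ω => solvesDelayEq_of_fixed hb hT hrT (hZ _ (hXgood n) ω) (hfix ω) hr.le,
    h0, c', k, hc', hH⟩

end Construction

/-- Moments of a polynomial of a sum of random variables with all moments. -/
lemma lintegral_polynomial_lt_top {Ω : Type*} [MeasurableSpace Ω] {P : Measure Ω}
    [IsProbabilityMeasure P] {m : ℕ} {G : Fin m → Ω → ℝ} (hG : ∀ j, Measurable (G j))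
    (hG0 : ∀ j ω, 0 ≤ G j ω)
    (hmom : ∀ j, ∀ p : ℝ, 1 ≤ p → ∫⁻ ω, ENNReal.ofReal (G j ω) ^ p ∂P < ∞) (c : ℝ) (k : ℕ) {p : ℝ}
    (hp : 1 ≤ p) :
    ∫⁻ ω, ENNReal.ofReal (c * (1 + ∑ j, G j ω) ^ k) ^ p ∂P < ∞ := by
  -- The exponent is `(k + 1) p` instead of `k p`, so that `q ≥ 1` also when `k = 0`.
  obtain ⟨q, hq⟩ : ∃ q : ℝ, q = (k + 1 : ℕ) * p := ⟨_, rfl⟩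
  have hk1 : (1 : ℝ) ≤ (k + 1 : ℕ) := by push_cast; linarith [Nat.cast_nonneg (α := ℝ) k]
  have hq1 : 1 ≤ q := hq ▸ one_le_mul_of_one_le_of_one_le hk1 hp
  have hq0 : 0 < q := by linarith
  have hmem : ∀ j, MemLp (G j) (ENNReal.ofReal q) P := fun j => by
    refine ⟨(hG j).aestronglyMeasurable, ?_⟩
    rw [eLpNorm_lt_top_iff_lintegral_rpow_enorm_lt_top (by simpa using hq0) ENNReal.ofReal_ne_top,
      ENNReal.toReal_ofReal hq0.le]
    simp only [Real.enorm_of_nonneg (hG0 j _)]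
    exact hmom j q hq1
  have hsum' : MemLp (fun ω => ∑ j, G j ω) (ENNReal.ofReal q) P :=
    memLp_finsetSum _ fun j _ => hmem j
  have hone : MemLp (fun _ : Ω => (1 : ℝ)) (ENNReal.ofReal q) P := memLp_const 1
  have hsum : MemLp (fun ω => 1 + ∑ j, G j ω) (ENNReal.ofReal q) P := hone.add hsum'
  have hfin := lintegral_rpow_enorm_lt_top_of_eLpNorm_lt_top (by simpa using hq0)
    ENNReal.ofReal_ne_top hsum.2
  rw [ENNReal.toReal_ofReal hq0.le] at hfin
  have hle : ∀ ω, ENNReal.ofReal (c * (1 + ∑ j, G j ω) ^ k) ^ p ≤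
      ENNReal.ofReal |c| ^ p * ‖1 + ∑ j, G j ω‖ₑ ^ q := by
    intro ω
    have h0 : 0 ≤ ∑ j, G j ω := Finset.sum_nonneg fun j _ => hG0 j ω
    rw [Real.enorm_of_nonneg (by linarith), hq, ENNReal.rpow_mul, ENNReal.rpow_natCast,
      ← ENNReal.mul_rpow_of_nonneg _ _ (by linarith), ← ENNReal.ofReal_pow (by linarith),
      ← ENNReal.ofReal_mul (abs_nonneg _)]
    refine ENNReal.rpow_le_rpow (ENNReal.ofReal_le_ofReal ?_) (by linarith)
    have h1 : (1 + ∑ j, G j ω) ^ k ≤ (1 + ∑ j, G j ω) ^ (k + 1) :=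
      pow_le_pow_right₀ (by linarith) (Nat.le_succ k)
    exact mul_le_mul (le_abs_self c) h1 (by positivity) (abs_nonneg c)
  refine (lintegral_mono hle).trans_lt ?_
  rw [lintegral_const_mul' _ _ (ENNReal.rpow_ne_top_of_nonneg (by linarith) ENNReal.ofReal_ne_top)]
  exact ENNReal.mul_lt_top
    (ENNReal.rpow_lt_top_of_nonneg (by linarith) ENNReal.ofReal_ne_top) hfin

end DelayFBM

/-! ### The main theorem -/

theorem theorem1p1 {Ω : Type*} [MeasurableSpace Ω] (P : Measure Ω) [IsProbabilityMeasure P]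
    (d m : ℕ) (r T H α α₀ β δ : ℝ) (ρ : ℝ≥0∞)
    (hr : 0 < r) (hT : 0 < T) (hH : 1 / 2 < H) (hH1 : H < 1)
    (W : Fin m → ℝ → Ω → ℝ) (hW : ∀ j, DelayFBM.IsFBM H T (W j) P)
    (hWindep : iIndepFun (fun j ω => fun t : Icc (0 : ℝ) T => W j t ω) P)
    (b : ℝ → C(Icc (-r) T, DelayFBM.E d) → DelayFBM.E d)
    (σ : ℝ → DelayFBM.E d → DelayFBM.Mat d m) (η : ℝ → DelayFBM.E d)
    (h1 : DelayFBM.HypH1 T β δ σ) (h2 : DelayFBM.HypH2 r T ρ b)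
    (hβ : 1 - H < β) (hδ : 1 / H - 1 < δ)
    (hα₀ : α₀ = min (1 / 2) (min β (δ / (1 + δ))))
    (hα : α ∈ Ioo (1 - H) α₀) (hρ : ENNReal.ofReal (1 / α) ≤ ρ)
    (hηW : DelayFBM.MemW α (-r) 0 η) (hηC : DelayFBM.MemHolder (1 - α) (-r) 0 η) :
    ∃ X : Ω → ℝ → DelayFBM.E d,
      -- existence in `L^0(Ω, F, P; W_0^{α,∞}(-r,T; ℝ^d))`
      DelayFBM.MemL0W P α (-r) T X ∧
      (∀ᵐ ω ∂P, DelayFBM.SolvesDelayEq r T η b σ (fun j t => W j t ω) (X ω)) ∧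
      -- uniqueness
      (∀ Y : Ω → ℝ → DelayFBM.E d,
        (∀ᵐ ω ∂P, DelayFBM.MemW α (-r) T (Y ω) ∧
          DelayFBM.SolvesDelayEq r T η b σ (fun j t => W j t ω) (Y ω)) →
        ∀ᵐ ω ∂P, ∀ t ∈ Icc (-r) T, Y ω t = X ω t) ∧
      -- Hölder regularity
      (∀ᵐ ω ∂P, DelayFBM.MemHolder (1 - α) (-r) T (X ω)) ∧
      -- moments
      (∀ γ : ℝ, DelayFBM.HypH3 T γ σ → ∀ α' ∈ Ioo (1 - H) (max α₀ ((2 - γ) / 4)),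
        AEMeasurable (fun ω => DelayFBM.wNorm α' (-r) T (X ω)) P ∧
        ∀ p : ℝ, 1 ≤ p → ∫⁻ ω, DelayFBM.wNorm α' (-r) T (X ω) ^ p ∂P < ∞) := by
  have hrT : -r ≤ T := by linarith
  have hα₀half : α₀ ≤ 1 / 2 := hα₀ ▸ min_le_left _ _
  have hα₀β : α₀ ≤ β := hα₀ ▸ (min_le_right _ _).trans (min_le_left _ _)
  have hα0 : 0 < α := by linarith [hα.1]
  have hα2 : α < 1 / 2 := hα.2.trans_le hα₀half
  have hαβ : α < β := hα.2.trans_le hα₀β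
  have hlam : 0 < 1 - α := by linarith
  obtain ⟨M, hσ⟩ := h1.exists_diffusionBounds
  obtain ⟨b₀, L, C, hb⟩ := h2.exists_driftBounds hT.le hα0 (by linarith) hρ
  obtain ⟨D, hD, hη⟩ := hηC.exists_bound hlam.le
  -- The Hölder order `1 - α` is admissible for the driver because `α > 1 - H`.
  choose V G hVm hGm hG0 hVH hGmom hVW using fun j =>
    (hW j).exists_holder_version hT hlam (by linarith [hα.1])
  have hVW' : ∀ᵐ ω ∂P, ∀ j, ∀ t ∈ Icc 0 T, V j t ω = W j t ω := ae_all_iff.2 hVW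
  obtain ⟨X, hXm, hXs, hX0, c, k, hc, hXH⟩ := DelayFBM.exists_solution hb hσ hr hT.le hrT hα0 hα2
    hαβ h1.beta_mem.2 hD hη hVm (B := fun ω => ∑ j, G j ω)
    (fun ω => Finset.sum_nonneg fun j _ => hG0 j ω) (fun ω j s hs t ht => by
      refine (hVH j ω s hs t ht).trans ?_
      gcongr
      exact Finset.single_le_sum (f := fun j => G j ω) (fun j _ => hG0 j ω) (Finset.mem_univ j))
  have hsol : ∀ᵐ ω ∂P,
      DelayFBM.SolvesDelayEq r T η b σ (fun j t => W j t ω) (IccExtend hrT (X ω)) := by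
    filter_upwards [hVW'] with ω hω
    exact (hXs ω).congr_driver hω
  refine ⟨fun ω => IccExtend hrT (X ω), ?_, hsol, fun Y hY => ?_, Eventually.of_forall fun ω => ?_,
    fun γ hγ α' hα' => ⟨?_, fun p hp => ?_⟩⟩
  · exact DelayFBM.memL0W_of_holder P hrT hα0.le (by linarith : α < 1 - α) hXm
      fun ω => ⟨_, hXH ω⟩
  · filter_upwards [hY, hsol] with ω hω hω'
    exact hω.2.eqOn hb hr hT.le hω'
  · exact DelayFBM.memHolder_of_bound hlam.le (DelayFBM.holder_extend hrT (hXH ω))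
  · exact ((DelayFBM.measurable_wNorm hrT α').comp hXm).aemeasurable
  -- Since `γ ≥ 0`, both `α₀` and `(2 - γ) / 4` are at most `1/2`, so `α' < 1/2 < 1 - α` and the
  -- Hölder bound controls the norm with exponent `α'`.
  · have hα'2 : α' < 1 - α := by
      have h3 : max α₀ ((2 - γ) / 4) ≤ 1 / 2 := max_le hα₀half (by linarith [hγ.1])
      linarith [hα'.2]
    set κ := 1 - α - α' with hκ
    have hκ0 : 0 < κ := by linarith
    have hTr : 0 ≤ T + r := by linarith
    -- The first two terms bound the sup norm through the value at time `0`, the last one the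
    -- singular integral.
    set c' := ‖η 0‖ + c * (T + r) ^ (1 - α) + c * ((T - -r) ^ κ / κ) with hc'
    refine lt_of_le_of_lt (lintegral_mono fun ω => ?_)
      (DelayFBM.lintegral_polynomial_lt_top hGm hG0 hGmom c' k hp)
    have hB0 : 0 ≤ ∑ j, G j ω := Finset.sum_nonneg fun j _ => hG0 j ω
    set Q := (1 + ∑ j, G j ω) ^ k with hQ
    have hQ1 : 1 ≤ Q := one_le_pow₀ (by linarith)
    have hnorm := DelayFBM.norm_path_le hr.le hT.le hlam.le (by positivity : 0 ≤ c * Q)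
      (v := η 0) (fun u hu => by rw [hX0 ω u hu.le, hu]) (hXH ω)
    have hw := DelayFBM.wNorm_le_of_holder (S := ‖X ω‖) hα'2 (by positivity : 0 ≤ c * Q)
      (fun t _ => (X ω).norm_coe_le_norm _) (DelayFBM.holder_extend hrT (hXH ω))
    gcongr
    refine hw.trans (ENNReal.ofReal_le_ofReal ?_)
    have h3 : ‖η 0‖ ≤ ‖η 0‖ * Q := le_mul_of_one_le_right (norm_nonneg _) hQ1
    calc _ ≤ ‖η 0‖ * Q + c * Q * (T + r) ^ (1 - α) + c * Q * ((T - -r) ^ κ / κ) := by linarith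
      _ = c' * Q := by rw [hc']; ring
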